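/- Let $\lambda_q=2^q$. Fix a nonnegative radial $\chi\in C_0^\infty(B(0,1))$ on $\mathbb R^3$ with $\chi(\xi)=1$ for $|\xi|\le 1/2$, put $\varphi(\xi)=\chi(\xi/2)-\chi(\xi)$, and let $\Delta_{-1}$, $\Delta_q$ ($q\ge 0$) and $S_Q=\sum_{q=-1}^{Q}\Delta_q$ be the Fourier multipliers with symbols $\chi(\xi)$, $\varphi(\lambda_q^{-1}\xi)$ and $\chi(\lambda_{Q+1}^{-1}\xi)$. Let $B^{2/3}_{3,c(\mathbb N)}$ be the class of tempered distributions $u$ with $\lim_{q\to\infty}\lambda_q^{2/3}\|\Delta_q u\|_{L^3}=0$, with the norm $\|\Delta_{-1}u\|_{L^3}+\sup_{q\ge 0}\lambda_q^{2/3}\|\Delta_q u\|_{L^3}$ of $B^{2/3}_{3,\infty}$. For a real divergence-free vector field $u\in H^{1/2}(\mathbb R^3)$ with vorticity $\omega=\nabla\times u\in H^{-1/2}$, define the helicity $\mathcal H(u)=\int_{\mathbb R^3} u\cdot\omega\,dx$ (duality of $H^{1/2}$ and $H^{-1/2}$) and the truncated helicity flux $$\mathcal H_Q=\int_{\mathbb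 R^3}\mathrm{Tr}\big[S_Q(u\otimes u)\cdot\nabla S_Q\omega+S_Q(u\wedge\omega)\cdot\nabla S_Q u\big]\,dx,\qquad Q\in\mathbb N,$$ where $u\wedge\omega=u\otimes\omega-\omega\otimes u$, the products $u_i\omega_j$ are understood as the distributions $\psi\mapsto\langle\omega_j,\psi u_i\rangle$, and $\mathrm{Tr}[A\cdot\nabla v]=\sum_{i,j}A_{ij}\,\partial_i v_j$. Let $b_q=\lambda_q^{2/3}\|\Delta_q u\|_{L^3}$ for $q\ge -1$, let $T(q)=\lambda_q^{4/3}$ for $q\le 0$ and $T(q)=\lambda_q^{-2/3}$ for $q>0$, and $(T*b^2)(Q)=\sum_{q\ge -1}T(Q-q)\,b_q^2$. 1. There is a constant $C$, depending only on $\chi$, such that for every divergence-free $u\in H^{1/2}(\mathbb R^3)$ and every $Q\in\mathbb N$ the integral defining $\mathcal H_Q$ converges absolutely and $|\mathcal H_Q|\le C\,\big((T*b^2)(Q)\big)^{3/2}$. 2. For every divergence-free $u\in B^{2/3}_{3,c(\mathbb N)}\cap H^{1/2}$, $\lim_{Q\to\infty}\mathcal H_Q=0$. 3. Let $\tau>0$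 and let $u\in C_w([0,\tau];L^2(\mathbb R^3))$ be a weak solution of the Euler equations: $\nabla\cdot u(t)=0$ in the sense of distributions for every $t\in[0,\tau]$, and for every $\psi\in C^1([0,\tau];\mathcal S(\mathbb R^3))$ with $\nabla_x\cdot\psi=0$ and every $t\in[0,\tau]$, $$(u(t),\psi(t))-(u(0),\psi(0))-\int_0^t(u(s),\partial_s\psi(s))\,ds=\int_0^t\int_{\mathbb R^3}(u\cdot\nabla\psi)\cdot u\,dx\,ds .$$ If $u\in L^3([0,\tau];B^{2/3}_{3,c(\mathbb N)})\cap L^\infty([0,\tau];H^{1/2})$, then $u(t)\in H^{1/2}$ and $\mathcal H(u(t))=\mathcal H(u(0))$ for every $t\in[0,\tau]$. -/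

import Mathlib

open MeasureTheory TemperedDistribution FourierTransform LineDeriv SchwartzMap Set Filter
open scoped ENNReal NNReal Topology ContDiff

namespace HelicityFlux

noncomputable section

/-- Physical space `ℝ³`. -/
abbrev E3 := EuclideanSpace ℝ (Fin 3)

/-- `ℂ³`, the target of the complexified vector fields. -/
abbrev C3 := EuclideanSpace ℂ (Fin 3)

/-- The standard basis vectors of `ℝ³`. -/
def stdVec (i : Fin 3) : E3 := EuclideanSpace.single i 1

/-! ### Littlewood-Paley decomposition -/

/-- A cut-off function `χ`: nonnegative, radial, in `C_0^∞(B(0,1))`, equal to `1` on `|ξ| ≤ 1/2`. -/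
structure Cutoff where
  toFun : E3 → ℝ
  smooth : ContDiff ℝ ∞ toFun
  nonneg : ∀ ξ, 0 ≤ toFun ξ
  radial : ∀ ξ η, ‖ξ‖ = ‖η‖ → toFun ξ = toFun η
  hasCompactSupport : HasCompactSupport toFun
  tsupport_subset : tsupport toFun ⊆ Metric.ball 0 1
  eq_one : ∀ ξ, ‖ξ‖ ≤ 1 / 2 → toFun ξ = 1

/-- `χ(λ_q⁻¹ ξ)` with `λ_q = 2^q`. -/
def Cutoff.dilate (χ : Cutoff) (q : ℤ) (ξ : E3) : ℝ := χ.toFun (((2 : ℝ) ^ q)⁻¹ • ξ)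

/-- `φ(ξ) = χ(λ_1⁻¹ ξ) - χ(ξ)`. -/
def Cutoff.phi (χ : Cutoff) (ξ : E3) : ℝ := χ.dilate 1 ξ - χ.toFun ξ

/-- The symbol of `Δ_q`: `φ(λ_q⁻¹ ξ)` for `q ≥ 0`, `χ(ξ)` for `q = -1`. There are no blocks with
`q < -1`; they are set to zero. -/
def Cutoff.blockSymbol (χ : Cutoff) (q : ℤ) (ξ : E3) : ℝ :=
  if 0 ≤ q then χ.phi (((2 : ℝ) ^ q)⁻¹ • ξ) else if q = -1 then χ.toFun ξ else 0

/-- The symbol `χ(λ_{Q+1}⁻¹ ξ)` of `S_Q = ∑_{q=-1}^Q Δ_q`. -/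
def Cutoff.lowSymbol (χ : Cutoff) (Q : ℕ) (ξ : E3) : ℝ := χ.dilate (Q + 1) ξ

theorem Cutoff.sum_blockSymbol (χ : Cutoff) (Q : ℕ) (ξ : E3) :
    χ.blockSymbol (-1) ξ + ∑ q ∈ Finset.range (Q + 1), χ.blockSymbol q ξ = χ.lowSymbol Q ξ := by
  have h : ∀ q : ℕ, χ.blockSymbol q ξ = χ.dilate (q + 1) ξ - χ.dilate q ξ := by
    intro q
    simp only [blockSymbol, phi, dilate, Int.natCast_nonneg, if_true, smul_smul]
    rw [← mul_inv, ← zpow_add₀ (two_ne_zero), add_comm (1 : ℤ)]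
  have h1 : χ.blockSymbol (-1) ξ = χ.dilate 0 ξ := by simp [blockSymbol, dilate]
  rw [h1, lowSymbol]
  induction Q with
  | zero => simp [h]
  | succ n ih => rw [Finset.sum_range_succ, ← add_assoc, ih, h]; push_cast; ring

/-- The block `Δ_q` acting on tempered (vector) distributions. Frequencies `ξ` are angular, i.e.
dual to `x` through `e^{i x·ξ}`; since `𝓕` uses `e^{-2πi x·ξ}`, this is the factor `2π`. -/
def Cutoff.block (χ : Cutoff) (q : ℤ) (f : 𝓢'(E3, C3)) : 𝓢'(E3, C3) :=
  fourierMultiplierCLM C3 (fun ξ ↦ (χ.blockSymbol q ((2 * Real.pi) • ξ) : ℂ)) f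

/-- The symbol of `S_Q` as a Schwartz function. -/
def Cutoff.lowSchwartz (χ : Cutoff) (Q : ℕ) : 𝓢(E3, ℂ) :=
  HasCompactSupport.toSchwartzMap
    (f := fun ξ : E3 ↦ (χ.lowSymbol Q ((2 * Real.pi) • ξ) : ℂ))
    (by
      have h : HasCompactSupport (fun ξ : E3 ↦ χ.lowSymbol Q ((2 * Real.pi) • ξ)) := by
        unfold lowSymbol dilate
        have := χ.hasCompactSupport.comp_smul
          (c := ((2 : ℝ) ^ ((Q : ℤ) + 1))⁻¹ * (2 * Real.pi)) (by positivity)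
        simpa only [smul_smul] using this
      exact h.comp_left (g := fun r : ℝ ↦ (r : ℂ)) Complex.ofReal_zero)
    (by
      have h : ContDiff ℝ ∞ (fun ξ : E3 ↦ χ.lowSymbol Q ((2 * Real.pi) • ξ)) := by
        unfold lowSymbol dilate
        exact χ.smooth.comp ((contDiff_id.const_smul _).const_smul _)
      exact Complex.ofRealCLM.contDiff.comp h)

/-- The function `y ↦ k_Q(x - y)`, where `k_Q` is the inverse Fourier transform of the symbol of
`S_Q` (see `lowKernel_apply`). -/
def Cutoff.lowKernel (χ : Cutoff) (Q : ℕ) (x : E3) : 𝓢(E3, ℂ) :=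
  (𝓕 (χ.lowSchwartz Q)).compSubConstCLM ℂ x

theorem Cutoff.lowKernel_apply (χ : Cutoff) (Q : ℕ) (x y : E3) :
    χ.lowKernel Q x y = (𝓕⁻ (χ.lowSchwartz Q)) (x - y) := by
  rw [lowKernel, compSubConstCLM_apply, SchwartzMap.fourierInv_apply_eq]
  simp

/-- `S_Q f` as a function, `(S_Q f)(x) = ⟨f, k_Q(x - ·)⟩`, for a functional `f` on Schwartz
functions. -/
def Cutoff.low (χ : Cutoff) (Q : ℕ) (f : 𝓢(E3, ℂ) → ℂ) (x : E3) : ℂ := f (χ.lowKernel Q x)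

/-! ### Norms and the duality pairing -/

instance fact_one_le_three : Fact ((1 : ℝ≥0∞) ≤ 3) := ⟨by norm_num⟩

/-- The `L^p` norm of a tempered distribution, `∞` if it is not an `L^p` function. -/
def distLpNorm (p : ℝ≥0∞) [Fact (1 ≤ p)] (f : 𝓢'(E3, C3)) : ℝ≥0∞ :=
  ⨅ (g : Lp C3 p (volume : Measure E3)) (_ : f = g), ‖g‖ₑ

/-- The `H^s` norm of a tempered distribution, `∞` if it is not in `H^s`. -/
def sobolevNorm (s : ℝ) (f : 𝓢'(E3, C3)) : ℝ≥0∞ := distLpNorm 2 (besselPotential E3 C3 s f)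

/-- `λ_q^s ‖Δ_q f‖_p`. -/
def weightedBlock (χ : Cutoff) (s : ℝ) (p : ℝ≥0∞) [Fact (1 ≤ p)] (f : 𝓢'(E3, C3)) (q : ℤ) :
    ℝ≥0∞ :=
  ENNReal.ofReal (((2 : ℝ) ^ q) ^ s) * distLpNorm p (χ.block q f)

/-- The norm of `B^s_{p,∞}`. -/
def besovNorm (χ : Cutoff) (s : ℝ) (p : ℝ≥0∞) [Fact (1 ≤ p)] (f : 𝓢'(E3, C3)) : ℝ≥0∞ :=
  distLpNorm p (χ.block (-1) f) + ⨆ q : ℕ, weightedBlock χ s p f q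

/-- The class `B^s_{p,c(ℕ)}`: `λ_q^s ‖Δ_q f‖_p → 0` as `q → ∞`. -/
def MemBesovC (χ : Cutoff) (s : ℝ) (p : ℝ≥0∞) [Fact (1 ≤ p)] (f : 𝓢'(E3, C3)) : Prop :=
  Tendsto (fun q : ℕ ↦ weightedBlock χ s p f q) atTop (𝓝 0)

open Classical in
/-- The bilinear duality pairing of `f ∈ H^{-s}` with `g ∈ H^s`, extending `∫ f g dx`:
the integral of `(1 + |D|²)^{-s/2} f · (1 + |D|²)^{s/2} g`. -/
def sobolevPairing (s : ℝ) (f g : 𝓢'(E3, ℂ)) : ℂ :=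
  if h : MemSobolev (-s) 2 f ∧ MemSobolev s 2 g then
    ∫ x, (h.1.choose : E3 → ℂ) x * (h.2.choose : E3 → ℂ) x
  else 0

/-! ### Vector fields, vorticity, helicity and its flux -/

/-- The inclusion `ℝ³ → ℂ³`. -/
def complexifyCLM : E3 →L[ℝ] C3 :=
  LinearMap.toContinuousLinearMap
    { toFun := fun x ↦ WithLp.toLp 2 (fun i ↦ (x i : ℂ))
      map_add' := fun x y ↦ by ext i; simp
      map_smul' := fun c x ↦ by ext i; simp }

/-- A real `L²` vector field as a tempered distribution. -/
def toDist (u : Lp E3 2 (volume : Measure E3)) : 𝓢'(E3, C3) :=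
  ((complexifyCLM.compLp u : Lp C3 2 (volume : Measure E3)) : 𝓢'(E3, C3))

/-- The `i`-th component of a real `L²` vector field as a tempered distribution. -/
def comp (u : Lp E3 2 (volume : Measure E3)) (i : Fin 3) : 𝓢'(E3, ℂ) :=
  (((Complex.ofRealCLM.comp (EuclideanSpace.proj (𝕜 := ℝ) i)).compLp u :
    Lp ℂ 2 (volume : Measure E3)) : 𝓢'(E3, ℂ))

/-- `∇ · u = 0` in the sense of distributions. -/
def IsDivFree (u : Lp E3 2 (volume : Measure E3)) : Prop :=
  ∑ i : Fin 3, ∂_{stdVec i} (comp u i) = 0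

/-- The vorticity `ω = ∇ × u`, a tempered distribution. -/
def vorticity (u : Lp E3 2 (volume : Measure E3)) : Fin 3 → 𝓢'(E3, ℂ) :=
  ![∂_{stdVec 1} (comp u 2) - ∂_{stdVec 2} (comp u 1),
    ∂_{stdVec 2} (comp u 0) - ∂_{stdVec 0} (comp u 2),
    ∂_{stdVec 0} (comp u 1) - ∂_{stdVec 1} (comp u 0)]

/-- The helicity `∫ u · ω dx` of `u ∈ H^{1/2}`, through the duality of `H^{-1/2}` and `H^{1/2}`
(a real number, regarded as a complex one). -/
def helicity (u : Lp E3 2 (volume : Measure E3)) : ℂ :=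
  ∑ i : Fin 3, sobolevPairing (1 / 2) (vorticity u i) (comp u i)

/-- The entry `u_i u_j` of `u ⊗ u`, acting on Schwartz functions. -/
def tensorVel (u : Lp E3 2 (volume : Measure E3)) (i j : Fin 3) (ψ : 𝓢(E3, ℂ)) : ℂ :=
  ∫ y, ψ y * ((u y i * u y j : ℝ) : ℂ)

/-- The entry `u_i ω_j` of `u ⊗ ω`, acting on Schwartz functions by `⟨u_i ω_j, ψ⟩ = ⟨ω_j, ψ u_i⟩`
in the duality of `H^{-1/2}` and `H^{1/2}`. -/
def tensorVort (u : Lp E3 2 (volume : Measure E3)) (i j : Fin 3) (ψ : 𝓢(E3, ℂ)) : ℂ :=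
  sobolevPairing (1 / 2) (vorticity u j) (smulLeftCLM ℂ ψ (comp u i))

/-- The entry `u_i ω_j - ω_i u_j` of `u ∧ ω = u ⊗ ω - ω ⊗ u`, acting on Schwartz functions. -/
def wedgeVort (u : Lp E3 2 (volume : Measure E3)) (i j : Fin 3) (ψ : 𝓢(E3, ℂ)) : ℂ :=
  tensorVort u i j ψ - tensorVort u j i ψ

/-- `Tr[S_Q(u ⊗ u) · ∇ S_Q ω + S_Q(u ∧ ω) · ∇ S_Q u]` at the point `x`, where `∇ v` is the Jacobian
matrix of `v`, so that `Tr[A · ∇ v] = ∑_{i,j} A_{ij} ∂_i v_j`. -/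
def fluxDensity (χ : Cutoff) (Q : ℕ) (u : Lp E3 2 (volume : Measure E3)) (x : E3) : ℂ :=
  ∑ i : Fin 3, ∑ j : Fin 3,
    (χ.low Q (tensorVel u i j) x *
        fderiv ℝ (χ.low Q (fun ψ ↦ vorticity u j ψ)) x (stdVec i) +
      χ.low Q (wedgeVort u i j) x *
        fderiv ℝ (χ.low Q (fun ψ ↦ comp u j ψ)) x (stdVec i))

/-- The truncated helicity flux `𝓗_Q`. -/
def helicityFlux (χ : Cutoff) (Q : ℕ) (u : Lp E3 2 (volume : Measure E3)) : ℂ :=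
  ∫ x, fluxDensity χ Q u x

/-- The localization kernel: `λ_q^{4/3}` for `q ≤ 0` and `λ_q^{-2/3}` for `q > 0`. -/
def locKernel (q : ℤ) : ℝ≥0∞ :=
  if q ≤ 0 then ENNReal.ofReal (((2 : ℝ) ^ q) ^ (4 / 3 : ℝ))
  else ENNReal.ofReal (((2 : ℝ) ^ q) ^ (-(2 / 3) : ℝ))

/-- `(T * b²)(Q) = ∑_{q ≥ -1} T(Q - q) b_q²` with `b_q = λ_q^{2/3} ‖Δ_q u‖_3` (the terms with
`q < -1` vanish). -/
def locSum (χ : Cutoff) (f : 𝓢'(E3, C3)) (Q : ℕ) : ℝ≥0∞ :=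
  ∑' q : ℤ, locKernel (Q - q) * weightedBlock χ (2 / 3) 3 f q ^ 2

/-! ### Weak solutions of the Euler equations -/

/-- `u` is a weak solution of the Euler equations on `[0, τ]`: `u ∈ C_w([0,τ]; L²)`, `∇ · u(t) = 0`
for every `t`, and the weak formulation holds for all divergence-free
`ψ ∈ C¹([0,τ]; 𝓢(ℝ³))`, with time derivative `ψ'`. -/
structure IsWeakEulerSolution (τ : ℝ) (u : ℝ → Lp E3 2 (volume : Measure E3)) : Prop where
  weaklyContinuous : ∀ v : Lp E3 2 (volume : Measure E3),
    ContinuousOn (fun t ↦ inner ℝ (u t) v) (Icc 0 τ)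
  divFree : ∀ t ∈ Icc 0 τ, IsDivFree (u t)
  weak : ∀ ψ ψ' : ℝ → 𝓢(E3, E3), ContinuousOn ψ' (Icc 0 τ) →
    (∀ t ∈ Icc 0 τ, HasDerivWithinAt ψ (ψ' t) (Icc 0 τ) t) →
    (∀ t ∈ Icc 0 τ, ∀ x, ∑ i : Fin 3, (fderiv ℝ (ψ t) x (stdVec i)) i = 0) →
    ∀ t ∈ Icc 0 τ,
      (∫ x, inner ℝ (u t x) (ψ t x)) - (∫ x, inner ℝ (u 0 x) (ψ 0 x))
          - ∫ s in (0 : ℝ)..t, ∫ x, inner ℝ (u s x) (ψ' s x)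
        = ∫ s in (0 : ℝ)..t, ∫ x, inner ℝ (fderiv ℝ (ψ s) x (u s x)) (u s x)

/-- `u ∈ L^∞([0,τ]; H^{1/2})`. -/
def MemLinftyHHalf (τ : ℝ) (u : ℝ → Lp E3 2 (volume : Measure E3)) : Prop :=
  ∃ M : ℝ≥0, ∀ᵐ t ∂(volume.restrict (Icc 0 τ)), sobolevNorm (1 / 2) (toDist (u t)) ≤ M

/-- `u ∈ L³([0,τ]; B^{2/3}_{3,c(ℕ)})`. -/
def MemL3Besov (χ : Cutoff) (τ : ℝ) (u : ℝ → Lp E3 2 (volume : Measure E3)) : Prop :=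
  (∀ᵐ t ∂(volume.restrict (Icc 0 τ)), MemBesovC χ (2 / 3) 3 (toDist (u t))) ∧
    ∫⁻ t in Icc 0 τ, besovNorm χ (2 / 3) 3 (toDist (u t)) ^ 3 < ⊤

end

end HelicityFlux

open HelicityFlux

/-! Write S for S_Q and λ for 2^(Q+1). When div u = 0, curl div(u ⊗ u) = div(u ∧ ω), so after
integrating by parts both terms of the flux have the same integral, and H_Q = 2 ∫ S(u ⊗ u) : ∇Sω
(`helicityFlux_eq`). Since u_i ω_j is only a distribution, this identity is verified frequency by
frequency (`flux_algebra`).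

The field Su is smooth and divergence free with curl Sω, so the resolved flux ∫ (Su ⊗ Su) : ∇Sω is
the integral of a divergence and vanishes (`integral_resolved_flux`). There remains the commutator
S(u_i u_j) - Su_i Su_j, a double average of products of two increments of u (`two_mul_conv_sub_eq`),
integrated against ∇Sω. The latter is λ² times an average of increments, because second derivatives
of the kernel have mean zero (`eLpNorm_conv_dS_dS_le`). Thus a bound ‖u - u(· - y)‖_3 ≤ a (1 + λ|y|)
for all y gives |H_Q| ≤ C λ² a³.

A block of frequency about 2^k contributes at most a multiple of min(1, 2^k/λ) times its norm to the
increment. These contributions are summed in ℓ², through the embedding of B^0_{3,2} into L³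
(`eLpNorm_three_sq_le`). This produces exactly the exponents 4/3 and -2/3 of T, so that λ^(4/3) a² ≤
C (T * b²)(Q) (`locX_le_locSum`); a triangle inequality in ℓ¹ would give a weaker kernel. The
embedding has an elementary proof. When a block h is added to a partial sum F, the cube of the L³
norm grows by a linear term ∫ |F| F̄ h plus terms quadratic in h. As h has no low frequencies and
|F| F̄ is as regular as F, the linear term is small: this is almost orthogonality, and the recursion
for the cubes is then solved by taking a maximum (`sq_le_of_cube_recursion`).

Since T is summable and b_q tends to 0, dominated convergence gives (T * b²)(Q) → 0, hence the
second statement.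

For conservation, the helicity of S u(t) is α(u(t), u(t)) for a symmetric bilinear form α. The weak
formulation with the time-independent test field curl S² f gives the evolution of α(u(t), f) for
Schwartz f, then for all f in L² by density. Since u is only weakly continuous, f = u(t) is reached
through a telescoping sum over a partition of the time interval (`energy_identity`). The rate of
change of the mollified helicity is then H_Q(u(t)), up to the sign conventions and the duality
already absorbed in the forms. It tends to 0 almost everywhere and is dominated by a multiple of
‖u(t)‖³ in the Besov norm, while the mollified helicity tends to the helicity (`tendsto_helForm`).
Membership in H^{1/2}, known for almost every time, passes to every time by Fatou's lemma. -/

namespace HelicityFlux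

noncomputable section

/-! ### The Fourier transform of square-integrable functions -/

open Classical in
/-- The `L²` Fourier transform of a function, `0` if the function is not in `L²`. -/
def hat (f : E3 → ℂ) : E3 → ℂ :=
  if h : MemLp f 2 volume then (𝓕 (h.toLp f) : Lp ℂ 2 (volume : Measure E3)) else 0

theorem hat_eq {f : E3 → ℂ} (h : MemLp f 2 volume) :
    hat f = (𝓕 (h.toLp f) : Lp ℂ 2 (volume : Measure E3)) := by
  simp [hat, h]

theorem hat_coe (f : Lp ℂ 2 (volume : Measure E3)) :
    hat f = (𝓕 f : Lp ℂ 2 (volume : Measure E3)) := by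
  rw [hat_eq (Lp.memLp f), Lp.toLp_coeFn]

theorem hat_congr {f g : E3 → ℂ} (hf : MemLp f 2 volume) (h : f =ᵐ[volume] g) :
    hat f = hat g := by
  have hg := hf.ae_eq h
  rw [hat_eq hf, hat_eq hg, (MemLp.toLp_eq_toLp_iff hf hg).2 h]

theorem memLp_hat (f : E3 → ℂ) : MemLp (hat f) 2 volume := by
  by_cases h : MemLp f 2 volume
  · rw [hat_eq h]; exact Lp.memLp _
  · simp [hat, h]

theorem eLpNorm_hat {f : E3 → ℂ} (h : MemLp f 2 volume) :
    eLpNorm (hat f) 2 volume = eLpNorm f 2 volume := by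
  have h1 := Lp.norm_fourier_eq (h.toLp f)
  rw [Lp.norm_def, Lp.norm_toLp, ENNReal.toReal_eq_toReal_iff' (Lp.eLpNorm_ne_top _) h.2.ne] at h1
  rw [hat_eq h, h1]

theorem hat_add {f g : E3 → ℂ} (hf : MemLp f 2 volume) (hg : MemLp g 2 volume) :
    hat (f + g) =ᵐ[volume] hat f + hat g := by
  rw [hat_eq hf, hat_eq hg, hat_eq (hf.add hg), MemLp.toLp_add hf hg, FourierTransform.fourier_add]
  exact Lp.coeFn_add _ _

theorem hat_const_smul {f : E3 → ℂ} (hf : MemLp f 2 volume) (c : ℂ) :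
    hat (c • f) =ᵐ[volume] c • hat f := by
  rw [hat_eq hf, hat_eq (hf.const_smul c), MemLp.toLp_const_smul c hf, FourierTransform.fourier_smul]
  exact Lp.coeFn_smul _ _

/-- Pointwise identities between L² transforms are obtained by testing against Schwartz functions,
where the transform can be thrown onto the test function. -/
theorem ae_eq_of_forall_schwartz {f g : E3 → ℂ} (hf : LocallyIntegrable f volume)
    (hg : LocallyIntegrable g volume)
    (h : ∀ ψ : 𝓢(E3, ℂ), ∫ x, ψ x * f x = ∫ x, ψ x * g x) : f =ᵐ[volume] g := by
  refine ae_eq_of_integral_contDiff_smul_eq hf hg fun φ hφ hc ↦ ?_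
  have h1 : HasCompactSupport (Complex.ofRealCLM ∘ φ) := hc.comp_left rfl
  have h2 : ContDiff ℝ ∞ (Complex.ofRealCLM ∘ φ) := by fun_prop
  simpa using h (h1.toSchwartzMap h2)

theorem _root_.MeasureTheory.MemLp.locInt {f : E3 → ℂ} (h : MemLp f 2 volume) : LocallyIntegrable f volume :=
  h.locallyIntegrable (by norm_num)

theorem memLp_schwartz (ψ : 𝓢(E3, ℂ)) (p : ℝ≥0∞) : MemLp ψ p volume := ψ.memLp p

theorem integrable_mul_of_L2 {f g : E3 → ℂ} (hf : MemLp f 2 volume) (hg : MemLp g 2 volume) :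
    Integrable (fun x ↦ f x * g x) volume := by
  simpa using! MemLp.integrable_mul hf hg

theorem integral_schwartz_mul_hat {f : E3 → ℂ} (hf : MemLp f 2 volume) (ψ : 𝓢(E3, ℂ)) :
    ∫ x, ψ x * hat f x = ∫ x, (𝓕 ψ) x * f x := by
  have h := Lp.fourier_toTemperedDistribution_eq (hf.toLp f)
  have h1 := DFunLike.congr_fun h ψ
  rw [TemperedDistribution.fourier_apply, Lp.toTemperedDistribution_apply,
    Lp.toTemperedDistribution_apply] at h1
  simp only [smul_eq_mul] at h1
  rw [hat_eq hf, ← h1]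
  refine integral_congr_ae ?_
  filter_upwards [hf.coeFn_toLp] with x hx
  rw [hx]

theorem hat_schwartz (ψ : 𝓢(E3, ℂ)) : hat ψ =ᵐ[volume] (𝓕 ψ : 𝓢(E3, ℂ)) := by
  have h : (memLp_schwartz ψ 2).toLp ψ = ψ.toLp 2 := rfl
  rw [hat_eq (memLp_schwartz ψ 2), h, SchwartzMap.toLp_fourier_eq]
  exact SchwartzMap.coeFn_toLp _ 2 volume

/-- Parseval's identity in bilinear form. -/
theorem integral_hat_mul {f g : E3 → ℂ} (hf : MemLp f 2 volume) (hg : MemLp g 2 volume) :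
    ∫ x, hat f x * g x = ∫ x, f x * hat g x := by
  have key : ∀ g : Lp ℂ 2 (volume : Measure E3),
      (ContinuousLinearMap.mul ℂ ℂ).lpPairing volume 2 2 (𝓕 (hf.toLp f)) g =
      (ContinuousLinearMap.mul ℂ ℂ).lpPairing volume 2 2 (hf.toLp f) (𝓕 g) := by
    intro g
    refine DenseRange.induction_on
      (p := fun g ↦ (ContinuousLinearMap.mul ℂ ℂ).lpPairing volume 2 2 (𝓕 (hf.toLp f)) g =
      (ContinuousLinearMap.mul ℂ ℂ).lpPairing volume 2 2 (hf.toLp f) (𝓕 g))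
      (SchwartzMap.denseRange_toLpCLM (E := E3) (F := ℂ) (p := 2) ENNReal.ofNat_ne_top) g ?_ ?_
    · refine isClosed_eq (ContinuousLinearMap.continuous _) ?_
      exact (ContinuousLinearMap.continuous _).comp
        (fourierCLM ℂ (Lp ℂ 2 (volume : Measure E3))).continuous
    · intro ψ
      have h := integral_schwartz_mul_hat hf ψ
      rw [ContinuousLinearMap.lpPairing_eq_integral, ContinuousLinearMap.lpPairing_eq_integral]
      simp only [ContinuousLinearMap.mul_apply', toLpCLM_apply, SchwartzMap.toLp_fourier_eq]
      rw [hat_eq hf] at h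
      calc _ = ∫ x, ψ x * (𝓕 (hf.toLp f) : Lp ℂ 2 (volume : Measure E3)) x := by
            refine integral_congr_ae ?_
            filter_upwards [SchwartzMap.coeFn_toLp ψ 2 volume] with x hx
            rw [hx, mul_comm]
        _ = _ := h
        _ = _ := by
            refine integral_congr_ae ?_
            filter_upwards [SchwartzMap.coeFn_toLp (𝓕 ψ) 2 volume, hf.coeFn_toLp] with x hx hx2
            rw [hx, hx2, mul_comm]
  have h := key (hg.toLp g)
  rw [ContinuousLinearMap.lpPairing_eq_integral, ContinuousLinearMap.lpPairing_eq_integral] at h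
  simp only [ContinuousLinearMap.mul_apply'] at h
  rw [hat_eq hf, hat_eq hg]
  calc _ = _ := by
        refine integral_congr_ae ?_
        filter_upwards [hg.coeFn_toLp] with x hx
        rw [← hx]
    _ = _ := h
    _ = _ := by
        refine integral_congr_ae ?_
        filter_upwards [hf.coeFn_toLp] with x hx
        rw [hx]

theorem hat_ae_eq_fourier {f : E3 → ℂ} (hf : MemLp f 2 volume) (hi : Integrable f volume) :
    hat f =ᵐ[volume] 𝓕 f := by
  have hc : Continuous (𝓕 f) := VectorFourier.fourierIntegral_continuous
    Real.continuous_fourierChar (innerSL ℝ).continuous₂ hi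
  refine ae_eq_of_forall_schwartz (memLp_hat f).locInt hc.locallyIntegrable fun ψ ↦ ?_
  rw [integral_schwartz_mul_hat hf ψ]
  have := VectorFourier.integral_fourierIntegral_smul_eq_flip (μ := (volume : Measure E3))
    (ν := (volume : Measure E3)) (L := innerₗ E3)
    Real.continuous_fourierChar (innerSL ℝ).continuous₂ ψ.integrable hi
  simpa [Real.fourier_eq, VectorFourier.fourierIntegral, SchwartzMap.fourier_coe] using this

theorem memLp_comp_neg {f : E3 → ℂ} {p : ℝ≥0∞} (hf : MemLp f p volume) :
    MemLp (fun x ↦ f (-x)) p volume :=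
  hf.comp_measurePreserving (Measure.measurePreserving_neg volume)

theorem integral_comp_neg (f : E3 → ℂ) : ∫ x, f (-x) = ∫ x, f x :=
  integral_neg_eq_self f volume

theorem hat_hat {f : E3 → ℂ} (hf : MemLp f 2 volume) :
    hat (hat f) =ᵐ[volume] fun x ↦ f (-x) := by
  refine ae_eq_of_forall_schwartz (memLp_hat _).locInt (memLp_comp_neg hf).locInt fun ψ ↦ ?_
  rw [integral_schwartz_mul_hat (memLp_hat f), integral_schwartz_mul_hat hf,
    ← integral_comp_neg]
  refine integral_congr_ae (Eventually.of_forall fun x ↦ ?_)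
  have : (𝓕 (𝓕 ψ)) (-x) = ψ x := by
    have := SchwartzMap.fourierInv_apply_eq (𝓕 ψ)
    have h2 := DFunLike.congr_fun this x
    rw [fourierInv_fourier_eq] at h2
    simpa using h2.symm
  simp only [this]

/-- Parseval's identity. -/
theorem integral_mul_eq_hat {f g : E3 → ℂ} (hf : MemLp f 2 volume) (hg : MemLp g 2 volume) :
    ∫ x, f x * g x = ∫ ξ, hat f ξ * hat g (-ξ) := by
  have h := integral_hat_mul (memLp_comp_neg (memLp_hat g)) hf
  have h1 : hat (fun x ↦ hat g (-x)) =ᵐ[volume] g := by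
    refine ae_eq_of_forall_schwartz (memLp_hat _).locInt hg.locInt fun ψ ↦ ?_
    rw [integral_schwartz_mul_hat (memLp_comp_neg (memLp_hat g)), ← integral_comp_neg]
    simp only [neg_neg]
    have h3 : ∀ x, (𝓕 ψ) (-x) = (𝓕⁻ ψ) x := fun x ↦ by
      rw [SchwartzMap.fourierInv_apply_eq]; simp
    simp only [h3]
    rw [integral_schwartz_mul_hat hg, fourier_fourierInv_eq]
  calc ∫ x, f x * g x = ∫ x, hat (fun x ↦ hat g (-x)) x * f x := by
        refine integral_congr_ae ?_
        filter_upwards [h1] with x hx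
        rw [hx, mul_comm]
    _ = _ := by rw [h]; simp only [mul_comm]

/-! ### Convolution with Schwartz kernels -/

/-- The convolution of `k` and `f`. -/
def conv (k f : E3 → ℂ) (x : E3) : ℂ := ∫ y, k y * f (x - y)

theorem conv_eq (k f : E3 → ℂ) (x : E3) : conv k f x = ∫ y, k (x - y) * f y := by
  rw [conv, ← integral_sub_left_eq_self _ volume x]
  simp

theorem conv_congr_right {f g : E3 → ℂ} (k : E3 → ℂ) (h : f =ᵐ[volume] g) : conv k f = conv k g := by
  ext x
  rw [conv_eq, conv_eq]
  refine integral_congr_ae ?_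
  filter_upwards [h] with y hy
  rw [hy]

theorem memLp_comp_sub_left {f : E3 → ℂ} {p : ℝ≥0∞} (hf : MemLp f p volume) (x : E3) :
    MemLp (fun y ↦ f (x - y)) p volume :=
  hf.comp_measurePreserving (Measure.measurePreserving_sub_left volume x)

theorem memLp_comp_sub_right {f : E3 → ℂ} {p : ℝ≥0∞} (hf : MemLp f p volume) (x : E3) :
    MemLp (fun y ↦ f (y - x)) p volume :=
  hf.comp_measurePreserving (measurePreserving_sub_right volume x)

theorem integrable_conv (k : 𝓢(E3, ℂ)) {f : E3 → ℂ} (hf : MemLp f 2 volume) (x : E3) :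
    Integrable (fun y ↦ k y * f (x - y)) volume :=
  integrable_mul_of_L2 (memLp_schwartz k 2) (memLp_comp_sub_left hf x)

/-- The product of two Schwartz functions. -/
def mulS (σ τ : 𝓢(E3, ℂ)) : 𝓢(E3, ℂ) := SchwartzMap.smulLeftCLM ℂ (σ : E3 → ℂ) τ

@[simp] theorem mulS_apply (σ τ : 𝓢(E3, ℂ)) (x : E3) : mulS σ τ x = σ x * τ x := by
  rw [mulS, SchwartzMap.smulLeftCLM_apply_apply σ.hasTemperateGrowth, smul_eq_mul]

/-- The symbol `2πi (ξ·v) σ(ξ)` of the derivative in direction `v`. -/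
def dS (v : E3) (σ : 𝓢(E3, ℂ)) : 𝓢(E3, ℂ) :=
  (2 * Real.pi * Complex.I : ℂ) •
    SchwartzMap.smulLeftCLM ℂ (fun ξ : E3 ↦ ((inner ℝ ξ v : ℝ) : ℂ)) σ

@[simp] theorem dS_apply (v : E3) (σ : 𝓢(E3, ℂ)) (ξ : E3) :
    dS v σ ξ = 2 * Real.pi * Complex.I * (inner ℝ ξ v : ℝ) * σ ξ := by
  rw [dS, smul_apply, SchwartzMap.smulLeftCLM_apply_apply (by fun_prop)]
  simp only [smul_eq_mul]; ring

theorem memLp_schwartz_mul (σ : 𝓢(E3, ℂ)) {f : E3 → ℂ} {p : ℝ≥0∞} (hf : MemLp f p volume) :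
    MemLp (fun x ↦ σ x * f x) p volume :=
  MemLp.mul' (p := ⊤) (q := p) hf (memLp_schwartz σ ⊤)

theorem integrable_schwartz_mul (σ : 𝓢(E3, ℂ)) {f : E3 → ℂ} (hf : MemLp f 2 volume) :
    Integrable (fun x ↦ σ x * f x) volume :=
  integrable_mul_of_L2 (memLp_schwartz σ 2) hf

theorem fourierInv_eq_exp (h : E3 → ℂ) (x : E3) :
    𝓕⁻ h x = ∫ ξ, (Real.fourierChar (inner ℝ ξ x) : ℂ) * h ξ := by
  rw [Real.fourierInv_eq]
  simp [Circle.smul_def]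

/-- The modulation `e^{2πi x·ξ} σ(ξ)` and its Fourier transform. -/
theorem exists_modulation (σ : 𝓢(E3, ℂ)) (x : E3) : ∃ κ : 𝓢(E3, ℂ),
    (∀ ξ, κ ξ = (Real.fourierChar (inner ℝ ξ x) : ℂ) * σ ξ) ∧
      ∀ y, (𝓕 κ) y = (𝓕⁻ σ : 𝓢(E3, ℂ)) (x - y) := by
  refine ⟨𝓕⁻ ((𝓕 σ).compSubConstCLM ℂ x), fun ξ ↦ ?_, fun y ↦ ?_⟩
  · rw [SchwartzMap.fourierInv_coe, fourierInv_eq_exp]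
    simp only [compSubConstCLM_apply]
    have h1 : σ ξ = (𝓕⁻ (𝓕 σ : 𝓢(E3, ℂ)) : 𝓢(E3, ℂ)) ξ := by rw [fourierInv_fourier_eq]
    rw [h1, SchwartzMap.fourierInv_coe, fourierInv_eq_exp, ← integral_const_mul,
      ← integral_add_right_eq_self _ x]
    refine integral_congr_ae (Eventually.of_forall fun y ↦ ?_)
    simp only [add_sub_cancel_right, inner_add_left, AddChar.map_add_eq_mul, Circle.coe_mul]
    rw [real_inner_comm ξ x]; ring
  · rw [fourier_fourierInv_eq, compSubConstCLM_apply, SchwartzMap.fourierInv_apply_eq]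
    simp

/-- The translated kernel is the Fourier transform of a modulation of σ, so duality evaluates the
convolution at every point x, with f merely in L². -/
theorem conv_eq_fourierInv (σ : 𝓢(E3, ℂ)) {f : E3 → ℂ} (hf : MemLp f 2 volume) (x : E3) :
    conv (𝓕⁻ σ : 𝓢(E3, ℂ)) f x = 𝓕⁻ (fun ξ ↦ σ ξ * hat f ξ) x := by
  obtain ⟨κ, h1, h2⟩ := exists_modulation σ x
  rw [conv_eq, fourierInv_eq_exp]
  simp only [← h2]
  rw [← integral_schwartz_mul_hat hf]
  simp only [h1, mul_assoc]

theorem hat_hat_neg {f : E3 → ℂ} (hf : MemLp f 2 volume) :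
    hat (fun x ↦ hat f (-x)) =ᵐ[volume] f := by
  refine ae_eq_of_forall_schwartz (memLp_hat _).locInt hf.locInt fun ψ ↦ ?_
  rw [integral_schwartz_mul_hat (memLp_comp_neg (memLp_hat f)), ← integral_comp_neg]
  simp only [neg_neg]
  have h3 : ∀ x, (𝓕 ψ) (-x) = (𝓕⁻ ψ) x := fun x ↦ by
    rw [SchwartzMap.fourierInv_apply_eq]; simp
  simp only [h3]
  rw [integral_schwartz_mul_hat hf, fourier_fourierInv_eq]

theorem fourierInv_ae_eq {h : E3 → ℂ} (h2 : MemLp h 2 volume) (h1 : Integrable h volume) :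
    𝓕⁻ h =ᵐ[volume] fun x ↦ hat h (-x) := by
  have := (Measure.measurePreserving_neg (volume : Measure E3)).quasiMeasurePreserving.ae_eq_comp
    (hat_ae_eq_fourier h2 h1)
  filter_upwards [this] with x hx
  rw [Real.fourierInv_eq_fourier_neg]
  exact hx.symm

theorem memLp_fourierInv {h : E3 → ℂ} (h2 : MemLp h 2 volume) (h1 : Integrable h volume) :
    MemLp (𝓕⁻ h) 2 volume :=
  (memLp_comp_neg (memLp_hat h)).ae_eq (fourierInv_ae_eq h2 h1).symm

theorem hat_fourierInv {h : E3 → ℂ} (h2 : MemLp h 2 volume) (h1 : Integrable h volume) :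
    hat (𝓕⁻ h) =ᵐ[volume] h := by
  rw [hat_congr (memLp_fourierInv h2 h1) (fourierInv_ae_eq h2 h1)]
  exact hat_hat_neg h2

theorem continuous_fourierInv {h : E3 → ℂ} (h1 : Integrable h volume) : Continuous (𝓕⁻ h) := by
  have hc : Continuous (𝓕 h) := VectorFourier.fourierIntegral_continuous
    Real.continuous_fourierChar (innerSL ℝ).continuous₂ h1
  have : 𝓕⁻ h = fun x ↦ 𝓕 h (-x) := funext fun x ↦ Real.fourierInv_eq_fourier_neg h x
  rw [this]
  exact hc.comp continuous_neg

theorem norm_fourierInv_le (h : E3 → ℂ) (x : E3) : ‖𝓕⁻ h x‖ ≤ ∫ ξ, ‖h ξ‖ := by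
  rw [fourierInv_eq_exp]
  refine (norm_integral_le_integral_norm _).trans_eq ?_
  simp only [norm_mul, Circle.norm_coe, one_mul]

/-! ### Multipliers with Schwartz symbol acting on L² -/

section

variable (σ τ : 𝓢(E3, ℂ)) {f g : E3 → ℂ}

theorem conv_eq_fourierInv' (hf : MemLp f 2 volume) :
    conv (𝓕⁻ σ : 𝓢(E3, ℂ)) f = 𝓕⁻ (fun ξ ↦ σ ξ * hat f ξ) :=
  funext fun x ↦ conv_eq_fourierInv σ hf x

theorem memLp_conv (hf : MemLp f 2 volume) : MemLp (conv (𝓕⁻ σ : 𝓢(E3, ℂ)) f) 2 volume := by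
  rw [conv_eq_fourierInv' σ hf]
  exact memLp_fourierInv (memLp_schwartz_mul σ (memLp_hat f))
    (integrable_schwartz_mul σ (memLp_hat f))

theorem hat_conv (hf : MemLp f 2 volume) :
    hat (conv (𝓕⁻ σ : 𝓢(E3, ℂ)) f) =ᵐ[volume] fun ξ ↦ σ ξ * hat f ξ := by
  rw [conv_eq_fourierInv' σ hf]
  exact hat_fourierInv (memLp_schwartz_mul σ (memLp_hat f))
    (integrable_schwartz_mul σ (memLp_hat f))

theorem continuous_conv (hf : MemLp f 2 volume) : Continuous (conv (𝓕⁻ σ : 𝓢(E3, ℂ)) f) := by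
  rw [conv_eq_fourierInv' σ hf]
  exact continuous_fourierInv (integrable_schwartz_mul σ (memLp_hat f))

theorem norm_conv_le (hf : MemLp f 2 volume) (x : E3) :
    ‖conv (𝓕⁻ σ : 𝓢(E3, ℂ)) f x‖ ≤ ∫ ξ, ‖σ ξ * hat f ξ‖ := by
  rw [conv_eq_fourierInv' σ hf]
  exact norm_fourierInv_le _ x

theorem memLp_top_conv (hf : MemLp f 2 volume) :
    MemLp (conv (𝓕⁻ σ : 𝓢(E3, ℂ)) f) ⊤ volume :=
  memLp_top_of_bound (continuous_conv σ hf).aestronglyMeasurable _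
    (Eventually.of_forall (norm_conv_le σ hf))

theorem eLpNorm_three_pow {F : Type*} [NormedAddCommGroup F] (f : E3 → F) :
    eLpNorm f 3 volume ^ 3 = ∫⁻ x, ‖f x‖ₑ ^ 3 := by
  rw [eLpNorm_eq_lintegral_rpow_enorm_toReal (by norm_num) (by norm_num), ← ENNReal.rpow_natCast,
    ← ENNReal.rpow_mul]
  norm_num

theorem memLp_three {F : Type*} [NormedAddCommGroup F] {f : E3 → F} (h2 : MemLp f 2 volume)
    (hi : MemLp f ⊤ volume) : MemLp f 3 volume := by
  refine ⟨h2.1, ?_⟩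
  suffices h : eLpNorm f 3 volume ^ 3 < ⊤ from
    (ENNReal.pow_lt_top_iff.1 h).resolve_right three_ne_zero
  rw [eLpNorm_three_pow]
  have hb := ae_le_eLpNormEssSup (f := f) (μ := volume)
  have h2' : ∫⁻ x, ‖f x‖ₑ ^ 2 < ⊤ := by
    have := lintegral_rpow_enorm_lt_top_of_eLpNorm_lt_top (p := 2) (by norm_num) (by norm_num) h2.2
    simpa using this
  calc ∫⁻ x, ‖f x‖ₑ ^ 3 ≤ ∫⁻ x, eLpNormEssSup f volume * ‖f x‖ₑ ^ 2 := by
        refine lintegral_mono_ae ?_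
        filter_upwards [hb] with x hx
        rw [pow_succ' _ 2]
        gcongr
    _ < ⊤ := by
        have h3 : eLpNormEssSup f volume < ⊤ := by
          have := hi.2
          rwa [eLpNorm_exponent_top] at this
        rw [lintegral_const_mul' _ _ h3.ne]
        exact ENNReal.mul_lt_top h3 h2'

theorem memLp_three_conv (hf : MemLp f 2 volume) :
    MemLp (conv (𝓕⁻ σ : 𝓢(E3, ℂ)) f) 3 volume :=
  memLp_three (memLp_conv σ hf) (memLp_top_conv σ hf)

theorem conv_conv (hf : MemLp f 2 volume) :
    conv (𝓕⁻ σ : 𝓢(E3, ℂ)) (conv (𝓕⁻ τ : 𝓢(E3, ℂ)) f) = conv (𝓕⁻ (mulS σ τ) : 𝓢(E3, ℂ)) f := by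
  ext x
  rw [conv_eq_fourierInv σ (memLp_conv τ hf), conv_eq_fourierInv (mulS σ τ) hf, fourierInv_eq_exp,
    fourierInv_eq_exp]
  refine integral_congr_ae ?_
  filter_upwards [hat_conv τ hf] with ξ hξ
  rw [hξ, mulS_apply, mul_assoc]

/-- The bilinear Parseval identity pairs ξ with -ξ, so the transpose of a multiplier has the
reflected symbol; even symbols give symmetric operators. -/
theorem integral_conv_mul (hf : MemLp f 2 volume) (hg : MemLp g 2 volume)
    (h : ∀ ξ, τ ξ = σ (-ξ)) :
    ∫ x, conv (𝓕⁻ σ : 𝓢(E3, ℂ)) f x * g x = ∫ x, f x * conv (𝓕⁻ τ : 𝓢(E3, ℂ)) g x := by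
  rw [integral_mul_eq_hat (memLp_conv σ hf) hg, integral_mul_eq_hat hf (memLp_conv τ hg)]
  have h1 := (Measure.measurePreserving_neg (volume : Measure E3)).quasiMeasurePreserving.ae_eq_comp
    (hat_conv τ hg)
  refine integral_congr_ae ?_
  filter_upwards [hat_conv σ hf, h1] with ξ h2 h3
  simp only [Function.comp_apply] at h3
  rw [h2, h3, h, neg_neg]; ring

theorem hasFDerivAt_conv (hf : MemLp f 2 volume) (x : E3) :
    ∃ f' : E3 →L[ℝ] ℂ, HasFDerivAt (conv (𝓕⁻ σ : 𝓢(E3, ℂ)) f) f' x ∧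
      ∀ v, f' v = conv (𝓕⁻ (dS v σ) : 𝓢(E3, ℂ)) f x := by
  set h : E3 → ℂ := fun ξ ↦ σ ξ * hat f ξ with hh
  have hi : Integrable h volume := integrable_schwartz_mul σ (memLp_hat f)
  -- The weight |ξ| is not smooth at 0, but |ξ||σ(ξ)| is the norm of the vector-valued Schwartz
  -- function σ(ξ)⟪ξ, ·⟫.
  have hn : MemLp (fun ξ ↦ ‖ξ‖ * ‖σ ξ‖) 2 volume := by
    refine ⟨by fun_prop, ?_⟩
    have h1 : MemLp (SchwartzMap.smulRightCLM ℂ ℂ (innerSL ℝ) σ) 2 volume := (SchwartzMap.smulRightCLM ℂ ℂ (innerSL ℝ) σ).memLp 2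
    have h2 : ∀ ξ, ‖SchwartzMap.smulRightCLM ℂ ℂ (innerSL ℝ) σ ξ‖ = ‖ξ‖ * ‖σ ξ‖ := by
      intro ξ
      rw [SchwartzMap.smulRightCLM_apply_apply, ContinuousLinearMap.norm_smulRight_apply,
        innerSL_apply_norm]
    refine lt_of_eq_of_lt (eLpNorm_congr_norm_ae (Eventually.of_forall fun ξ ↦ ?_)) h1.2
    rw [h2, norm_mul, norm_norm, norm_norm]
  have hi' : Integrable (fun ξ ↦ ‖ξ‖ * ‖h ξ‖) volume := by
    have := MemLp.integrable_mul hn (memLp_hat f).norm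
    refine this.congr (Eventually.of_forall fun ξ ↦ ?_)
    simp [hh, mul_assoc]
  have hd := Real.hasFDerivAt_fourier hi hi' (-x)
  have hcomp := hd.comp x (hasFDerivAt_id x).neg
  refine ⟨(𝓕 (VectorFourier.fourierSMulRight (innerSL ℝ) h) (-x)).comp
    (-ContinuousLinearMap.id ℝ E3), ?_, ?_⟩
  · rw [conv_eq_fourierInv' σ hf]
    have : 𝓕⁻ h = 𝓕 h ∘ fun x ↦ -x := funext fun x ↦ Real.fourierInv_eq_fourier_neg h x
    rw [this]
    exact hcomp
  · intro v
    rw [conv_eq_fourierInv' _ hf, fourierInv_eq_exp]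
    have hint : Integrable (VectorFourier.fourierSMulRight (innerSL ℝ) h) volume := by
      refine hi'.const_mul (2 * Real.pi) |>.mono'
        hi.1.fourierSMulRight (Eventually.of_forall fun ξ ↦ ?_)
      rw [VectorFourier.norm_fourierSMulRight, innerSL_apply_norm]
      exact le_of_eq (by ring)
    simp only [ContinuousLinearMap.comp_apply, neg_apply,
      ContinuousLinearMap.id_apply, map_neg]
    rw [Real.fourier_eq, ContinuousLinearMap.integral_apply, ← integral_neg]
    · refine integral_congr_ae (Eventually.of_forall fun ξ ↦ ?_)
      simp [VectorFourier.fourierSMulRight_apply, Circle.smul_def, hh, inner_neg_right]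
      rw [show ((innerSL ℝ) ξ) v = inner ℝ ξ v from rfl]
      ring
    · exact (Real.fourierIntegral_convergent_iff (-x)).2 hint

theorem fderiv_conv (hf : MemLp f 2 volume) (x v : E3) :
    fderiv ℝ (conv (𝓕⁻ σ : 𝓢(E3, ℂ)) f) x v = conv (𝓕⁻ (dS v σ) : 𝓢(E3, ℂ)) f x := by
  obtain ⟨f', h, h'⟩ := hasFDerivAt_conv σ hf x
  rw [h.fderiv, h']

theorem differentiable_conv (hf : MemLp f 2 volume) :
    Differentiable ℝ (conv (𝓕⁻ σ : 𝓢(E3, ℂ)) f) := fun x ↦ by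
  obtain ⟨f', h, -⟩ := hasFDerivAt_conv σ hf x
  exact h.differentiableAt

end

/-! ### Sobolev spaces and the duality pairing on the Fourier side -/

/-- The weight `(1 + |ξ|²)^r`. -/
def wt (r : ℝ) (ξ : E3) : ℝ := (1 + ‖ξ‖ ^ 2) ^ r

theorem wt_pos (r : ℝ) (ξ : E3) : 0 < wt r ξ := Real.rpow_pos_of_pos (by positivity) _

theorem wt_neg (r : ℝ) (ξ : E3) : wt r (-ξ) = wt r ξ := by simp [wt]

theorem wt_add (r s : ℝ) (ξ : E3) : wt (r + s) ξ = wt r ξ * wt s ξ :=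
  Real.rpow_add (by positivity) _ _

theorem wt_zero (ξ : E3) : wt 0 ξ = 1 := Real.rpow_zero _

theorem one_le_wt {r : ℝ} (hr : 0 ≤ r) (ξ : E3) : 1 ≤ wt r ξ :=
  Real.one_le_rpow (by nlinarith [sq_nonneg ‖ξ‖]) hr

theorem hasTemperateGrowth_wt (r : ℝ) : (wt r).HasTemperateGrowth := by
  unfold wt; fun_prop

theorem continuous_wt (r : ℝ) : Continuous (wt r) := (hasTemperateGrowth_wt r).1.continuous

/-- Peetre's inequality. -/
theorem wt_le {r : ℝ} (hr : 0 ≤ r) (ξ η : E3) : wt r (ξ + η) ≤ 2 ^ r * (wt r ξ * wt r η) := by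
  unfold wt
  rw [← Real.mul_rpow (by positivity) (by positivity), ← Real.mul_rpow (by positivity)
    (by positivity)]
  refine Real.rpow_le_rpow (by positivity) ?_ hr
  have h1 := norm_add_le ξ η
  have h2 : ‖ξ + η‖ ^ 2 ≤ (‖ξ‖ + ‖η‖) ^ 2 := by gcongr
  nlinarith [sq_nonneg (‖ξ‖ - ‖η‖), sq_nonneg (‖ξ‖ * ‖η‖)]

/-- A Schwartz function multiplied by a weight. -/
def wtS (r : ℝ) (ψ : 𝓢(E3, ℂ)) : 𝓢(E3, ℂ) :=
  SchwartzMap.smulLeftCLM ℂ (fun ξ ↦ (wt r ξ : ℂ)) ψ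

theorem hasTemperateGrowth_wtC (r : ℝ) : (fun ξ : E3 ↦ (wt r ξ : ℂ)).HasTemperateGrowth := by
  have := hasTemperateGrowth_wt r
  fun_prop

@[simp] theorem wtS_apply (r : ℝ) (ψ : 𝓢(E3, ℂ)) (ξ : E3) : wtS r ψ ξ = wt r ξ * ψ ξ := by
  rw [wtS, SchwartzMap.smulLeftCLM_apply_apply (hasTemperateGrowth_wtC r), smul_eq_mul]

/-- The Fourier transform of the tempered distribution `T` is the function `h`. -/
def HasFourier (T : 𝓢'(E3, ℂ)) (h : E3 → ℂ) : Prop :=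
  ∀ ψ : 𝓢(E3, ℂ), (𝓕 T) ψ = ∫ ξ, ψ ξ * h ξ

theorem hasFourier_coe (f : Lp ℂ 2 (volume : Measure E3)) :
    HasFourier (f : 𝓢'(E3, ℂ)) (hat f) := by
  intro ψ
  rw [Lp.fourier_toTemperedDistribution_eq, Lp.toTemperedDistribution_apply, hat_coe]
  simp

theorem HasFourier.lineDeriv {T : 𝓢'(E3, ℂ)} {h : E3 → ℂ} (hT : HasFourier T h) (v : E3) :
    HasFourier (∂_{v} T) (fun ξ ↦ 2 * Real.pi * Complex.I * (inner ℝ ξ v : ℝ) * h ξ) := by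
  intro ψ
  have hg : (fun ξ : E3 ↦ ((inner ℝ ξ v : ℝ) : ℂ)).HasTemperateGrowth := by fun_prop
  rw [TemperedDistribution.fourier_lineDerivOp_eq]
  change (2 * Real.pi * Complex.I : ℂ) • (TemperedDistribution.smulLeftCLM ℂ (fun ξ : E3 ↦ ((inner ℝ ξ v : ℝ) : ℂ))
    (𝓕 T)) ψ = _
  rw [TemperedDistribution.smulLeftCLM_apply_apply, hT, smul_eq_mul, ← integral_const_mul]
  refine integral_congr_ae (Eventually.of_forall fun ξ ↦ ?_)
  simp only [SchwartzMap.smulLeftCLM_apply_apply hg, smul_eq_mul]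
  ring

theorem HasFourier.sub {T S : 𝓢'(E3, ℂ)} {h g : E3 → ℂ} (hT : HasFourier T h)
    (hS : HasFourier S g) (hh : ∀ ψ : 𝓢(E3, ℂ), Integrable (fun ξ ↦ ψ ξ * h ξ) volume)
    (hg : ∀ ψ : 𝓢(E3, ℂ), Integrable (fun ξ ↦ ψ ξ * g ξ) volume) :
    HasFourier (T - S) (fun ξ ↦ h ξ - g ξ) := by
  intro ψ
  have h1 : (𝓕 (T - S)) ψ = (𝓕 T) ψ - (𝓕 S) ψ := by
    simp [TemperedDistribution.fourier_apply]
  rw [h1, hT, hS, ← integral_sub (hh ψ) (hg ψ)]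
  simp only [mul_sub]

theorem HasFourier.bessel {T : 𝓢'(E3, ℂ)} {h : E3 → ℂ} (hT : HasFourier T h) (s : ℝ) :
    HasFourier (besselPotential E3 ℂ s T) (fun ξ ↦ wt (s / 2) ξ * h ξ) := by
  intro ψ
  rw [fourier_besselPotential_eq_smulLeftCLM_fourier_apply,
    TemperedDistribution.smulLeftCLM_apply_apply, hT]
  refine integral_congr_ae (Eventually.of_forall fun ξ ↦ ?_)
  have := SchwartzMap.smulLeftCLM_apply_apply (hasTemperateGrowth_wtC (s / 2)) ψ ξ
  simp only [wt, smul_eq_mul] at this ⊢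
  rw [this]
  ring

theorem locallyIntegrable_wt_mul {h : E3 → ℂ} (hh : LocallyIntegrable h volume) (r : ℝ) :
    LocallyIntegrable (fun ξ ↦ wt r ξ * h ξ) volume := by
  rw [← locallyIntegrableOn_univ] at hh ⊢
  refine LocallyIntegrableOn.continuousOn_mul hh ?_ isOpen_univ.isLocallyClosed
  exact (Complex.continuous_ofReal.comp (continuous_wt r)).continuousOn

theorem HasFourier.ae_eq {T : 𝓢'(E3, ℂ)} {h g : E3 → ℂ} (hT : HasFourier T h)
    (hT' : HasFourier T g) (hh : LocallyIntegrable h volume) (hg : LocallyIntegrable g volume) :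
    h =ᵐ[volume] g :=
  ae_eq_of_forall_schwartz hh hg fun ψ ↦ by rw [← hT, ← hT']

theorem HasFourier.bessel_ae_eq {T : 𝓢'(E3, ℂ)} {h : E3 → ℂ} (hT : HasFourier T h)
    (hh : LocallyIntegrable h volume) {s : ℝ} {F : Lp ℂ 2 (volume : Measure E3)}
    (hF : besselPotential E3 ℂ s T = F) : hat F =ᵐ[volume] fun ξ ↦ wt (s / 2) ξ * h ξ := by
  have h1 := hT.bessel s
  rw [hF] at h1
  exact (hasFourier_coe F).ae_eq h1 (memLp_hat _).locInt (locallyIntegrable_wt_mul hh _)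

theorem HasFourier.memSobolev_iff {T : 𝓢'(E3, ℂ)} {h : E3 → ℂ} (hT : HasFourier T h)
    (hh : LocallyIntegrable h volume) (s : ℝ) :
    MemSobolev s 2 T ↔ MemLp (fun ξ ↦ wt (s / 2) ξ * h ξ) 2 volume := by
  constructor
  · rintro ⟨F, hF⟩
    exact (memLp_hat F).ae_eq (hT.bessel_ae_eq hh hF)
  · intro hL
    rw [memSobolev_iff_exists_smulLeftCLM_fourier]
    refine ⟨hL.toLp _, ?_⟩
    ext ψ
    have h1 := hT.bessel s ψ
    rw [fourier_besselPotential_eq_smulLeftCLM_fourier_apply] at h1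
    rw [h1, Lp.toTemperedDistribution_apply]
    refine integral_congr_ae ?_
    filter_upwards [hL.coeFn_toLp] with ξ hξ
    rw [hξ, smul_eq_mul]

/-- The duality pairing as an integral on the Fourier side. -/
theorem sobolevPairing_eq {s : ℝ} {T S : 𝓢'(E3, ℂ)} {h g : E3 → ℂ} (hT : HasFourier T h)
    (hS : HasFourier S g) (hh : LocallyIntegrable h volume) (hg : LocallyIntegrable g volume)
    (hT' : MemLp (fun ξ ↦ wt (-s / 2) ξ * h ξ) 2 volume)
    (hS' : MemLp (fun ξ ↦ wt (s / 2) ξ * g ξ) 2 volume) :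
    sobolevPairing s T S = ∫ ξ, h ξ * g (-ξ) := by
  have H : MemSobolev (-s) 2 T ∧ MemSobolev s 2 S :=
    ⟨(hT.memSobolev_iff hh _).2 hT', (hS.memSobolev_iff hg _).2 hS'⟩
  rw [sobolevPairing, dif_pos H, integral_mul_eq_hat (Lp.memLp _) (Lp.memLp _)]
  have h1 := hT.bessel_ae_eq hh H.1.choose_spec
  have h2 := (Measure.measurePreserving_neg
    (volume : Measure E3)).quasiMeasurePreserving.ae_eq_comp
      (hS.bessel_ae_eq hg H.2.choose_spec)
  refine integral_congr_ae ?_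
  filter_upwards [h1, h2] with ξ h3 h4
  simp only [Function.comp_apply] at h4
  rw [h3, h4, wt_neg]
  have : (wt (-s / 2) ξ : ℂ) * wt (s / 2) ξ = 1 := by
    rw [← Complex.ofReal_mul, ← wt_add]; simp [neg_div, wt_zero]
  linear_combination h ξ * g (-ξ) * this

theorem smulLeftCLM_coe (ψ : 𝓢(E3, ℂ)) (f : Lp ℂ 2 (volume : Measure E3)) :
    smulLeftCLM ℂ (ψ : E3 → ℂ) (f : 𝓢'(E3, ℂ)) =
      (((memLp_schwartz_mul ψ (Lp.memLp f)).toLp _ : Lp ℂ 2 (volume : Measure E3)) :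
        𝓢'(E3, ℂ)) := by
  ext φ
  rw [TemperedDistribution.smulLeftCLM_apply_apply, Lp.toTemperedDistribution_apply,
    Lp.toTemperedDistribution_apply]
  refine integral_congr_ae ?_
  filter_upwards [(memLp_schwartz_mul ψ (Lp.memLp f)).coeFn_toLp] with x hx
  rw [hx, SchwartzMap.smulLeftCLM_apply_apply ψ.hasTemperateGrowth]
  simp only [smul_eq_mul]; ring

/-- Applying the transform twice is a reflection, so this is the convolution formula for the symbol
𝓕𝓕ψ and the L² function `hat f`. -/
theorem fourier_schwartz_mul (ψ : 𝓢(E3, ℂ)) {f : E3 → ℂ} (hf : MemLp f 2 volume) :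
    𝓕 (fun x ↦ ψ x * f x) = conv (𝓕 ψ : 𝓢(E3, ℂ)) (hat f) := by
  ext ξ
  have h := conv_eq_fourierInv (𝓕 (𝓕 ψ)) (memLp_hat f) ξ
  rw [fourierInv_fourier_eq] at h
  rw [h, Real.fourierInv_eq_fourier_neg, Real.fourier_eq, Real.fourier_eq, ← integral_comp_neg]
  refine integral_congr_ae ?_
  filter_upwards [hat_hat hf] with x hx
  have : (𝓕 (𝓕 ψ)) x = ψ (-x) := by
    have := DFunLike.congr_fun (SchwartzMap.fourierInv_apply_eq (𝓕 ψ)) (-x)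
    rw [fourierInv_fourier_eq] at this
    simpa using this.symm
  rw [hx, this, inner_neg_left, inner_neg_right]

theorem hat_schwartz_mul (ψ : 𝓢(E3, ℂ)) {f : E3 → ℂ} (hf : MemLp f 2 volume) :
    hat (fun x ↦ ψ x * f x) =ᵐ[volume] conv (𝓕 ψ : 𝓢(E3, ℂ)) (hat f) := by
  rw [← fourier_schwartz_mul ψ hf]
  exact hat_ae_eq_fourier (memLp_schwartz_mul ψ hf) (integrable_schwartz_mul ψ hf)

/-! ### Products on the Fourier side -/

/-- The convolution `∫ h(ζ-η) g(η) dη` of functions on the Fourier side. -/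
def star (h g : E3 → ℂ) (ζ : E3) : ℂ := ∫ η, h (ζ - η) * g η

/-- The functions `h` and `g` are in the weighted `L²` spaces dual to `H^{-1/2}` and `H^{1/2}`. -/
structure WeightedPair (h g : E3 → ℂ) : Prop where
  left : MemLp (fun ξ ↦ wt (-(1 / 4)) ξ * h ξ) 2 volume
  right : MemLp (fun ξ ↦ wt (1 / 4) ξ * g ξ) 2 volume

theorem memLp_two_of_wt {g : E3 → ℂ} {r : ℝ} (hr : 0 ≤ r)
    (hg : MemLp (fun ξ ↦ wt r ξ * g ξ) 2 volume) : MemLp g 2 volume := by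
  have hm : AEStronglyMeasurable g volume := by
    have h1 := (Complex.continuous_ofReal.comp (continuous_wt (-r))).aestronglyMeasurable
      (μ := volume)
    refine (h1.mul hg.1).congr (Eventually.of_forall fun ξ ↦ ?_)
    simp only [Pi.mul_apply, Function.comp_apply]
    rw [← mul_assoc, ← Complex.ofReal_mul, ← wt_add]
    simp [wt_zero]
  refine hg.of_le hm (Eventually.of_forall fun ξ ↦ ?_)
  rw [norm_mul, Complex.norm_real, Real.norm_of_nonneg (wt_pos _ _).le]
  exact le_mul_of_one_le_left (norm_nonneg _) (one_le_wt hr ξ)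

theorem aestronglyMeasurable_of_wt {h : E3 → ℂ} {r : ℝ}
    (hh : AEStronglyMeasurable (fun ξ ↦ wt r ξ * h ξ) volume) : AEStronglyMeasurable h volume := by
  have h1 := (Complex.continuous_ofReal.comp (continuous_wt (-r))).aestronglyMeasurable
    (μ := volume)
  refine (h1.mul hh).congr (Eventually.of_forall fun ξ ↦ ?_)
  simp only [Pi.mul_apply, Function.comp_apply]
  rw [← mul_assoc, ← Complex.ofReal_mul, ← wt_add]
  simp [wt_zero]

theorem locallyIntegrable_of_wt {h : E3 → ℂ} {r : ℝ}
    (hh : MemLp (fun ξ ↦ wt r ξ * h ξ) 2 volume) : LocallyIntegrable h volume := by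
  refine (locallyIntegrable_wt_mul hh.locInt (-r)).congr (Eventually.of_forall fun ξ ↦ ?_)
  simp only
  rw [← mul_assoc, ← Complex.ofReal_mul, ← wt_add]
  simp [wt_zero]

theorem mul_le_half_sq_add (a b : ℝ) : a * b ≤ 2⁻¹ * (a ^ 2 + b ^ 2) := by
  nlinarith [sq_nonneg (a - b)]

theorem wt_mul_wt_neg (r : ℝ) (ξ : E3) : wt r ξ * wt (-r) ξ = 1 := by
  rw [← wt_add]; simp [wt_zero]

/-- The pointwise bound behind all integrability statements for `star`. -/
theorem norm_mul_le_weighted (h g : E3 → ℂ) (ζ η : E3) :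
    ‖h (ζ - η) * g η‖ ≤ 2 ^ (1 / 4 : ℝ) * wt (1 / 4) ζ *
      (2⁻¹ * (‖(wt (-(1 / 4)) (ζ - η) : ℂ) * h (ζ - η)‖ ^ 2 + ‖(wt (1 / 4) η : ℂ) * g η‖ ^ 2)) := by
  refine le_trans ?_ (mul_le_mul_of_nonneg_left (mul_le_half_sq_add _ _)
    (mul_nonneg (by positivity) (wt_pos _ _).le))
  simp only [norm_mul, Complex.norm_real, Real.norm_of_nonneg (wt_pos _ _).le]
  -- Peetre's inequality trades the weight at ζ - η for weights at ζ and η, the latter being the one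
  -- carried by `g`.
  have h1 := wt_le (r := 1 / 4) (by norm_num) ζ (-η)
  rw [wt_neg, ← sub_eq_add_neg] at h1
  have h2 := wt_mul_wt_neg (1 / 4) (ζ - η)
  have h3 := wt_pos (-(1 / 4)) (ζ - η)
  calc ‖h (ζ - η)‖ * ‖g η‖
      = (wt (1 / 4) (ζ - η) * wt (-(1 / 4)) (ζ - η)) * (‖h (ζ - η)‖ * ‖g η‖) := by rw [h2, one_mul]
    _ ≤ ((2 ^ (1 / 4 : ℝ) * (wt (1 / 4) ζ * wt (1 / 4) η)) * wt (-(1 / 4)) (ζ - η)) *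
        (‖h (ζ - η)‖ * ‖g η‖) := by gcongr
    _ = _ := by ring

theorem integrable_norm_sq {f : E3 → ℂ} (hf : MemLp f 2 volume) :
    Integrable (fun x ↦ ‖f x‖ ^ 2) volume := (memLp_two_iff_integrable_sq_norm hf.1).1 hf

theorem aestronglyMeasurable_comp_sub {h : E3 → ℂ} (hh : AEStronglyMeasurable h volume) :
    AEStronglyMeasurable (fun p : E3 × E3 ↦ h (p.1 - p.2)) (volume.prod volume) :=
  hh.comp_quasiMeasurePreserving (quasiMeasurePreserving_sub volume volume)

section

variable {h g : E3 → ℂ} (H : WeightedPair h g)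
include H

theorem WeightedPair.measurable_left : AEStronglyMeasurable h volume :=
  aestronglyMeasurable_of_wt H.left.1

theorem WeightedPair.measurable_right : AEStronglyMeasurable g volume :=
  aestronglyMeasurable_of_wt H.right.1

theorem WeightedPair.integrable_star (ζ : E3) : Integrable (fun η ↦ h (ζ - η) * g η) volume := by
  have h1 : Integrable (fun η ↦ ‖(wt (-(1 / 4)) (ζ - η) : ℂ) * h (ζ - η)‖ ^ 2) volume :=
    (integrable_norm_sq H.left).comp_sub_left ζ
  have hm : AEStronglyMeasurable (fun η ↦ h (ζ - η) * g η) volume :=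
    (H.measurable_left.comp_quasiMeasurePreserving
      (Measure.measurePreserving_sub_left volume ζ).quasiMeasurePreserving).mul H.measurable_right
  exact Integrable.mono' (((h1.add (integrable_norm_sq H.right)).const_mul 2⁻¹).const_mul _) hm
    (Eventually.of_forall fun η ↦ norm_mul_le_weighted h g ζ η)

/-- Integrating the pointwise bound in η leaves a growth of order (1 + |ζ|²)^(1/4), which any
Schwartz symbol absorbs. This is why S_Q(u_i ω_j) is a genuine L² function although u_i ω_j is not.
-/
theorem WeightedPair.norm_star_le : ∃ C : ℝ, ∀ ζ, ‖star h g ζ‖ ≤ C * wt (1 / 4) ζ := by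
  refine ⟨2 ^ (1 / 4 : ℝ) * (2⁻¹ * ((∫ η, ‖(wt (-(1 / 4)) η : ℂ) * h η‖ ^ 2) +
    ∫ η, ‖(wt (1 / 4) η : ℂ) * g η‖ ^ 2)), fun ζ ↦ ?_⟩
  have h1 : Integrable (fun η ↦ ‖(wt (-(1 / 4)) (ζ - η) : ℂ) * h (ζ - η)‖ ^ 2) volume :=
    (integrable_norm_sq H.left).comp_sub_left ζ
  have h2 := norm_integral_le_of_norm_le
    (((h1.add (integrable_norm_sq H.right)).const_mul 2⁻¹).const_mul
      (2 ^ (1 / 4 : ℝ) * wt (1 / 4) ζ))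
    (Eventually.of_forall fun η ↦ norm_mul_le_weighted h g ζ η)
  refine h2.trans_eq ?_
  have h3 := integral_sub_left_eq_self (fun η ↦ ‖(wt (-(1 / 4)) η : ℂ) * h η‖ ^ 2) volume ζ
  rw [integral_const_mul, integral_const_mul]
  have h4 := integral_add h1 (integrable_norm_sq H.right)
  simp only [Pi.add_apply] at *
  rw [h4, h3]
  ring

theorem WeightedPair.aestronglyMeasurable_prod :
    AEStronglyMeasurable (fun p : E3 × E3 ↦ h (p.1 - p.2) * g p.2) (volume.prod volume) :=
  (aestronglyMeasurable_comp_sub H.measurable_left).mul H.measurable_right.comp_snd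

theorem WeightedPair.aestronglyMeasurable_star : AEStronglyMeasurable (star h g) volume :=
  H.aestronglyMeasurable_prod.integral_prod_right'

theorem WeightedPair.norm_schwartz_mul_star_le (s : 𝓢(E3, ℂ)) : ∃ C : ℝ, ∀ ζ,
    ‖s ζ * star h g ζ‖ ≤ C * ‖wtS (1 / 4) s ζ‖ := by
  obtain ⟨C, hC⟩ := H.norm_star_le
  refine ⟨C, fun ζ ↦ ?_⟩
  rw [norm_mul, wtS_apply, norm_mul, Complex.norm_real, Real.norm_of_nonneg (wt_pos _ _).le]
  calc _ ≤ ‖s ζ‖ * (C * wt (1 / 4) ζ) := by gcongr; exact hC ζ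
    _ = _ := by ring

theorem WeightedPair.memLp_schwartz_mul_star (s : 𝓢(E3, ℂ)) :
    MemLp (fun ζ ↦ s ζ * star h g ζ) 2 volume := by
  obtain ⟨C, hC⟩ := H.norm_schwartz_mul_star_le s
  exact (memLp_schwartz (wtS (1 / 4) s) 2).of_le_mul
    (s.continuous.aestronglyMeasurable.mul H.aestronglyMeasurable_star)
    (Eventually.of_forall hC)

theorem WeightedPair.integrable_schwartz_mul_star (s : 𝓢(E3, ℂ)) :
    Integrable (fun ζ ↦ s ζ * star h g ζ) volume := by
  obtain ⟨C, hC⟩ := H.norm_schwartz_mul_star_le s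
  exact ((wtS (1 / 4) s).integrable.norm.const_mul C).mono'
    (s.continuous.aestronglyMeasurable.mul H.aestronglyMeasurable_star)
    (Eventually.of_forall hC)

theorem WeightedPair.integrable_prod (s : 𝓢(E3, ℂ)) :
    Integrable (fun p : E3 × E3 ↦ s p.1 * (h (p.1 - p.2) * g p.2)) (volume.prod volume) := by
  have hm : AEStronglyMeasurable (fun p : E3 × E3 ↦ s p.1 * (h (p.1 - p.2) * g p.2))
      (volume.prod volume) :=
    (s.continuous.comp continuous_fst).aestronglyMeasurable.mul H.aestronglyMeasurable_prod
  have hK : Integrable (fun ζ ↦ ‖wtS (1 / 4) s ζ‖) volume := (wtS (1 / 4) s).integrable.norm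
  have h1 : Integrable (fun p : E3 × E3 ↦ ‖wtS (1 / 4) s p.1‖ *
      ‖(wt (1 / 4) p.2 : ℂ) * g p.2‖ ^ 2) (volume.prod volume) :=
    hK.mul_prod (integrable_norm_sq H.right)
  have h2 : Integrable (fun p : E3 × E3 ↦ ‖wtS (1 / 4) s p.1‖ *
      ‖(wt (-(1 / 4)) (p.1 - p.2) : ℂ) * h (p.1 - p.2)‖ ^ 2) (volume.prod volume) := by
    -- The shear (ζ, η) ↦ (ζ, η - ζ) preserves the measure and separates the variables; the
    -- reflection of `h` compensates the sign.
    have hp := hK.mul_prod (integrable_norm_sq (memLp_comp_neg H.left))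
    have := (measurePreserving_prod_neg_add (volume : Measure E3) (volume : Measure E3)
      ).integrable_comp_of_integrable hp
    refine this.congr (Eventually.of_forall fun p ↦ ?_)
    simp only [Function.comp_apply]
    rw [show -(-p.1 + p.2) = p.1 - p.2 by abel]
  refine ((h1.add h2).const_mul (2 ^ (1 / 4 : ℝ) * 2⁻¹)).mono' hm
    (Eventually.of_forall fun p ↦ ?_)
  rw [norm_mul]
  refine (mul_le_mul_of_nonneg_left (norm_mul_le_weighted h g p.1 p.2) (norm_nonneg _)).trans_eq ?_
  have : ‖wtS (1 / 4) s p.1‖ = wt (1 / 4) p.1 * ‖s p.1‖ := by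
    rw [wtS_apply, norm_mul, Complex.norm_real, Real.norm_of_nonneg (wt_pos _ _).le]
  simp only [Pi.add_apply]
  rw [this]
  ring

/-- The substitution ζ = ξ + η turns the mollified product into a pairing of `h` with a function
built from `s` and `g`, which is the shape of ⟨ω_j, ψ u_i⟩. -/
theorem WeightedPair.integral_swap (s : 𝓢(E3, ℂ)) :
    ∫ ζ, s ζ * star h g ζ = ∫ ξ, h ξ * ∫ η, s (ξ + η) * g η := by
  have hF := H.integrable_prod s
  have hF' : Integrable (fun p : E3 × E3 ↦ s (p.1 + p.2) * (h p.1 * g p.2))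
      (volume.prod volume) := by
    have := (measurePreserving_add_prod (volume : Measure E3) (volume : Measure E3)
      ).integrable_comp_of_integrable hF
    refine this.congr (Eventually.of_forall fun p ↦ ?_)
    simp only [Function.comp_apply]
    rw [show p.1 + p.2 - p.2 = p.1 by abel]
  calc ∫ ζ, s ζ * star h g ζ = ∫ ζ, ∫ η, s ζ * (h (ζ - η) * g η) := by
        simp only [star, integral_const_mul]
    _ = ∫ η, ∫ ζ, s ζ * (h (ζ - η) * g η) := integral_integral_swap hF
    _ = ∫ η, ∫ ξ, s (ξ + η) * (h ξ * g η) := by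
        refine integral_congr_ae (Eventually.of_forall fun η ↦ ?_)
        simp only
        rw [← integral_add_right_eq_self _ η]
        simp
    _ = ∫ ξ, ∫ η, s (ξ + η) * (h ξ * g η) := (integral_integral_swap hF').symm
    _ = _ := by
        refine integral_congr_ae (Eventually.of_forall fun ξ ↦ ?_)
        simp only
        rw [← integral_const_mul]
        refine integral_congr_ae (Eventually.of_forall fun η ↦ ?_)
        simp only
        ring

end

/-- The distribution `h`-times-`g` tested with the kernel `k(x - ·)`. -/
theorem integral_mul_hat_kernel (s : 𝓢(E3, ℂ)) {h g : E3 → ℂ} (hg : MemLp g 2 volume)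
    (H : WeightedPair h (hat g)) (x : E3) {k : 𝓢(E3, ℂ)}
    (hk : ∀ y, k y = (𝓕⁻ s : 𝓢(E3, ℂ)) (x - y)) :
    ∫ ξ, h ξ * hat (fun y ↦ k y * g y) (-ξ) = 𝓕⁻ (fun ζ ↦ s ζ * star h (hat g) ζ) x := by
  obtain ⟨κ, h1, h2⟩ := exists_modulation s x
  have hkκ : k = 𝓕 κ := by ext y; rw [hk, h2]
  have h3 := (Measure.measurePreserving_neg
    (volume : Measure E3)).quasiMeasurePreserving.ae_eq_comp (hat_schwartz_mul k hg)
  rw [fourierInv_eq_exp]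
  simp only [← mul_assoc, ← h1]
  rw [H.integral_swap κ]
  refine integral_congr_ae ?_
  filter_upwards [h3] with ξ hξ
  simp only [Function.comp_apply] at hξ
  rw [hξ, conv_eq, hkκ]
  have : ∀ η, (𝓕 (𝓕 κ)) (-ξ - η) = κ (ξ + η) := by
    intro η
    have := DFunLike.congr_fun (SchwartzMap.fourierInv_apply_eq (𝓕 κ)) (ξ + η)
    rw [fourierInv_fourier_eq] at this
    rw [this]
    simp [sub_eq_add_neg, add_comm]
  simp only [this]

/-! ### Integral inequalities -/

/-- Hölder's inequality for the measure k dμ, by splitting k = k^(1 - 1/p) k^(1/p). -/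
theorem rpow_lintegral_mul_le {α : Type*} [MeasurableSpace α] {μ : Measure α} {p : ℝ} (hp : 1 < p)
    {k G : α → ℝ≥0∞} (hk : AEMeasurable k μ) (hG : AEMeasurable G μ) :
    (∫⁻ y, k y * G y ∂μ) ^ p ≤ (∫⁻ y, k y ∂μ) ^ (p - 1) * ∫⁻ y, k y * G y ^ p ∂μ := by
  have hp0 : 0 < p := by linarith
  have h1 : 0 ≤ 1 - 1 / p := by
    rw [sub_nonneg, div_le_one hp0]; exact hp.le
  have h := ENNReal.lintegral_mul_norm_pow_le hk (hk.mul (hG.pow_const p)) h1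
    (by positivity : 0 ≤ 1 / p) (by ring)
  have h2 : ∀ y, k y ^ (1 - 1 / p) * (k y * G y ^ p) ^ (1 / p) = k y * G y := by
    intro y
    rw [ENNReal.mul_rpow_of_nonneg _ _ (by positivity), ← ENNReal.rpow_mul, mul_one_div_cancel
      hp0.ne', ENNReal.rpow_one, ← mul_assoc, ← ENNReal.rpow_add_of_nonneg _ _ h1 (by positivity)]
    simp
  simp only [Pi.mul_apply, h2] at h
  calc _ ≤ ((∫⁻ y, k y ∂μ) ^ (1 - 1 / p) * (∫⁻ y, k y * G y ^ p ∂μ) ^ (1 / p)) ^ p := by gcongr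
    _ = _ := by
      rw [ENNReal.mul_rpow_of_nonneg _ _ hp0.le, ← ENNReal.rpow_mul, ← ENNReal.rpow_mul,
        one_div_mul_cancel hp0.ne', ENNReal.rpow_one]
      congr 2
      field_simp

theorem lintegral_rpow_lintegral_mul_le {α β : Type*} [MeasurableSpace α] [MeasurableSpace β]
    {μ : Measure α} {ν : Measure β} [SFinite μ] [SFinite ν] {p : ℝ} (hp : 1 < p)
    {k : β → ℝ≥0∞} {G : α → β → ℝ≥0∞} (hk : AEMeasurable k ν)
    (hG : AEMeasurable (fun z : α × β ↦ G z.1 z.2) (μ.prod ν))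
    (hG' : ∀ x, AEMeasurable (G x) ν) (hG'' : ∀ y, AEMeasurable (fun x ↦ G x y) μ)
    (hk' : ∫⁻ y, k y ∂ν ≠ ⊤) :
    ∫⁻ x, (∫⁻ y, k y * G x y ∂ν) ^ p ∂μ ≤
      (∫⁻ y, k y ∂ν) ^ (p - 1) * ∫⁻ y, k y * ∫⁻ x, G x y ^ p ∂μ ∂ν := by
  calc _ ≤ ∫⁻ x, (∫⁻ y, k y ∂ν) ^ (p - 1) * ∫⁻ y, k y * G x y ^ p ∂ν ∂μ :=
        lintegral_mono fun x ↦ rpow_lintegral_mul_le hp hk (hG' x)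
    _ = (∫⁻ y, k y ∂ν) ^ (p - 1) * ∫⁻ x, ∫⁻ y, k y * G x y ^ p ∂ν ∂μ :=
        lintegral_const_mul' _ _ (ENNReal.rpow_ne_top_of_nonneg (by linarith) hk')
    _ = _ := by
      rw [lintegral_lintegral_swap (hk.comp_snd.mul (hG.pow_const p))]
      congr 1
      refine lintegral_congr fun y ↦ ?_
      rw [lintegral_const_mul'' _ ((hG'' y).pow_const p)]

theorem aemeasurable_comp_sub_left {g : E3 → ℝ≥0∞} (hg : AEMeasurable g volume) (x : E3) :
    AEMeasurable (fun y ↦ g (x - y)) volume :=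
  hg.comp_quasiMeasurePreserving
    (Measure.measurePreserving_sub_left volume x).quasiMeasurePreserving

/-- Young's convolution inequality `L¹ * L^p ⊆ L^p`. -/
theorem lintegral_conv_rpow_le {p : ℝ} (hp : 1 < p) {k g : E3 → ℝ≥0∞} (hk : AEMeasurable k volume)
    (hk' : ∫⁻ y, k y ≠ ⊤) (hg : AEMeasurable g volume) :
    ∫⁻ x, (∫⁻ y, k y * g (x - y)) ^ p ≤ (∫⁻ y, k y) ^ p * ∫⁻ x, g x ^ p := by
  have h := lintegral_rpow_lintegral_mul_le (μ := (volume : Measure E3)) hp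
    (G := fun x y ↦ g (x - y)) hk
    (hg.comp_quasiMeasurePreserving (quasiMeasurePreserving_sub volume volume))
    (aemeasurable_comp_sub_left hg)
    (fun y ↦ hg.comp_quasiMeasurePreserving
      (measurePreserving_sub_right volume y).quasiMeasurePreserving) hk'
  refine h.trans_eq ?_
  simp only [lintegral_sub_right_eq_self (fun x ↦ g x ^ p)]
  rw [lintegral_mul_const'' _ hk, ← mul_assoc]
  congr 1
  nth_rewrite 2 [← ENNReal.rpow_one (∫⁻ y, k y)]
  rw [← ENNReal.rpow_add_of_nonneg _ _ (by linarith) zero_le_one]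
  simp

theorem enorm_conv_le (k f : E3 → ℂ) (x : E3) : ‖conv k f x‖ₑ ≤ ∫⁻ y, ‖k y‖ₑ * ‖f (x - y)‖ₑ := by
  refine (enorm_integral_le_lintegral_enorm _).trans_eq ?_
  simp only [enorm_mul]

theorem eLpNorm_le_of_lintegral_rpow_le {f : E3 → ℂ} {p : ℝ} (hp : 0 < p) {C : ℝ≥0∞}
    (h : ∫⁻ x, ‖f x‖ₑ ^ p ≤ C ^ p) : eLpNorm f (ENNReal.ofReal p) volume ≤ C := by
  rw [eLpNorm_eq_lintegral_rpow_enorm_toReal (by simpa using hp) (by simp),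
    ENNReal.toReal_ofReal hp.le]
  calc _ ≤ (C ^ p) ^ (1 / p) := by gcongr
    _ = C := by rw [← ENNReal.rpow_mul, mul_one_div_cancel hp.ne', ENNReal.rpow_one]

theorem eLpNorm_ofReal_rpow {f : E3 → ℂ} {p : ℝ} (hp : 0 < p) :
    eLpNorm f (ENNReal.ofReal p) volume ^ p = ∫⁻ x, ‖f x‖ₑ ^ p := by
  rw [eLpNorm_eq_lintegral_rpow_enorm_toReal (by simpa using hp) (by simp),
    ENNReal.toReal_ofReal hp.le, ← ENNReal.rpow_mul, one_div_mul_cancel hp.ne', ENNReal.rpow_one]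

theorem eLpNorm_conv_le {p : ℝ} (hp : 1 < p) {k f : E3 → ℂ}
    (hk : Integrable k volume) (hf : AEStronglyMeasurable f volume) :
    eLpNorm (conv k f) (ENNReal.ofReal p) volume ≤
      (∫⁻ y, ‖k y‖ₑ) * eLpNorm f (ENNReal.ofReal p) volume := by
  have hp0 : 0 < p := by linarith
  refine eLpNorm_le_of_lintegral_rpow_le hp0 ?_
  rw [ENNReal.mul_rpow_of_nonneg _ _ hp0.le, eLpNorm_ofReal_rpow hp0]
  refine le_trans (lintegral_mono fun x ↦ ?_) (lintegral_conv_rpow_le hp hk.1.enorm hk.2.ne hf.enorm)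
  gcongr
  exact enorm_conv_le k f x

theorem eLpNorm_three_conv_le {k f : E3 → ℂ}
    (hk : Integrable k volume) (hf : AEStronglyMeasurable f volume) :
    eLpNorm (conv k f) 3 volume ≤ (∫⁻ y, ‖k y‖ₑ) * eLpNorm f 3 volume := by
  simpa using eLpNorm_conv_le (p := 3) (by norm_num) hk hf

/-- Peetre's inequality distributes the weight over the kernel and `g`, and Young's inequality in L²
concludes. On the physical side, multiplication by a Schwartz function preserves H^{1/2}, as the
definition of u_i ω_j requires. -/
theorem wt_conv_memLp (k : 𝓢(E3, ℂ)) {g : E3 → ℂ}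
    (hg : MemLp (fun ξ ↦ wt (1 / 4) ξ * g ξ) 2 volume) :
    MemLp (fun ξ ↦ wt (1 / 4) ξ * conv k g ξ) 2 volume := by
  have hg2 := memLp_two_of_wt (by norm_num) hg
  have hm : AEStronglyMeasurable (conv k g) volume := by
    have h1 : k = 𝓕⁻ (𝓕 k) := (fourierInv_fourier_eq k).symm
    rw [h1]
    exact (continuous_conv _ hg2).aestronglyMeasurable
  refine ⟨((Complex.continuous_ofReal.comp (continuous_wt _)).aestronglyMeasurable).mul hm, ?_⟩
  rw [eLpNorm_lt_top_iff_lintegral_rpow_enorm_lt_top (by norm_num) (by norm_num)]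
  have hY := lintegral_conv_rpow_le (p := 2) (by norm_num)
    ((wtS (1 / 4) k).continuous.aestronglyMeasurable (μ := volume)).enorm
    (wtS (1 / 4) k).integrable.2.ne hg.1.enorm
  have hb : ∀ x, ‖(wt (1 / 4) x : ℂ) * conv k g x‖ₑ ≤ ENNReal.ofReal (2 ^ (1 / 4 : ℝ)) *
      ∫⁻ y, ‖wtS (1 / 4) k y‖ₑ * ‖(wt (1 / 4) (x - y) : ℂ) * g (x - y)‖ₑ := by
    intro x
    rw [enorm_mul]
    calc _ ≤ ‖(wt (1 / 4) x : ℂ)‖ₑ * ∫⁻ y, ‖k y‖ₑ * ‖g (x - y)‖ₑ := by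
          gcongr; exact enorm_conv_le _ _ _
      _ = ∫⁻ y, ‖(wt (1 / 4) x : ℂ)‖ₑ * (‖k y‖ₑ * ‖g (x - y)‖ₑ) :=
          (lintegral_const_mul' _ _ enorm_ne_top).symm
      _ ≤ ∫⁻ y, ENNReal.ofReal (2 ^ (1 / 4 : ℝ)) *
          (‖wtS (1 / 4) k y‖ₑ * ‖(wt (1 / 4) (x - y) : ℂ) * g (x - y)‖ₑ) := by
          refine lintegral_mono fun y ↦ ?_
          rw [wtS_apply, enorm_mul, enorm_mul]
          have h1 := wt_le (r := 1 / 4) (by norm_num) y (x - y)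
          rw [add_sub_cancel] at h1
          have h2 : ∀ z, ‖(wt (1 / 4) z : ℂ)‖ₑ = ENNReal.ofReal (wt (1 / 4) z) := fun z ↦ by
            rw [← ofReal_norm, Complex.norm_real, Real.norm_of_nonneg (wt_pos _ _).le]
          rw [h2, h2, h2]
          have h3 := ENNReal.ofReal_le_ofReal h1
          rw [ENNReal.ofReal_mul (by positivity), ENNReal.ofReal_mul (wt_pos _ _).le] at h3
          calc _ ≤ (ENNReal.ofReal (2 ^ (1 / 4 : ℝ)) * (ENNReal.ofReal (wt (1 / 4) y) *
                ENNReal.ofReal (wt (1 / 4) (x - y)))) * (‖k y‖ₑ * ‖g (x - y)‖ₑ) := by gcongr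
            _ = _ := by ring
      _ = _ := lintegral_const_mul' _ _ ENNReal.ofReal_ne_top
  have h3 : ∫⁻ y, ‖wtS (1 / 4) k y‖ₑ < ⊤ := (wtS (1 / 4) k).integrable.2
  have h4 := lintegral_rpow_enorm_lt_top_of_eLpNorm_lt_top (p := 2) (by norm_num) (by norm_num) hg.2
  simp only [ENNReal.toReal_ofNat] at h4 ⊢
  calc _ ≤ ∫⁻ x, (ENNReal.ofReal (2 ^ (1 / 4 : ℝ)) *
      ∫⁻ y, ‖wtS (1 / 4) k y‖ₑ * ‖(wt (1 / 4) (x - y) : ℂ) * g (x - y)‖ₑ) ^ (2 : ℝ) := by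
        refine lintegral_mono fun x ↦ ?_
        gcongr
        exact hb x
    _ = ENNReal.ofReal (2 ^ (1 / 4 : ℝ)) ^ (2 : ℝ) * ∫⁻ x,
      (∫⁻ y, ‖wtS (1 / 4) k y‖ₑ * ‖(wt (1 / 4) (x - y) : ℂ) * g (x - y)‖ₑ) ^ (2 : ℝ) := by
        simp only [ENNReal.mul_rpow_of_nonneg _ _ zero_le_two]
        exact lintegral_const_mul' _ _ (ENNReal.rpow_ne_top_of_nonneg zero_le_two
          ENNReal.ofReal_ne_top)
    _ ≤ ENNReal.ofReal (2 ^ (1 / 4 : ℝ)) ^ (2 : ℝ) * ((∫⁻ y, ‖wtS (1 / 4) k y‖ₑ) ^ (2 : ℝ) *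
        ∫⁻ x, ‖(wt (1 / 4) x : ℂ) * g x‖ₑ ^ (2 : ℝ)) := by gcongr
    _ < ⊤ := ENNReal.mul_lt_top (ENNReal.rpow_lt_top_of_nonneg zero_le_two ENNReal.ofReal_ne_top)
        (ENNReal.mul_lt_top (ENNReal.rpow_lt_top_of_nonneg zero_le_two h3.ne) h4)

/-- Hölder's inequality for three functions in `L³`. -/
theorem lintegral_mul_mul_le {f g h : E3 → ℝ≥0∞} (hf : AEMeasurable f volume)
    (hg : AEMeasurable g volume) (hh : AEMeasurable h volume) :
    ∫⁻ x, f x * g x * h x ≤ (∫⁻ x, f x ^ 3) ^ (1 / 3 : ℝ) * (∫⁻ x, g x ^ 3) ^ (1 / 3 : ℝ) *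
      (∫⁻ x, h x ^ 3) ^ (1 / 3 : ℝ) := by
  have := ENNReal.lintegral_prod_norm_pow_le (μ := (volume : Measure E3)) (Finset.univ : Finset (Fin 3))
    (f := ![fun x ↦ f x ^ 3, fun x ↦ g x ^ 3, fun x ↦ h x ^ 3]) (p := fun _ ↦ 1 / 3)
    (by
      intro i _
      fin_cases i
      · exact hf.pow_const 3
      · exact hg.pow_const 3
      · exact hh.pow_const 3) (by simp) (by simp)
  simp only [Fin.prod_univ_three] at this
  have h3 : ∀ a : ℝ≥0∞, (a ^ 3) ^ (3⁻¹ : ℝ) = a := fun a ↦ by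
    rw [← ENNReal.rpow_natCast, ← ENNReal.rpow_mul]; norm_num
  simpa [h3] using this

theorem eLpNorm_three_eq (f : E3 → ℂ) :
    eLpNorm f 3 volume = (∫⁻ x, ‖f x‖ₑ ^ 3) ^ (1 / 3 : ℝ) := by
  rw [← eLpNorm_three_pow, ← ENNReal.rpow_natCast, ← ENNReal.rpow_mul]; norm_num

theorem lintegral_enorm_mul_mul_le {f g h : E3 → ℂ} (hf : AEStronglyMeasurable f volume)
    (hg : AEStronglyMeasurable g volume) (hh : AEStronglyMeasurable h volume) :
    ∫⁻ x, ‖f x‖ₑ * ‖g x‖ₑ * ‖h x‖ₑ ≤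
      eLpNorm f 3 volume * eLpNorm g 3 volume * eLpNorm h 3 volume := by
  rw [eLpNorm_three_eq, eLpNorm_three_eq, eLpNorm_three_eq]
  exact lintegral_mul_mul_le hf.enorm hg.enorm hh.enorm

/-- Minkowski's integral inequality in `L³`, for a superposition dominated by a weight `B`. -/
theorem eLpNorm_three_le_of_superposition {k : E3 → ℝ≥0∞} {G : E3 → E3 → ℂ} {F : E3 → ℂ}
    {B : E3 → ℝ≥0} (hB : Measurable B) (hB0 : ∀ y, B y ≠ 0) (hk : AEMeasurable k volume)
    (hG : AEStronglyMeasurable (fun z : E3 × E3 ↦ G z.1 z.2) (volume.prod volume))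
    (hG' : ∀ x, AEStronglyMeasurable (G x) volume)
    (hG'' : ∀ y, AEStronglyMeasurable (fun x ↦ G x y) volume)
    (hGB : ∀ y, eLpNorm (fun x ↦ G x y) 3 volume ≤ B y)
    (hF : ∀ x, ‖F x‖ₑ ≤ ∫⁻ y, k y * ‖G x y‖ₑ) :
    eLpNorm F 3 volume ≤ ∫⁻ y, k y * B y := by
  by_cases hkB : ∫⁻ y, k y * B y = ⊤
  · rw [hkB]; exact le_top
  have hBm : Measurable fun y ↦ (B y : ℝ≥0∞) := hB.coe_nnreal_ennreal
  have hBi : ∀ y, (B y : ℝ≥0∞) * (B y : ℝ≥0∞)⁻¹ = 1 := fun y ↦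
    ENNReal.mul_inv_cancel (by simpa using hB0 y) ENNReal.coe_ne_top
  -- Jensen's inequality is applied to G / B with the weight k B, so that every slice has L³ norm at
  -- most 1; the division is what needs B ≠ 0.
  have h := lintegral_rpow_lintegral_mul_le (μ := (volume : Measure E3)) (p := 3) (by norm_num)
    (k := fun y ↦ k y * B y) (G := fun x y ↦ (B y : ℝ≥0∞)⁻¹ * ‖G x y‖ₑ)
    (hk.mul hBm.aemeasurable)
    ((hBm.inv.comp measurable_snd).aemeasurable.mul hG.enorm)
    (fun x ↦ hBm.inv.aemeasurable.mul (hG' x).enorm)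
    (fun y ↦ (hG'' y).enorm.const_mul _) hkB
  have h1 : ∀ x y, k y * B y * ((B y : ℝ≥0∞)⁻¹ * ‖G x y‖ₑ) = k y * ‖G x y‖ₑ := by
    intro x y
    calc _ = k y * ((B y : ℝ≥0∞) * (B y : ℝ≥0∞)⁻¹) * ‖G x y‖ₑ := by ring
      _ = _ := by rw [hBi, mul_one]
  simp only [h1] at h
  have h2 : ∀ y, ∫⁻ x, ((B y : ℝ≥0∞)⁻¹ * ‖G x y‖ₑ) ^ (3 : ℝ) ≤ 1 := by
    intro y
    have h3 : ∀ x, ((B y : ℝ≥0∞)⁻¹ * ‖G x y‖ₑ) ^ (3 : ℝ) =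
        ((B y : ℝ≥0∞)⁻¹) ^ 3 * ‖G x y‖ₑ ^ 3 := fun x ↦ by
      rw [← mul_pow]; norm_cast
    simp only [h3]
    rw [lintegral_const_mul' _ _ (ENNReal.pow_ne_top (ENNReal.inv_ne_top.2 (by simpa using hB0 y))),
      ← eLpNorm_three_pow, ← mul_pow]
    calc _ ≤ ((B y : ℝ≥0∞)⁻¹ * B y) ^ 3 := by gcongr; exact hGB y
      _ = 1 := by rw [mul_comm, hBi, one_pow]
  have h4 : eLpNorm F (ENNReal.ofReal 3) volume ≤ ∫⁻ y, k y * B y := by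
    refine eLpNorm_le_of_lintegral_rpow_le (by norm_num) ?_
    calc _ ≤ ∫⁻ x, (∫⁻ y, k y * ‖G x y‖ₑ) ^ (3 : ℝ) := by
          refine lintegral_mono fun x ↦ ?_
          gcongr
          exact hF x
      _ ≤ _ := h
      _ ≤ (∫⁻ y, k y * B y) ^ ((3 : ℝ) - 1) * ∫⁻ y, k y * B y * 1 := by
          gcongr with y
          exact h2 y
      _ = _ := by
          simp only [mul_one]
          nth_rewrite 2 [← ENNReal.rpow_one (∫⁻ y, k y * B y)]
          rw [← ENNReal.rpow_add_of_nonneg _ _ (by norm_num) zero_le_one]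
          norm_num
  simpa using h4

/-! ### Components of vector fields -/

theorem toTemperedDistribution_apply_coord {p : ℝ≥0∞} [hp : Fact (1 ≤ p)]
    (F : Lp C3 p (volume : Measure E3)) (ψ : 𝓢(E3, ℂ)) (i : Fin 3) :
    ((F : 𝓢'(E3, C3)) ψ) i = ∫ x, ψ x * F x i := by
  rw [Lp.toTemperedDistribution_apply]
  have := ENNReal.HolderConjugate.inv_one_sub_inv' hp.out
  have hi : Integrable (fun x ↦ ψ x • F x) volume := by
    refine memLp_one_iff_integrable.1 ?_
    exact MemLp.smul (p := (1 - p⁻¹)⁻¹) (q := p) (Lp.memLp F) (memLp_schwartz ψ _)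
  have := (EuclideanSpace.proj (𝕜 := ℂ) i : C3 →L[ℂ] ℂ).integral_comp_comm hi
  exact this.symm

/-- The `i`-th component of a vector field, as a complex-valued function. -/
def cmp (u : Lp E3 2 (volume : Measure E3)) (i : Fin 3) : E3 → ℂ := fun x ↦ ((u x i : ℝ) : ℂ)

/-- The Fourier transform of the `i`-th component. -/
def cmpHat (u : Lp E3 2 (volume : Measure E3)) (i : Fin 3) : E3 → ℂ := hat (cmp u i)

/-- The symbol of `∂_a` applied to a function on the Fourier side. -/
def dHat (a : Fin 3) (h : E3 → ℂ) : E3 → ℂ :=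
  fun ξ ↦ 2 * Real.pi * Complex.I * (inner ℝ ξ (stdVec a) : ℝ) * h ξ

/-- The Fourier transform of the vorticity. -/
def vortHat (u : Lp E3 2 (volume : Measure E3)) : Fin 3 → E3 → ℂ :=
  ![fun ξ ↦ dHat 1 (cmpHat u 2) ξ - dHat 2 (cmpHat u 1) ξ,
    fun ξ ↦ dHat 2 (cmpHat u 0) ξ - dHat 0 (cmpHat u 2) ξ,
    fun ξ ↦ dHat 0 (cmpHat u 1) ξ - dHat 1 (cmpHat u 0) ξ]

section

variable (u : Lp E3 2 (volume : Measure E3))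

theorem memLp_cmp (i : Fin 3) : MemLp (cmp u i) 2 volume := by
  have := (Complex.ofRealCLM.comp (EuclideanSpace.proj (𝕜 := ℝ) i)).comp_memLp' (Lp.memLp u)
  exact this

theorem comp_eq (i : Fin 3) :
    comp u i = ((memLp_cmp u i).toLp _ : Lp ℂ 2 (volume : Measure E3)) := by
  have : (Complex.ofRealCLM.comp (EuclideanSpace.proj (𝕜 := ℝ) i)).compLp u =
      (memLp_cmp u i).toLp _ := by
    refine Lp.ext ?_
    filter_upwards [(Complex.ofRealCLM.comp (EuclideanSpace.proj (𝕜 := ℝ) i)).coeFn_compLp u,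
      (memLp_cmp u i).coeFn_toLp] with x h1 h2
    rw [h1, h2]; rfl
  rw [comp, this]

theorem comp_apply (i : Fin 3) (ψ : 𝓢(E3, ℂ)) : comp u i ψ = ∫ x, ψ x * cmp u i x := by
  rw [comp_eq, Lp.toTemperedDistribution_apply]
  refine integral_congr_ae ?_
  filter_upwards [(memLp_cmp u i).coeFn_toLp] with x h
  rw [h, smul_eq_mul]

theorem toDist_apply (i : Fin 3) (ψ : 𝓢(E3, ℂ)) : (toDist u ψ) i = comp u i ψ := by
  rw [comp_apply, toDist, toTemperedDistribution_apply_coord]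
  refine integral_congr_ae ?_
  filter_upwards [complexifyCLM.coeFn_compLp u] with x h
  rw [h]
  rfl

theorem hasFourier_comp (i : Fin 3) : HasFourier (comp u i) (cmpHat u i) := by
  have := hasFourier_coe ((memLp_cmp u i).toLp _)
  rw [← comp_eq, hat_congr (Lp.memLp _) (memLp_cmp u i).coeFn_toLp] at this
  exact this

theorem memLp_cmpHat (i : Fin 3) : MemLp (cmpHat u i) 2 volume := memLp_hat _

theorem schwartz_mul_dHat (ψ : 𝓢(E3, ℂ)) (a : Fin 3) (h : E3 → ℂ) :
    (fun ξ ↦ ψ ξ * dHat a h ξ) = fun ξ ↦ dS (stdVec a) ψ ξ * h ξ := by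
  ext ξ
  rw [dS_apply, dHat]; ring

theorem integrable_schwartz_mul_dHat (ψ : 𝓢(E3, ℂ)) (a : Fin 3) {h : E3 → ℂ}
    (hh : MemLp h 2 volume) : Integrable (fun ξ ↦ ψ ξ * dHat a h ξ) volume := by
  rw [schwartz_mul_dHat]
  exact integrable_schwartz_mul _ hh

theorem hasFourier_vorticity (j : Fin 3) : HasFourier (vorticity u j) (vortHat u j) := by
  have key : ∀ a b k l : Fin 3, HasFourier (∂_{stdVec a} (comp u k) - ∂_{stdVec b} (comp u l))
      (fun ξ ↦ dHat a (cmpHat u k) ξ - dHat b (cmpHat u l) ξ) := fun a b k l ↦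
    ((hasFourier_comp u k).lineDeriv (stdVec a)).sub ((hasFourier_comp u l).lineDeriv (stdVec b))
      (fun ψ ↦ integrable_schwartz_mul_dHat ψ a (memLp_cmpHat u k))
      (fun ψ ↦ integrable_schwartz_mul_dHat ψ b (memLp_cmpHat u l))
  fin_cases j
  · exact key 1 2 2 1
  · exact key 2 0 0 2
  · exact key 0 1 1 0

/-- The vector field has components in `H^{1/2}`. -/
def HHalf : Prop := ∀ i, MemLp (fun ξ ↦ wt (1 / 4) ξ * cmpHat u i ξ) 2 volume

variable {u}

theorem bessel_toDist_apply (s : ℝ) (i : Fin 3) (ψ : 𝓢(E3, ℂ)) :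
    (besselPotential E3 C3 s (toDist u) ψ) i = besselPotential E3 ℂ s (comp u i) ψ := by
  rw [besselPotential, besselPotential, fourierMultiplierCLM_apply_apply,
    fourierMultiplierCLM_apply_apply, toDist_apply]

theorem memSobolev_comp_iff (i : Fin 3) : MemSobolev (1 / 2) 2 (comp u i) ↔
    MemLp (fun ξ ↦ wt (1 / 4) ξ * cmpHat u i ξ) 2 volume := by
  have := (hasFourier_comp u i).memSobolev_iff (memLp_cmpHat u i).locInt (1 / 2)
  rw [this]; norm_num

theorem memSobolev_toDist_iff : MemSobolev (1 / 2) 2 (toDist u) ↔ HHalf u := by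
  constructor
  · rintro ⟨F, hF⟩ i
    rw [← memSobolev_comp_iff]
    refine ⟨(EuclideanSpace.proj (𝕜 := ℂ) i : C3 →L[ℂ] ℂ).compLp F, ?_⟩
    ext ψ
    rw [← bessel_toDist_apply, hF, toTemperedDistribution_apply_coord,
      Lp.toTemperedDistribution_apply]
    refine integral_congr_ae ?_
    filter_upwards [(EuclideanSpace.proj (𝕜 := ℂ) i : C3 →L[ℂ] ℂ).coeFn_compLp F] with x h
    rw [h]
    rfl
  · intro h
    have h1 : ∀ i, MemSobolev (1 / 2) 2 (comp u i) := fun i ↦ (memSobolev_comp_iff i).2 (h i)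
    choose F hF using h1
    have hG : MemLp (fun x ↦ WithLp.toLp 2 (fun i ↦ F i x) : E3 → C3) 2 volume := by
      rw [memLp_piLp_iff]
      exact fun i ↦ Lp.memLp (F i)
    refine ⟨hG.toLp _, ?_⟩
    ext ψ i
    rw [bessel_toDist_apply, hF, toTemperedDistribution_apply_coord,
      Lp.toTemperedDistribution_apply]
    refine integral_congr_ae ?_
    filter_upwards [hG.coeFn_toLp] with x hx
    rw [hx]
    rfl

/-- One derivative costs |ξ| ≤ (1 + |ξ|²)^(1/2), the ratio of the weights of H^{1/2} and H^{-1/2}.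
-/
theorem memLp_wt_dHat (a : Fin 3) {h : E3 → ℂ}
    (hh : MemLp (fun ξ ↦ wt (1 / 4) ξ * h ξ) 2 volume) :
    MemLp (fun ξ ↦ wt (-(1 / 4)) ξ * dHat a h ξ) 2 volume := by
  refine hh.of_le_mul (c := 2 * Real.pi) ?_ (Eventually.of_forall fun ξ ↦ ?_)
  · have h1 : Continuous fun ξ : E3 ↦ (wt (-(1 / 4)) ξ : ℂ) :=
      Complex.continuous_ofReal.comp (continuous_wt _)
    have h2 : Continuous fun ξ : E3 ↦ (2 * Real.pi * Complex.I * (inner ℝ ξ (stdVec a) : ℝ) : ℂ) := by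
      fun_prop
    exact h1.aestronglyMeasurable.mul
      (h2.aestronglyMeasurable.mul (aestronglyMeasurable_of_wt hh.1))
  · simp only [dHat, norm_mul, Complex.norm_real, Real.norm_of_nonneg (wt_pos _ _).le,
      Complex.norm_I, Complex.norm_ofNat, Real.norm_of_nonneg Real.pi_pos.le, mul_one]
    have h1 : ‖(inner ℝ ξ (stdVec a) : ℝ)‖ ≤ wt (1 / 4) ξ * wt (1 / 4) ξ := by
      rw [← wt_add]
      refine (norm_inner_le_norm _ _).trans ?_
      have : ‖stdVec a‖ = 1 := by simp [stdVec]
      rw [this, mul_one, wt, show (1 / 4 + 1 / 4 : ℝ) = 1 / 2 by norm_num, ← Real.sqrt_eq_rpow]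
      exact Real.le_sqrt_of_sq_le (by linarith)
    have h2 := wt_mul_wt_neg (1 / 4) ξ
    have h3 := wt_pos (-(1 / 4)) ξ
    calc wt (-(1 / 4)) ξ * (2 * Real.pi * ‖(inner ℝ ξ (stdVec a) : ℝ)‖ * ‖h ξ‖)
        ≤ wt (-(1 / 4)) ξ * (2 * Real.pi * (wt (1 / 4) ξ * wt (1 / 4) ξ) * ‖h ξ‖) := by gcongr
      _ = 2 * Real.pi * ((wt (1 / 4) ξ * wt (-(1 / 4)) ξ) * wt (1 / 4) ξ * ‖h ξ‖) := by ring
      _ = _ := by rw [h2, one_mul]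

theorem weightedPair_dHat (a : Fin 3) {h g : E3 → ℂ}
    (hh : MemLp (fun ξ ↦ wt (1 / 4) ξ * h ξ) 2 volume)
    (hg : MemLp (fun ξ ↦ wt (1 / 4) ξ * g ξ) 2 volume) : WeightedPair (dHat a h) g :=
  ⟨memLp_wt_dHat a hh, hg⟩

theorem weightedPair_self {h g : E3 → ℂ} (hh : MemLp h 2 volume)
    (hg : MemLp (fun ξ ↦ wt (1 / 4) ξ * g ξ) 2 volume) : WeightedPair h g := by
  refine ⟨hh.of_le ?_ (Eventually.of_forall fun ξ ↦ ?_), hg⟩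
  · exact (Complex.continuous_ofReal.comp (continuous_wt _)).aestronglyMeasurable.mul hh.1
  · rw [norm_mul, Complex.norm_real, Real.norm_of_nonneg (wt_pos _ _).le]
    refine mul_le_of_le_one_left (norm_nonneg _) ?_
    exact Real.rpow_le_one_of_one_le_of_nonpos (by nlinarith [sq_nonneg ‖ξ‖]) (by norm_num)

theorem memLp_wt_vortHat (hu : HHalf u) (j : Fin 3) :
    MemLp (fun ξ ↦ wt (-(1 / 4)) ξ * vortHat u j ξ) 2 volume := by
  have key : ∀ a b k l : Fin 3, MemLp (fun ξ ↦ wt (-(1 / 4)) ξ *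
      (dHat a (cmpHat u k) ξ - dHat b (cmpHat u l) ξ)) 2 volume := fun a b k l ↦ by
    simp only [mul_sub]
    exact (memLp_wt_dHat a (hu k)).sub (memLp_wt_dHat b (hu l))
  fin_cases j
  · exact key 1 2 2 1
  · exact key 2 0 0 2
  · exact key 0 1 1 0

theorem weightedPair_vortHat (hu : HHalf u) (i j : Fin 3) :
    WeightedPair (vortHat u j) (cmpHat u i) := ⟨memLp_wt_vortHat hu j, hu i⟩

theorem IsDivFree.sum_dHat (hu : IsDivFree u) :
    (fun ξ ↦ ∑ i, dHat i (cmpHat u i) ξ) =ᵐ[volume] 0 := by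
  have hloc : ∀ i, LocallyIntegrable (dHat i (cmpHat u i)) volume := fun i ↦ by
    have h2 : Continuous fun ξ : E3 ↦ (2 * Real.pi * Complex.I * (inner ℝ ξ (stdVec i) : ℝ) : ℂ) := by
      fun_prop
    have := (memLp_cmpHat u i).locInt
    rw [← locallyIntegrableOn_univ] at this ⊢
    exact LocallyIntegrableOn.continuousOn_mul this h2.continuousOn isOpen_univ.isLocallyClosed
  refine ae_eq_of_forall_schwartz ?_ (locallyIntegrable_const 0) fun ψ ↦ ?_
  · simp only [Fin.sum_univ_three]
    exact ((hloc 0).add (hloc 1)).add (hloc 2)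
  · have h1 : (𝓕 (∑ i, ∂_{stdVec i} (comp u i))) ψ = 0 := by
      rw [hu, TemperedDistribution.fourier_apply]; rfl
    have h2 : (𝓕 (∑ i, ∂_{stdVec i} (comp u i))) ψ = ∑ i, (𝓕 (∂_{stdVec i} (comp u i))) ψ := by
      simp only [TemperedDistribution.fourier_apply, Fin.sum_univ_three]
      rfl
    have h3 : ∀ i, (𝓕 (∂_{stdVec i} (comp u i))) ψ = ∫ ξ, ψ ξ * dHat i (cmpHat u i) ξ := fun i ↦
      (hasFourier_comp u i).lineDeriv (stdVec i) ψ
    rw [h2] at h1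
    simp only [h3] at h1
    rw [← integral_finsetSum _ fun i _ ↦ integrable_schwartz_mul_dHat ψ i (memLp_cmpHat u i)] at h1
    simp only [Finset.mul_sum]
    rw [h1]
    simp

end

/-! ### The truncated flux on the Fourier side -/

theorem exists_fourier_lowKernel (χ : Cutoff) (Q : ℕ) (x : E3) : ∃ κ : 𝓢(E3, ℂ),
    χ.lowKernel Q x = 𝓕 κ ∧
      ∀ ξ, κ ξ = (Real.fourierChar (inner ℝ ξ x) : ℂ) * χ.lowSchwartz Q ξ := by
  obtain ⟨κ, h1, h2⟩ := exists_modulation (χ.lowSchwartz Q) x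
  refine ⟨κ, ?_, h1⟩
  ext y
  rw [h2, χ.lowKernel_apply]

theorem low_eq (χ : Cutoff) (Q : ℕ) {T : 𝓢'(E3, ℂ)} {h : E3 → ℂ} (hT : HasFourier T h) :
    χ.low Q (fun ψ ↦ T ψ) = 𝓕⁻ (fun ξ ↦ χ.lowSchwartz Q ξ * h ξ) := by
  ext x
  obtain ⟨κ, h1, h2⟩ := exists_fourier_lowKernel χ Q x
  rw [Cutoff.low, h1, ← TemperedDistribution.fourier_apply, hT, fourierInv_eq_exp]
  simp only [h2, mul_assoc]

section

variable {u : Lp E3 2 (volume : Measure E3)}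

theorem low_comp (χ : Cutoff) (Q : ℕ) (i : Fin 3) :
    χ.low Q (fun ψ ↦ comp u i ψ) = conv (𝓕⁻ (χ.lowSchwartz Q) : 𝓢(E3, ℂ)) (cmp u i) := by
  rw [low_eq χ Q (hasFourier_comp u i), conv_eq_fourierInv' _ (memLp_cmp u i)]
  rfl

/-- The curl of `σ(D) u`. -/
def curlConv (σ : 𝓢(E3, ℂ)) (u : Lp E3 2 (volume : Measure E3)) : Fin 3 → E3 → ℂ :=
  ![conv (𝓕⁻ (dS (stdVec 1) σ) : 𝓢(E3, ℂ)) (cmp u 2) - conv (𝓕⁻ (dS (stdVec 2) σ) : 𝓢(E3, ℂ)) (cmp u 1),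
    conv (𝓕⁻ (dS (stdVec 2) σ) : 𝓢(E3, ℂ)) (cmp u 0) - conv (𝓕⁻ (dS (stdVec 0) σ) : 𝓢(E3, ℂ)) (cmp u 2),
    conv (𝓕⁻ (dS (stdVec 0) σ) : 𝓢(E3, ℂ)) (cmp u 1) - conv (𝓕⁻ (dS (stdVec 1) σ) : 𝓢(E3, ℂ)) (cmp u 0)]

theorem fourierInv_schwartz_mul_vortHat (σ : 𝓢(E3, ℂ)) (j : Fin 3) :
    𝓕⁻ (fun ξ ↦ σ ξ * vortHat u j ξ) = curlConv σ u j := by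
  have key : ∀ a b k l : Fin 3, 𝓕⁻ (fun ξ ↦ σ ξ *
      (dHat a (cmpHat u k) ξ - dHat b (cmpHat u l) ξ)) =
      conv (𝓕⁻ (dS (stdVec a) σ) : 𝓢(E3, ℂ)) (cmp u k) -
        conv (𝓕⁻ (dS (stdVec b) σ) : 𝓢(E3, ℂ)) (cmp u l) := by
    intro a b k l
    ext x
    rw [Pi.sub_apply, conv_eq_fourierInv _ (memLp_cmp u k), conv_eq_fourierInv _ (memLp_cmp u l),
      Real.fourierInv_eq, Real.fourierInv_eq, Real.fourierInv_eq, ← integral_sub]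
    · refine integral_congr_ae (Eventually.of_forall fun ξ ↦ ?_)
      simp only [← smul_sub, dS_apply, dHat, cmpHat]
      congr 1
      ring
    · simpa using! (Real.fourierIntegral_convergent_iff (-x)).2
        (integrable_schwartz_mul (dS (stdVec a) σ) (memLp_hat (cmp u k)))
    · simpa using! (Real.fourierIntegral_convergent_iff (-x)).2
        (integrable_schwartz_mul (dS (stdVec b) σ) (memLp_hat (cmp u l)))
  fin_cases j
  · exact key 1 2 2 1
  · exact key 2 0 0 2
  · exact key 0 1 1 0

theorem low_vorticity (χ : Cutoff) (Q : ℕ) (j : Fin 3) :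
    χ.low Q (fun ψ ↦ vorticity u j ψ) = curlConv (χ.lowSchwartz Q) u j := by
  rw [low_eq χ Q (hasFourier_vorticity u j), fourierInv_schwartz_mul_vortHat]

theorem dS_comm (v w : E3) (σ : 𝓢(E3, ℂ)) : dS v (dS w σ) = dS w (dS v σ) := by
  ext ξ
  simp only [dS_apply]; ring

theorem fderiv_curlConv (σ : 𝓢(E3, ℂ)) (j : Fin 3) (x v : E3) :
    fderiv ℝ (curlConv σ u j) x v = curlConv (dS v σ) u j x := by
  have key : ∀ a b k l : Fin 3, fderiv ℝ (conv (𝓕⁻ (dS (stdVec a) σ) : 𝓢(E3, ℂ)) (cmp u k) -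
        conv (𝓕⁻ (dS (stdVec b) σ) : 𝓢(E3, ℂ)) (cmp u l)) x v =
      (conv (𝓕⁻ (dS (stdVec a) (dS v σ)) : 𝓢(E3, ℂ)) (cmp u k) -
        conv (𝓕⁻ (dS (stdVec b) (dS v σ)) : 𝓢(E3, ℂ)) (cmp u l)) x := by
    intro a b k l
    rw [fderiv_sub (differentiable_conv _ (memLp_cmp u k) x)
      (differentiable_conv _ (memLp_cmp u l) x), sub_apply,
      fderiv_conv _ (memLp_cmp u k), fderiv_conv _ (memLp_cmp u l), Pi.sub_apply, dS_comm v,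
      dS_comm v]
  fin_cases j
  · exact key 1 2 2 1
  · exact key 2 0 0 2
  · exact key 0 1 1 0

theorem memLp_schwartz_mul_vortHat (σ : 𝓢(E3, ℂ)) (j : Fin 3) :
    MemLp (fun ξ ↦ σ ξ * vortHat u j ξ) 2 volume := by
  have key : ∀ a b k l : Fin 3, MemLp (fun ξ ↦ σ ξ *
      (dHat a (cmpHat u k) ξ - dHat b (cmpHat u l) ξ)) 2 volume := by
    intro a b k l
    have := (memLp_schwartz_mul (dS (stdVec a) σ) (memLp_cmpHat u k)).sub
      (memLp_schwartz_mul (dS (stdVec b) σ) (memLp_cmpHat u l))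
    refine this.ae_eq (Eventually.of_forall fun ξ ↦ ?_)
    simp only [Pi.sub_apply, dS_apply, dHat]; ring
  fin_cases j
  · exact key 1 2 2 1
  · exact key 2 0 0 2
  · exact key 0 1 1 0

theorem integrable_schwartz_mul_vortHat (σ : 𝓢(E3, ℂ)) (j : Fin 3) :
    Integrable (fun ξ ↦ σ ξ * vortHat u j ξ) volume := by
  have key : ∀ a b k l : Fin 3, Integrable (fun ξ ↦ σ ξ *
      (dHat a (cmpHat u k) ξ - dHat b (cmpHat u l) ξ)) volume := by
    intro a b k l
    have := (integrable_schwartz_mul (dS (stdVec a) σ) (memLp_cmpHat u k)).sub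
      (integrable_schwartz_mul (dS (stdVec b) σ) (memLp_cmpHat u l))
    refine this.congr (Eventually.of_forall fun ξ ↦ ?_)
    simp only [Pi.sub_apply, dS_apply, dHat]; ring
  fin_cases j
  · exact key 1 2 2 1
  · exact key 2 0 0 2
  · exact key 0 1 1 0

theorem memLp_curlConv (σ : 𝓢(E3, ℂ)) (j : Fin 3) : MemLp (curlConv σ u j) 2 volume := by
  rw [← fourierInv_schwartz_mul_vortHat]
  exact memLp_fourierInv (memLp_schwartz_mul_vortHat σ j) (integrable_schwartz_mul_vortHat σ j)

theorem hat_curlConv (σ : 𝓢(E3, ℂ)) (j : Fin 3) :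
    hat (curlConv σ u j) =ᵐ[volume] fun ξ ↦ σ ξ * vortHat u j ξ := by
  rw [← fourierInv_schwartz_mul_vortHat]
  exact hat_fourierInv (memLp_schwartz_mul_vortHat σ j) (integrable_schwartz_mul_vortHat σ j)

theorem low_tensorVel (hu : HHalf u) (χ : Cutoff) (Q : ℕ) (i j : Fin 3) :
    χ.low Q (tensorVel u i j) =
      𝓕⁻ (fun ζ ↦ χ.lowSchwartz Q ζ * star (cmpHat u j) (cmpHat u i) ζ) := by
  ext x
  have H := weightedPair_self (memLp_cmpHat u j) (hu i)
  rw [Cutoff.low]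
  refine Eq.trans ?_ (integral_mul_hat_kernel (χ.lowSchwartz Q) (memLp_cmp u i) H x
    (χ.lowKernel_apply Q x))
  rw [cmpHat, ← integral_mul_eq_hat (memLp_cmp u j)
    (memLp_schwartz_mul _ (memLp_cmp u i)), tensorVel]
  refine integral_congr_ae (Eventually.of_forall fun y ↦ ?_)
  simp only [cmp]
  push_cast
  ring

/-- The product k_Q(x - ·) u_i stays in H^{1/2}, so the duality pairing defining u_i ω_j is not the
default value and may be computed as an integral over frequencies. -/
theorem low_tensorVort (hu : HHalf u) (χ : Cutoff) (Q : ℕ) (i j : Fin 3) :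
    χ.low Q (tensorVort u i j) =
      𝓕⁻ (fun ζ ↦ χ.lowSchwartz Q ζ * star (vortHat u j) (cmpHat u i) ζ) := by
  ext x
  refine Eq.trans ?_ (integral_mul_hat_kernel (χ.lowSchwartz Q) (memLp_cmp u i)
    (weightedPair_vortHat hu i j) x (χ.lowKernel_apply Q x))
  rw [Cutoff.low, tensorVort, comp_eq,
    smulLeftCLM_coe]
  set k := χ.lowKernel Q x
  have hae : (fun y ↦ k y * ((memLp_cmp u i).toLp _ : Lp ℂ 2 (volume : Measure E3)) y)
      =ᵐ[volume] fun y ↦ k y * cmp u i y := by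
    filter_upwards [(memLp_cmp u i).coeFn_toLp] with y hy
    rw [hy]
  have hk := memLp_schwartz_mul k (memLp_cmp u i)
  have hS := hasFourier_coe ((memLp_schwartz_mul k (Lp.memLp ((memLp_cmp u i).toLp _))).toLp _)
  rw [hat_congr (Lp.memLp _) (MemLp.coeFn_toLp _),
    hat_congr (memLp_schwartz_mul k (Lp.memLp _)) hae] at hS
  have hw := wt_conv_memLp (𝓕 k) (hu i)
  have hw' : MemLp (fun ξ ↦ wt (1 / 4) ξ * hat (fun y ↦ k y * cmp u i y) ξ) 2 volume := by
    refine hw.ae_eq ?_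
    filter_upwards [hat_schwartz_mul k (memLp_cmp u i)] with ξ hξ
    rw [hξ]; rfl
  rw [sobolevPairing_eq (hasFourier_vorticity u j) hS
    (locallyIntegrable_of_wt (memLp_wt_vortHat hu j)) (memLp_hat _).locInt ?_ ?_]
  · rw [show (-(1 / 2) / 2 : ℝ) = -(1 / 4) by norm_num]
    exact memLp_wt_vortHat hu j
  · rw [show (1 / 2 / 2 : ℝ) = 1 / 4 by norm_num]
    exact hw'

end

/-! ### The two halves of the flux agree -/

theorem star_comm (h g : E3 → ℂ) (ζ : E3) : star h g ζ = star g h ζ := by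
  rw [star, ← integral_sub_left_eq_self _ volume ζ, star]
  simp only [sub_sub_cancel]
  refine integral_congr_ae (Eventually.of_forall fun η ↦ mul_comm _ _)

/-- The Leibniz rule on the Fourier side: it is the splitting ζ = (ζ - η) + η. -/
theorem star_dHat_add (a : Fin 3) {h g : E3 → ℂ} (H₁ : WeightedPair (dHat a h) g)
    (H₂ : WeightedPair (dHat a g) h) (ζ : E3) :
    star (dHat a h) g ζ + star (dHat a g) h ζ =
      2 * Real.pi * Complex.I * (inner ℝ ζ (stdVec a) : ℝ) * star h g ζ := by
  have h2 := (H₂.integrable_star ζ).comp_sub_left ζ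
  rw [star, star, ← integral_sub_left_eq_self (fun η ↦ dHat a g (ζ - η) * h η) volume ζ,
    ← integral_add (H₁.integrable_star ζ) h2, star, ← integral_const_mul]
  refine integral_congr_ae (Eventually.of_forall fun η ↦ ?_)
  simp only [sub_sub_cancel, dHat, inner_sub_left]
  push_cast
  ring

theorem star_sub_left {h₁ h₂ g : E3 → ℂ} (H₁ : WeightedPair h₁ g) (H₂ : WeightedPair h₂ g)
    (ζ : E3) : star (fun ξ ↦ h₁ ξ - h₂ ξ) g ζ = star h₁ g ζ - star h₂ g ζ := by
  rw [star, star, star, ← integral_sub (H₁.integrable_star ζ) (H₂.integrable_star ζ)]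
  simp only [sub_mul]

section

variable {u : Lp E3 2 (volume : Measure E3)}

/-- The transform of u_l div u. Since div u = 0 is known for almost every frequency only, the
conclusion at every ζ uses that the reflected translate of a null set is null. -/
theorem sum_star_dHat (hu : HHalf u) (hd : IsDivFree u) (l : Fin 3) (ζ : E3) :
    ∑ a, star (dHat a (cmpHat u a)) (cmpHat u l) ζ = 0 := by
  simp only [star]
  rw [← integral_finsetSum _ fun a _ ↦ (weightedPair_dHat a (hu a) (hu l)).integrable_star ζ]
  rw [← integral_zero E3 ℂ (μ := volume)]
  refine integral_congr_ae ?_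
  have := (Measure.measurePreserving_sub_left volume ζ).quasiMeasurePreserving.ae hd.sum_dHat
  filter_upwards [this] with η hη
  rw [← Finset.sum_mul, hη]
  simp

/-- The algebraic identity behind the equality of the two halves of the flux, one component. -/
theorem flux_algebra_component {c : ℂ} {Z : Fin 3 → ℂ} {N : Fin 3 → Fin 3 → ℂ}
    {E : Fin 3 → Fin 3 → Fin 3 → ℂ} (hN : ∀ k l, N k l = N l k)
    (h₁ : ∀ a k l, E a k l + E a l k = c * Z a * N k l) (p q r : Fin 3)
    (h₂ : ∀ l, E p p l + E q q l + E r r l = 0) :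
    Z p * (c * (Z q * N p r - Z r * N p q)) + Z q * (c * (Z q * N q r - Z r * N q q)) +
        Z r * (c * (Z q * N r r - Z r * N r q)) =
      Z p * (E q r p - E r q p) + Z q * (E q r q - E r q q) + Z r * (E q r r - E r q r) -
        (Z p * (E q r p - E r q p) + Z q * (E r p p - E p r p) + Z r * (E p q p - E q p p)) := by
  -- The coefficients 1/2 go with the cases k = l of the Leibniz rule, that is with the gradient of
  -- |u|²/2, which the curl removes.
  linear_combination (-Z p) * h₁ q r p - Z q * h₁ q r q - Z r * h₁ q r r +
    Z p * h₁ r q p + Z q * h₁ r q q + Z r * h₁ r q r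
    + Z p * h₁ q p r - Z p * h₁ r p q + Z q * h₂ r - Z q * h₁ p p r - 1 / 2 * Z q * h₁ r r r
    - 1 / 2 * Z q * h₁ r q q + 1 / 2 * Z q * h₁ r p p - Z r * h₂ q + Z r * h₁ p p q
    + 1 / 2 * Z r * h₁ q q q + 1 / 2 * Z r * h₁ q r r - 1 / 2 * Z r * h₁ q p p
    + c * Z p * Z q * hN p r - c * Z p * Z r * hN p q + c * Z q * Z q * hN q r
    - c * Z r * Z r * hN r q

/-- Here N and E stand for the transforms of u_k u_l and (∂_a u_k) u_l, b and w for those of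
velocity and vorticity at -ζ. The coefficient of each b_p is the p-th component of curl div(u ⊗ u) =
div(u ⊗ ω - ω ⊗ u), and the minus signs in `w` come from the reflection. -/
theorem flux_algebra {c : ℂ} {Z : Fin 3 → ℂ} {N : Fin 3 → Fin 3 → ℂ}
    {E : Fin 3 → Fin 3 → Fin 3 → ℂ} (hN : ∀ k l, N k l = N l k)
    (h₁ : ∀ a k l, E a k l + E a l k = c * Z a * N k l) (h₂ : ∀ l, ∑ a, E a a l = 0)
    (b w : Fin 3 → ℂ) (W : Fin 3 → Fin 3 → ℂ)
    (hw0 : w 0 = -(c * (Z 1 * b 2 - Z 2 * b 1))) (hw1 : w 1 = -(c * (Z 2 * b 0 - Z 0 * b 2)))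
    (hw2 : w 2 = -(c * (Z 0 * b 1 - Z 1 * b 0)))
    (hW0 : ∀ i, W 0 i = E 1 2 i - E 2 1 i) (hW1 : ∀ i, W 1 i = E 2 0 i - E 0 2 i)
    (hW2 : ∀ i, W 2 i = E 0 1 i - E 1 0 i) :
    ∑ i, ∑ j, N j i * (Z i * w j) = ∑ i, ∑ j, (W j i - W i j) * (Z i * b j) := by
  simp only [Fin.sum_univ_three] at h₂
  have e0 := flux_algebra_component hN h₁ 0 1 2 h₂
  have e1 := flux_algebra_component hN h₁ 1 2 0 fun l ↦ by rw [← h₂ l]; ring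
  have e2 := flux_algebra_component hN h₁ 2 0 1 fun l ↦ by rw [← h₂ l]; ring
  simp only [Fin.sum_univ_three, hw0, hw1, hw2, hW0, hW1, hW2]
  rw [hN 1 0, hN 2 0, hN 2 1] at *
  linear_combination b 0 * e0 + b 1 * e1 + b 2 * e2

theorem vortHat_neg_zero (ζ : E3) : vortHat u 0 (-ζ) = -(2 * Real.pi * Complex.I *
    ((inner ℝ ζ (stdVec 1) : ℝ) * cmpHat u 2 (-ζ) - (inner ℝ ζ (stdVec 2) : ℝ) * cmpHat u 1 (-ζ))) := by
  simp only [vortHat, dHat, inner_neg_left, Matrix.cons_val]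
  push_cast; ring

theorem vortHat_neg_one (ζ : E3) : vortHat u 1 (-ζ) = -(2 * Real.pi * Complex.I *
    ((inner ℝ ζ (stdVec 2) : ℝ) * cmpHat u 0 (-ζ) - (inner ℝ ζ (stdVec 0) : ℝ) * cmpHat u 2 (-ζ))) := by
  simp only [vortHat, dHat, inner_neg_left, Matrix.cons_val]
  push_cast; ring

theorem vortHat_neg_two (ζ : E3) : vortHat u 2 (-ζ) = -(2 * Real.pi * Complex.I *
    ((inner ℝ ζ (stdVec 0) : ℝ) * cmpHat u 1 (-ζ) - (inner ℝ ζ (stdVec 1) : ℝ) * cmpHat u 0 (-ζ))) := by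
  simp only [vortHat, dHat, inner_neg_left, Matrix.cons_val]
  push_cast; ring

theorem sum_star_vortHat (hu : HHalf u) (hd : IsDivFree u) (ζ : E3) :
    ∑ i, ∑ j, star (cmpHat u j) (cmpHat u i) ζ *
        ((inner ℝ ζ (stdVec i) : ℝ) * vortHat u j (-ζ)) =
      ∑ i, ∑ j, (star (vortHat u j) (cmpHat u i) ζ - star (vortHat u i) (cmpHat u j) ζ) *
        ((inner ℝ ζ (stdVec i) : ℝ) * cmpHat u j (-ζ)) := by
  have hp := fun a k l ↦ weightedPair_dHat a (hu k) (hu l)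
  exact flux_algebra (c := 2 * Real.pi * Complex.I) (Z := fun a ↦ ((inner ℝ ζ (stdVec a) : ℝ) : ℂ))
    (N := fun k l ↦ star (cmpHat u k) (cmpHat u l) ζ)
    (E := fun a k l ↦ star (dHat a (cmpHat u k)) (cmpHat u l) ζ)
    (b := fun j ↦ cmpHat u j (-ζ)) (w := fun j ↦ vortHat u j (-ζ))
    (W := fun j i ↦ star (vortHat u j) (cmpHat u i) ζ)
    (fun k l ↦ star_comm _ _ ζ) (fun a k l ↦ star_dHat_add a (hp a k l) (hp a l k) ζ)
    (fun l ↦ sum_star_dHat hu hd l ζ) (vortHat_neg_zero ζ) (vortHat_neg_one ζ) (vortHat_neg_two ζ)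
    (fun i ↦ star_sub_left (hp 1 2 i) (hp 2 1 i) ζ) (fun i ↦ star_sub_left (hp 2 0 i) (hp 0 2 i) ζ)
    (fun i ↦ star_sub_left (hp 0 1 i) (hp 1 0 i) ζ)

/-- Half of the flux density: `∑ S(u_i u_j) ∂_i (S ω)_j`. -/
def velFlux (χ : Cutoff) (Q : ℕ) (u : Lp E3 2 (volume : Measure E3)) (x : E3) : ℂ :=
  ∑ i : Fin 3, ∑ j : Fin 3,
    χ.low Q (tensorVel u i j) x * curlConv (dS (stdVec i) (χ.lowSchwartz Q)) u j x

theorem low_wedgeVort (hu : HHalf u) (χ : Cutoff) (Q : ℕ) (i j : Fin 3) :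
    χ.low Q (wedgeVort u i j) = fun x ↦
      𝓕⁻ (fun ζ ↦ χ.lowSchwartz Q ζ * star (vortHat u j) (cmpHat u i) ζ) x -
      𝓕⁻ (fun ζ ↦ χ.lowSchwartz Q ζ * star (vortHat u i) (cmpHat u j) ζ) x := by
  rw [← low_tensorVort hu χ Q i j, ← low_tensorVort hu χ Q j i]
  rfl

theorem lowSchwartz_neg (χ : Cutoff) (Q : ℕ) (ξ : E3) :
    χ.lowSchwartz Q (-ξ) = χ.lowSchwartz Q ξ := by
  change (χ.lowSymbol Q ((2 * Real.pi) • (-ξ)) : ℂ) = (χ.lowSymbol Q ((2 * Real.pi) • ξ) : ℂ)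
  unfold Cutoff.lowSymbol Cutoff.dilate
  rw [χ.radial _ ((((2 : ℝ) ^ ((Q : ℤ) + 1))⁻¹ • ((2 * Real.pi) • ξ))) (by
    simp only [norm_smul, norm_neg])]

theorem memLp_low_tensorVel (hu : HHalf u) (χ : Cutoff) (Q : ℕ) (i j : Fin 3) :
    MemLp (χ.low Q (tensorVel u i j)) 2 volume ∧
      hat (χ.low Q (tensorVel u i j)) =ᵐ[volume]
        fun ζ ↦ χ.lowSchwartz Q ζ * star (cmpHat u j) (cmpHat u i) ζ := by
  have H := weightedPair_self (memLp_cmpHat u j) (hu i)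
  rw [low_tensorVel hu]
  exact ⟨memLp_fourierInv (H.memLp_schwartz_mul_star _) (H.integrable_schwartz_mul_star _),
    hat_fourierInv (H.memLp_schwartz_mul_star _) (H.integrable_schwartz_mul_star _)⟩

theorem memLp_low_wedgeVort (hu : HHalf u) (χ : Cutoff) (Q : ℕ) (i j : Fin 3) :
    MemLp (χ.low Q (wedgeVort u i j)) 2 volume ∧
      hat (χ.low Q (wedgeVort u i j)) =ᵐ[volume]
        fun ζ ↦ χ.lowSchwartz Q ζ * (star (vortHat u j) (cmpHat u i) ζ -
          star (vortHat u i) (cmpHat u j) ζ) := by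
  have H := weightedPair_vortHat hu i j
  have H' := weightedPair_vortHat hu j i
  have e : (fun ζ ↦ χ.lowSchwartz Q ζ * (star (vortHat u j) (cmpHat u i) ζ -
      star (vortHat u i) (cmpHat u j) ζ)) = (fun ζ ↦ χ.lowSchwartz Q ζ *
      star (vortHat u j) (cmpHat u i) ζ) - fun ζ ↦ χ.lowSchwartz Q ζ *
        star (vortHat u i) (cmpHat u j) ζ := by
    ext ζ; simp only [Pi.sub_apply]; ring
  have hL := (H.memLp_schwartz_mul_star (χ.lowSchwartz Q)).sub
    (H'.memLp_schwartz_mul_star (χ.lowSchwartz Q))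
  have hI := (H.integrable_schwartz_mul_star (χ.lowSchwartz Q)).sub
    (H'.integrable_schwartz_mul_star (χ.lowSchwartz Q))
  have e2 : χ.low Q (wedgeVort u i j) = 𝓕⁻ (fun ζ ↦ χ.lowSchwartz Q ζ *
      (star (vortHat u j) (cmpHat u i) ζ - star (vortHat u i) (cmpHat u j) ζ)) := by
    rw [low_wedgeVort hu, e]
    ext x
    rw [Real.fourierInv_eq, Real.fourierInv_eq, Real.fourierInv_eq, ← integral_sub]
    · simp only [Pi.sub_apply, smul_sub]
    · simpa using! (Real.fourierIntegral_convergent_iff (-x)).2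
        (H.integrable_schwartz_mul_star (χ.lowSchwartz Q))
    · simpa using! (Real.fourierIntegral_convergent_iff (-x)).2
        (H'.integrable_schwartz_mul_star (χ.lowSchwartz Q))
  rw [e2, e]
  exact ⟨memLp_fourierInv hL hI, hat_fourierInv hL hI⟩

theorem integrable_velFlux_term (hu : HHalf u) (χ : Cutoff) (Q : ℕ) (i j : Fin 3) :
    Integrable (fun x ↦ χ.low Q (tensorVel u i j) x *
      curlConv (dS (stdVec i) (χ.lowSchwartz Q)) u j x) volume :=
  integrable_mul_of_L2 (memLp_low_tensorVel hu χ Q i j).1 (memLp_curlConv _ j)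

theorem integrable_wedge_term (hu : HHalf u) (χ : Cutoff) (Q : ℕ) (i j : Fin 3) :
    Integrable (fun x ↦ χ.low Q (wedgeVort u i j) x *
      conv (𝓕⁻ (dS (stdVec i) (χ.lowSchwartz Q)) : 𝓢(E3, ℂ)) (cmp u j) x) volume :=
  integrable_mul_of_L2 (memLp_low_wedgeVort hu χ Q i j).1 (memLp_conv _ (memLp_cmp u j))

theorem fluxDensity_eq (χ : Cutoff) (Q : ℕ) : fluxDensity χ Q u = fun x ↦
    velFlux χ Q u x + ∑ i : Fin 3, ∑ j : Fin 3, χ.low Q (wedgeVort u i j) x *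
      conv (𝓕⁻ (dS (stdVec i) (χ.lowSchwartz Q)) : 𝓢(E3, ℂ)) (cmp u j) x := by
  ext x
  simp only [fluxDensity, velFlux, ← Finset.sum_add_distrib, low_vorticity, low_comp,
    fderiv_curlConv, fderiv_conv _ (memLp_cmp u _)]

theorem integrable_velFlux (hu : HHalf u) (χ : Cutoff) (Q : ℕ) :
    Integrable (velFlux χ Q u) volume :=
  integrable_finsetSum _ fun i _ ↦ integrable_finsetSum _ fun j _ ↦ integrable_velFlux_term hu χ Q i j

theorem integrable_fluxDensity (hu : HHalf u) (χ : Cutoff) (Q : ℕ) :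
    Integrable (fluxDensity χ Q u) volume := by
  rw [fluxDensity_eq]
  exact (integrable_velFlux hu χ Q).add (integrable_finsetSum _ fun i _ ↦
    integrable_finsetSum _ fun j _ ↦ integrable_wedge_term hu χ Q i j)

theorem integrable_hat_mul_hat_neg {f g : E3 → ℂ} :
    Integrable (fun ξ ↦ hat f ξ * hat g (-ξ)) volume :=
  integrable_mul_of_L2 (memLp_hat f) (memLp_comp_neg (memLp_hat g))

theorem integral_sum_mul_eq_hat {f g : Fin 3 → Fin 3 → E3 → ℂ} (hf : ∀ i j, MemLp (f i j) 2 volume)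
    (hg : ∀ i j, MemLp (g i j) 2 volume) :
    ∫ x, ∑ i, ∑ j, f i j x * g i j x = ∫ ξ, ∑ i, ∑ j, hat (f i j) ξ * hat (g i j) (-ξ) := by
  rw [integral_finsetSum _ fun i _ ↦ integrable_finsetSum _ fun j _ ↦
      integrable_mul_of_L2 (hf i j) (hg i j),
    integral_finsetSum _ fun i _ ↦ integrable_finsetSum _ fun j _ ↦ integrable_hat_mul_hat_neg]
  refine Finset.sum_congr rfl fun i _ ↦ ?_
  rw [integral_finsetSum _ fun j _ ↦ integrable_mul_of_L2 (hf i j) (hg i j),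
    integral_finsetSum _ fun j _ ↦ integrable_hat_mul_hat_neg]
  exact Finset.sum_congr rfl fun j _ ↦ integral_mul_eq_hat (hf i j) (hg i j)

/-- Parseval's identity turns both halves into integrals over ζ whose integrands agree by
`sum_star_vortHat`. This replaces an integration by parts, which the distribution u ∧ ω does not
directly permit, and it removes the wedge term from all later estimates. -/
theorem helicityFlux_eq (hu : HHalf u) (hd : IsDivFree u) (χ : Cutoff) (Q : ℕ) :
    helicityFlux χ Q u = 2 * ∫ x, velFlux χ Q u x := by
  rw [helicityFlux, fluxDensity_eq, integral_add (integrable_velFlux hu χ Q)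
    (integrable_finsetSum _ fun i _ ↦ integrable_finsetSum _ fun j _ ↦
      integrable_wedge_term hu χ Q i j), two_mul]
  congr 1
  unfold velFlux
  rw [integral_sum_mul_eq_hat (fun i j ↦ (memLp_low_wedgeVort hu χ Q i j).1)
      (fun i j ↦ memLp_conv _ (memLp_cmp u j)),
    integral_sum_mul_eq_hat (fun i j ↦ (memLp_low_tensorVel hu χ Q i j).1)
      (fun i j ↦ memLp_curlConv _ j)]
  refine integral_congr_ae ?_
  have hneg := (Measure.measurePreserving_neg (volume : Measure E3)).quasiMeasurePreserving
  have A1 := fun i j ↦ (memLp_low_wedgeVort hu χ Q i j).2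
  have A2 := fun i j ↦ (memLp_low_tensorVel hu χ Q i j).2
  have A3 := fun i j ↦ hneg.ae (hat_conv (dS (stdVec i) (χ.lowSchwartz Q)) (memLp_cmp u j))
  have A4 := fun i j ↦ hneg.ae (hat_curlConv (u := u) (dS (stdVec i) (χ.lowSchwartz Q)) j)
  simp only [Filter.EventuallyEq, ← ae_all_iff] at A1 A2 A3 A4
  filter_upwards [A1, A2, A3, A4] with ζ h1 h2 h3 h4
  simp only [h1, h2, h3, h4, dS_apply, lowSchwartz_neg, inner_neg_left]
  -- The common factor consists of one symbol of S_Q from each side and of the derivative symbol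
  -- evaluated at -ζ.
  have := congrArg (fun z ↦ -(2 * Real.pi * Complex.I * χ.lowSchwartz Q ζ * χ.lowSchwartz Q ζ) * z)
    (sum_star_vortHat hu hd ζ)
  simp only [Finset.mul_sum] at this
  push_cast
  refine Eq.trans (Finset.sum_congr rfl fun i _ ↦ Finset.sum_congr rfl fun j _ ↦ ?_)
    (this.symm.trans (Finset.sum_congr rfl fun i _ ↦ Finset.sum_congr rfl fun j _ ↦ ?_))
  · change _ * (_ * cmpHat u j (-ζ)) = _
    ring
  · ring

end

/-! ### Dilated kernels -/

theorem lintegral_comp_smul (f : E3 → ℝ≥0∞) {a : ℝ} (ha : 0 < a) :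
    ∫⁻ x, f (a • x) = ENNReal.ofReal ((a ^ 3)⁻¹) * ∫⁻ x, f x := by
  have h := (Homeomorph.smul (Units.mk0 a ha.ne')).measurableEmbedding.lintegral_map
    (μ := (volume : Measure E3)) f
  have h2 : (fun x : E3 ↦ a • x) = (Homeomorph.smul (Units.mk0 a ha.ne') : E3 → E3) := rfl
  rw [← h2, Measure.map_addHaar_smul _ ha.ne', lintegral_smul_measure] at h
  simp only [finrank_euclideanSpace, Fintype.card_fin, smul_eq_mul] at h
  rw [abs_of_pos (by positivity)] at h
  exact h.symm

theorem enorm_ofReal_pow_three {a : ℝ} (ha : 0 < a) : ‖(a : ℂ)‖ₑ ^ 3 = ENNReal.ofReal (a ^ 3) := by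
  rw [← ofReal_norm, Complex.norm_real, Real.norm_of_nonneg ha.le, ENNReal.ofReal_pow ha.le]

/-- The kernel `k` is the `L¹`-normalised dilation of the Schwartz kernel `K`. -/
def IsDilation (a : ℝ) (c : ℂ) (k K : 𝓢(E3, ℂ)) : Prop :=
  ∀ x, k x = c * (a : ℂ) ^ 3 * K (a • x)

theorem IsDilation.lintegral {a : ℝ} (ha : 0 < a) {c : ℂ} {k K : 𝓢(E3, ℂ)}
    (h : IsDilation a c k K) (g : E3 → ℝ≥0∞) :
    ∫⁻ y, ‖k y‖ₑ * g (a • y) = ‖c‖ₑ * ∫⁻ y, ‖K y‖ₑ * g y := by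
  have e : ∀ y, ‖k y‖ₑ * g (a • y) =
      (‖c‖ₑ * ENNReal.ofReal (a ^ 3)) * (fun z ↦ ‖K z‖ₑ * g z) (a • y) := by
    intro y
    rw [h y, enorm_mul, enorm_mul, enorm_pow, enorm_ofReal_pow_three ha, mul_assoc (_ * _)]
  simp only [e]
  rw [lintegral_const_mul' _ _ (ENNReal.mul_ne_top enorm_ne_top ENNReal.ofReal_ne_top),
    lintegral_comp_smul (fun z ↦ ‖K z‖ₑ * g z) ha,
    mul_assoc, ← mul_assoc (ENNReal.ofReal _) (ENNReal.ofReal _), ← ENNReal.ofReal_mul (by positivity),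
    mul_inv_cancel₀ (by positivity), ENNReal.ofReal_one, one_mul]

theorem isDilation_fourierInv {a : ℝ} (ha : 0 < a) {c : ℂ} {σ τ : 𝓢(E3, ℂ)}
    (h : ∀ ξ, σ ξ = c * τ (a⁻¹ • ξ)) :
    IsDilation a c (𝓕⁻ σ : 𝓢(E3, ℂ)) (𝓕⁻ τ : 𝓢(E3, ℂ)) := by
  intro x
  rw [SchwartzMap.fourierInv_coe, SchwartzMap.fourierInv_coe, fourierInv_eq_exp, fourierInv_eq_exp]
  have h2 := Measure.integral_comp_inv_smul (volume : Measure E3)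
    (fun ξ ↦ (Real.fourierChar (inner ℝ ξ (a • x)) : ℂ) * τ ξ) a
  simp only [finrank_euclideanSpace, Fintype.card_fin] at h2
  rw [abs_of_pos (by positivity)] at h2
  rw [mul_assoc, ← Complex.ofReal_pow, ← Complex.real_smul, ← h2, ← integral_const_mul]
  refine integral_congr_ae (Eventually.of_forall fun ξ ↦ ?_)
  have e : inner ℝ (a⁻¹ • ξ) (a • x) = inner ℝ ξ x := by
    rw [inner_smul_left, inner_smul_right]
    simp [← mul_assoc, inv_mul_cancel₀ ha.ne']
  simp only [h, e]
  ring

/-- The weighted `L¹` norm of a kernel. -/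
def kmom (K : 𝓢(E3, ℂ)) : ℝ≥0∞ := ∫⁻ y, ‖K y‖ₑ * ENNReal.ofReal ((1 + ‖y‖) ^ 2)

theorem kmom_lt_top (K : 𝓢(E3, ℂ)) : kmom K < ⊤ := by
  have h1 : Integrable (fun y ↦ 2 * (‖y‖ ^ 0 * ‖K y‖) + 2 * (‖y‖ ^ 2 * ‖K y‖)) volume :=
    ((K.integrable_pow_mul volume 0).const_mul 2).add ((K.integrable_pow_mul volume 2).const_mul 2)
  refine lt_of_le_of_lt (lintegral_mono fun y ↦ ?_) h1.lintegral_lt_top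
  rw [← ofReal_norm, ← ENNReal.ofReal_mul (norm_nonneg _)]
  refine ENNReal.ofReal_le_ofReal ?_
  nlinarith [mul_nonneg (norm_nonneg (K y)) (sq_nonneg (‖y‖ - 1))]

theorem IsDilation.kmom_le {a : ℝ} (ha : 0 < a) {c : ℂ} {k K : 𝓢(E3, ℂ)}
    (h : IsDilation a c k K) :
    ∫⁻ y, ‖k y‖ₑ * ENNReal.ofReal ((1 + a * ‖y‖) ^ 2) = ‖c‖ₑ * kmom K := by
  rw [kmom, ← h.lintegral ha]
  simp only [norm_smul, Real.norm_of_nonneg ha.le]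

/-- The fundamental theorem of calculus along the segment from y - z to y, followed by Tonelli and
translation invariance. -/
theorem lintegral_enorm_sub_translate_le (K : 𝓢(E3, ℂ)) (z : E3) :
    ∫⁻ y, ‖K y - K (y - z)‖ₑ ≤ ‖z‖ₑ * ∫⁻ y, ‖fderiv ℝ K y‖ₑ := by
  have hK : Continuous fun y ↦ fderiv ℝ K y := K.smooth'.continuous_fderiv (by simp)
  have h1 : ∀ y, ‖K y - K (y - z)‖ₑ ≤
      ∫⁻ t in Ioc (0 : ℝ) 1, ‖fderiv ℝ K (y - z + t • z)‖ₑ * ‖z‖ₑ := by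
    intro y
    have hd : ∀ t ∈ uIcc (0 : ℝ) 1, HasDerivAt (fun t : ℝ ↦ K (y - z + t • z))
        (fderiv ℝ K (y - z + t • z) z) t := by
      intro t _
      have h := K.differentiable.differentiableAt (x := y - z + t • z) |>.hasFDerivAt
      have h2 : HasDerivAt (fun t : ℝ ↦ y - z + t • z) z t := by
        simpa using ((hasDerivAt_id t).smul_const z).const_add (y - z)
      exact h.comp_hasDerivAt t h2
    have hc : Continuous fun t : ℝ ↦ fderiv ℝ K (y - z + t • z) z :=
      (hK.comp (by fun_prop)).clm_apply continuous_const
    have := intervalIntegral.integral_eq_sub_of_hasDerivAt hd (hc.intervalIntegrable 0 1)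
    simp only [one_smul, sub_add_cancel, zero_smul, add_zero] at this
    rw [← this, intervalIntegral.integral_of_le zero_le_one]
    refine (enorm_integral_le_lintegral_enorm _).trans (lintegral_mono fun t ↦ ?_)
    exact ContinuousLinearMap.le_opENorm _ _
  calc _ ≤ ∫⁻ y, ∫⁻ t in Ioc (0 : ℝ) 1, ‖fderiv ℝ K (y - z + t • z)‖ₑ * ‖z‖ₑ := lintegral_mono h1
    _ = ∫⁻ t in Ioc (0 : ℝ) 1, ∫⁻ y, ‖fderiv ℝ K (y - z + t • z)‖ₑ * ‖z‖ₑ := by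
        refine lintegral_lintegral_swap ?_
        have : Continuous fun p : E3 × ℝ ↦ ‖fderiv ℝ K (p.1 - z + p.2 • z)‖ₑ :=
          (hK.comp (by fun_prop)).enorm
        exact (this.measurable.mul_const _).aemeasurable
    _ = ∫⁻ t in Ioc (0 : ℝ) 1, ‖z‖ₑ * ∫⁻ y, ‖fderiv ℝ K y‖ₑ := by
        congr 1; ext t
        rw [lintegral_mul_const' _ _ enorm_ne_top, mul_comm]
        congr 1
        have := lintegral_add_right_eq_self (μ := (volume : Measure E3))
          (fun y ↦ ‖fderiv ℝ K y‖ₑ) (-z + t • z)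
        rw [← this]
        simp only [sub_eq_add_neg, add_assoc]
    _ = _ := by simp

theorem lintegral_fderiv_lt_top (K : 𝓢(E3, ℂ)) : ∫⁻ y, ‖fderiv ℝ K y‖ₑ < ⊤ := by
  have := (fderivCLM ℝ E3 ℂ K).integrable (μ := volume)
  exact this.2

theorem IsDilation.lintegral_translate_le {a : ℝ} (ha : 0 < a) {c : ℂ} {k K : 𝓢(E3, ℂ)}
    (h : IsDilation a c k K) (z : E3) :
    ∫⁻ y, ‖k y - k (y - z)‖ₑ ≤
      ‖c‖ₑ * (ENNReal.ofReal (a * ‖z‖) * ∫⁻ y, ‖fderiv ℝ K y‖ₑ) := by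
  have e : ∀ y, ‖k y - k (y - z)‖ₑ = (‖c‖ₑ * ENNReal.ofReal (a ^ 3)) *
      (fun w ↦ ‖K w - K (w - a • z)‖ₑ) (a • y) := by
    intro y
    simp only
    rw [h y, h (y - z), ← mul_sub, smul_sub, enorm_mul, enorm_mul, enorm_pow,
      enorm_ofReal_pow_three ha]
  simp only [e]
  rw [lintegral_const_mul' _ _ (ENNReal.mul_ne_top enorm_ne_top ENNReal.ofReal_ne_top),
    lintegral_comp_smul (fun w ↦ ‖K w - K (w - a • z)‖ₑ) ha,
    mul_assoc, ← mul_assoc (ENNReal.ofReal _) (ENNReal.ofReal _), ← ENNReal.ofReal_mul (by positivity),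
    mul_inv_cancel₀ (by positivity), ENNReal.ofReal_one, one_mul]
  gcongr
  refine (lintegral_enorm_sub_translate_le K (a • z)).trans_eq ?_
  rw [← ofReal_norm (a • z), norm_smul, Real.norm_of_nonneg ha.le]

/-! ### Littlewood-Paley symbols -/

theorem Cutoff.eq_zero (χ : Cutoff) {ξ : E3} (h : 1 ≤ ‖ξ‖) : χ.toFun ξ = 0 := by
  by_contra hne
  have := χ.tsupport_subset (subset_tsupport _ (Function.mem_support.2 hne))
  rw [mem_ball_zero_iff] at this
  linarith

theorem Cutoff.dilate_eq_one (χ : Cutoff) {j : ℤ} {ξ : E3} (h : ‖ξ‖ ≤ 2 ^ j / 2) :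
    χ.dilate j ξ = 1 := by
  refine χ.eq_one _ ?_
  rw [norm_smul, norm_inv, Real.norm_of_nonneg (by positivity), inv_mul_le_iff₀ (by positivity)]
  linarith

theorem Cutoff.dilate_eq_zero (χ : Cutoff) {j : ℤ} {ξ : E3} (h : 2 ^ j ≤ ‖ξ‖) :
    χ.dilate j ξ = 0 := by
  refine χ.eq_zero ?_
  rw [norm_smul, norm_inv, Real.norm_of_nonneg (by positivity), le_inv_mul_iff₀ (by positivity)]
  linarith

/-- The Schwartz function `ξ ↦ χ(2^{-j} 2πξ)`. -/
def Cutoff.sym (χ : Cutoff) (j : ℤ) : 𝓢(E3, ℂ) :=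
  HasCompactSupport.toSchwartzMap
    (f := fun ξ : E3 ↦ (χ.dilate j ((2 * Real.pi) • ξ) : ℂ))
    (by
      have h : HasCompactSupport (fun ξ : E3 ↦ χ.dilate j ((2 * Real.pi) • ξ)) := by
        unfold dilate
        have := χ.hasCompactSupport.comp_smul
          (c := ((2 : ℝ) ^ j)⁻¹ * (2 * Real.pi)) (by positivity)
        simpa only [smul_smul] using this
      exact h.comp_left (g := fun r : ℝ ↦ (r : ℂ)) Complex.ofReal_zero)
    (by
      have h : ContDiff ℝ ∞ (fun ξ : E3 ↦ χ.dilate j ((2 * Real.pi) • ξ)) := by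
        unfold dilate
        exact χ.smooth.comp ((contDiff_id.const_smul _).const_smul _)
      exact Complex.ofRealCLM.contDiff.comp h)

theorem Cutoff.sym_apply (χ : Cutoff) (j : ℤ) (ξ : E3) :
    χ.sym j ξ = (χ.dilate j ((2 * Real.pi) • ξ) : ℂ) := rfl

theorem Cutoff.lowSchwartz_eq (χ : Cutoff) (Q : ℕ) : χ.lowSchwartz Q = χ.sym (Q + 1) := rfl

theorem Cutoff.sym_neg (χ : Cutoff) (j : ℤ) (ξ : E3) : χ.sym j (-ξ) = χ.sym j ξ := by
  rw [sym_apply, sym_apply, dilate, dilate,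
    χ.radial _ (((2 : ℝ) ^ j)⁻¹ • ((2 * Real.pi) • ξ)) (by simp only [norm_smul, norm_neg])]

theorem Cutoff.sym_zero (χ : Cutoff) (j : ℤ) : χ.sym j 0 = 1 := by
  rw [sym_apply, χ.dilate_eq_one (by simp; positivity)]; simp

theorem Cutoff.sym_scale (χ : Cutoff) (j : ℤ) (ξ : E3) :
    χ.sym j ξ = 1 * χ.sym 0 (((2 : ℝ) ^ j)⁻¹ • ξ) := by
  simp only [sym_apply, dilate, zpow_zero, inv_one, one_smul, one_mul]
  rw [smul_comm]

/-- The convolution kernel of `χ(2^{-j} D)`. -/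
def Cutoff.ker (χ : Cutoff) (j : ℤ) : 𝓢(E3, ℂ) := 𝓕⁻ (χ.sym j)

theorem Cutoff.isDilation_ker (χ : Cutoff) (j : ℤ) :
    IsDilation (2 ^ j) 1 (χ.ker j) (χ.ker 0) :=
  isDilation_fourierInv (by positivity) (χ.sym_scale j)

theorem integral_fourierInv (σ : 𝓢(E3, ℂ)) : ∫ y, (𝓕⁻ σ : 𝓢(E3, ℂ)) y = σ 0 := by
  have h : (𝓕 (𝓕⁻ σ : 𝓢(E3, ℂ))) 0 = σ 0 := by rw [FourierTransform.fourier_fourierInv_eq]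
  rw [← h, SchwartzMap.fourier_coe, Real.fourier_eq]
  simp

theorem Cutoff.integral_ker (χ : Cutoff) (j : ℤ) : ∫ y, χ.ker j y = 1 := by
  rw [ker, integral_fourierInv, sym_zero]

/-- The symbols of the Littlewood-Paley blocks, indexed from `0`. -/
def Cutoff.blk (χ : Cutoff) (k : ℕ) : 𝓢(E3, ℂ) :=
  if k = 0 then χ.sym 0 else χ.sym k - χ.sym (k - 1)

theorem Cutoff.blk_zero (χ : Cutoff) : χ.blk 0 = χ.sym 0 := rfl

theorem Cutoff.blk_succ (χ : Cutoff) (k : ℕ) : χ.blk (k + 1) = χ.sym (k + 1) - χ.sym k := by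
  simp [blk]

theorem Cutoff.sum_blk (χ : Cutoff) (N : ℕ) :
    ∑ k ∈ Finset.range (N + 1), χ.blk k = χ.sym N := by
  induction N with
  | zero => simp [blk_zero]
  | succ n ih => rw [Finset.sum_range_succ, ih, blk_succ]; push_cast; abel

theorem Cutoff.sym_eq_zero (χ : Cutoff) {j : ℤ} {ξ : E3} (h : 2 ^ j ≤ 2 * Real.pi * ‖ξ‖) :
    χ.sym j ξ = 0 := by
  rw [sym_apply, χ.dilate_eq_zero, Complex.ofReal_zero]
  rwa [norm_smul, Real.norm_of_nonneg (by positivity)]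

theorem Cutoff.sym_eq_one (χ : Cutoff) {j : ℤ} {ξ : E3} (h : 2 * Real.pi * ‖ξ‖ ≤ 2 ^ j / 2) :
    χ.sym j ξ = 1 := by
  rw [sym_apply, χ.dilate_eq_one, Complex.ofReal_one]
  rwa [norm_smul, Real.norm_of_nonneg (by positivity)]

/-- The larger cut-off equals 1 wherever the smaller one does not vanish, because χ is 1 on half of
its ball. -/
theorem Cutoff.sym_mul_sym (χ : Cutoff) {i j : ℤ} (h : i < j) (ξ : E3) :
    χ.sym j ξ * χ.sym i ξ = χ.sym i ξ := by
  rcases le_or_gt (2 ^ i) (2 * Real.pi * ‖ξ‖) with h1 | h1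
  · rw [χ.sym_eq_zero h1, mul_zero]
  · rw [χ.sym_eq_one (j := j), one_mul]
    have : (2 : ℝ) ^ (i + 1) ≤ 2 ^ j := zpow_le_zpow_right₀ (by norm_num) h
    rw [zpow_add_one₀ two_ne_zero] at this
    linarith

theorem Cutoff.sym_mul_blk (χ : Cutoff) (k : ℕ) : mulS (χ.sym (k + 1)) (χ.blk k) = χ.blk k := by
  ext ξ
  rw [mulS_apply]
  cases k with
  | zero => exact χ.sym_mul_sym (by simp) ξ
  | succ n =>
    rw [blk_succ, sub_apply, mul_sub, χ.sym_mul_sym (by push_cast; omega),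
      χ.sym_mul_sym (by push_cast; omega)]

/-- Both cut-offs composing the block equal 1 on the support of the smaller cut-off, so they cancel
there. Together with `sym_mul_blk` this localizes a block from both sides. -/
theorem Cutoff.sym_mul_blk_eq_zero (χ : Cutoff) (k : ℕ) :
    mulS (χ.sym (k - 1)) (χ.blk (k + 1)) = 0 := by
  ext ξ
  rw [mulS_apply, blk_succ, sub_apply, mul_sub, mul_comm, χ.sym_mul_sym (by omega),
    mul_comm, χ.sym_mul_sym (by omega), sub_self, zero_apply]

/-! ### The square function bound in `L³` -/

/-- A Taylor expansion of the cube of the norm. With s = |F + h| and f = |F|, the identity s³ = f³ +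
(3/2) f (s² - f²) + (s - f)² (s + f/2) holds, and s² - f² contains the linear term. -/
theorem norm_add_cube_le (F h : ℂ) : ‖F + h‖ ^ 3 ≤ ‖F‖ ^ 3 +
    3 * ((‖F‖ : ℂ) * (starRingEnd ℂ) F * h).re + 3 * (‖F‖ * ‖h‖ ^ 2) + ‖h‖ ^ 3 := by
  have h1 : ‖F + h‖ ^ 2 = ‖F‖ ^ 2 + 2 * ((starRingEnd ℂ) F * h).re + ‖h‖ ^ 2 := by
    rw [← Complex.normSq_eq_norm_sq, ← Complex.normSq_eq_norm_sq, ← Complex.normSq_eq_norm_sq,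
      Complex.normSq_add, ← Complex.conj_re (F * _)]
    simp; ring
  have h2 : ((‖F‖ : ℂ) * (starRingEnd ℂ) F * h).re = ‖F‖ * ((starRingEnd ℂ) F * h).re := by
    rw [mul_assoc, Complex.re_ofReal_mul]
  rw [h2]
  have h3 : |‖F + h‖ - ‖F‖| ≤ ‖h‖ := by
    have := abs_norm_sub_norm_le (F + h) F
    simpa using this
  have h4 : (‖F + h‖ - ‖F‖) ^ 2 ≤ ‖h‖ ^ 2 := sq_le_sq.2 (by rwa [abs_of_nonneg (norm_nonneg h)])
  have h5 := norm_add_le F h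
  -- The remainder is quadratic in h because |s - f| ≤ |h|.
  have h6 : (‖F + h‖ - ‖F‖) ^ 2 * (‖F + h‖ + ‖F‖ / 2) ≤ ‖h‖ ^ 2 * (‖F‖ + ‖h‖ + ‖F‖ / 2) := by
    gcongr
  have h7 : ((starRingEnd ℂ) F * h).re = (‖F + h‖ ^ 2 - ‖F‖ ^ 2 - ‖h‖ ^ 2) / 2 := by linarith
  rw [h7]
  nlinarith

/-- Bounded square integrable functions. -/
def MemL2Linfty (f : E3 → ℂ) : Prop := MemLp f 2 volume ∧ MemLp f ⊤ volume

theorem MemL2Linfty.memLp_three {f : E3 → ℂ} (hf : MemL2Linfty f) : MemLp f 3 volume :=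
  HelicityFlux.memLp_three hf.1 hf.2

theorem MemL2Linfty.add {f g : E3 → ℂ} (hf : MemL2Linfty f) (hg : MemL2Linfty g) :
    MemL2Linfty (f + g) := ⟨hf.1.add hg.1, hf.2.add hg.2⟩

theorem MemL2Linfty.sum {h : ℕ → E3 → ℂ} (hh : ∀ k, MemL2Linfty (h k)) (n : ℕ) :
    MemL2Linfty (∑ k ∈ Finset.range n, h k) :=
  ⟨memLp_finsetSum' _ fun k _ ↦ (hh k).1, memLp_finsetSum' _ fun k _ ↦ (hh k).2⟩

/-- The `L³` norm as a real number. -/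
def n3 (f : E3 → ℂ) : ℝ := (eLpNorm f 3 volume).toReal

theorem n3_nonneg (f : E3 → ℂ) : 0 ≤ n3 f := ENNReal.toReal_nonneg

theorem ofReal_n3 {f : E3 → ℂ} (hf : MemLp f 3 volume) :
    ENNReal.ofReal (n3 f) = eLpNorm f 3 volume := ENNReal.ofReal_toReal hf.2.ne

theorem integrable_norm_cube {f : E3 → ℂ} (hf : MemLp f 3 volume) :
    Integrable (fun x ↦ ‖f x‖ ^ 3) volume := by
  have := hf.integrable_norm_pow (p := 3) (by norm_num)
  exact_mod_cast this

theorem integral_norm_cube {f : E3 → ℂ} (hf : MemLp f 3 volume) :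
    ∫ x, ‖f x‖ ^ 3 = n3 f ^ 3 := by
  rw [integral_eq_lintegral_of_nonneg_ae (Eventually.of_forall fun x ↦ by positivity)
    (integrable_norm_cube hf).1, n3, ← ENNReal.toReal_pow, eLpNorm_three_pow]
  congr 2; ext x
  rw [ENNReal.ofReal_pow (norm_nonneg _), ofReal_norm]

/-- The increment of a function. -/
def dlt (y : E3) (f : E3 → ℂ) (x : E3) : ℂ := f x - f (x - y)

/-- The dual function `|F| F̄` of an `L³` function. -/
def dual (F : E3 → ℂ) (x : E3) : ℂ := (‖F x‖ : ℂ) * (starRingEnd ℂ) (F x)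

theorem memLp_dual {F : E3 → ℂ} (hF : MemL2Linfty F) : MemLp (dual F) 2 volume := by
  have h1 : MemLp (fun x ↦ (‖F x‖ : ℂ)) ⊤ volume :=
    hF.2.norm.ofReal
  exact MemLp.mul' (p := ⊤) (q := 2) hF.1.star h1

/-- The map z ↦ |z| z̄ is locally Lipschitz, so the increments of `dual F` are controlled by those
of F. -/
theorem enorm_dual_sub_le (a b : ℂ) :
    ‖(‖a‖ : ℂ) * (starRingEnd ℂ) a - (‖b‖ : ℂ) * (starRingEnd ℂ) b‖ₑ ≤ (‖a‖ₑ + ‖b‖ₑ) * ‖a - b‖ₑ := by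
  have h : ‖(‖a‖ : ℂ) * (starRingEnd ℂ) a - (‖b‖ : ℂ) * (starRingEnd ℂ) b‖ ≤
      (‖a‖ + ‖b‖) * ‖a - b‖ := by
    have e : (‖a‖ : ℂ) * (starRingEnd ℂ) a - (‖b‖ : ℂ) * (starRingEnd ℂ) b =
        (‖a‖ : ℂ) * (starRingEnd ℂ) (a - b) + ((‖a‖ - ‖b‖ : ℝ) : ℂ) * (starRingEnd ℂ) b := by
      rw [map_sub]; push_cast; ring
    rw [e]
    refine (norm_add_le _ _).trans ?_
    rw [norm_mul, norm_mul, Complex.norm_real, Complex.norm_real, RCLike.norm_conj, RCLike.norm_conj,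
      norm_norm, Real.norm_eq_abs]
    have := abs_norm_sub_norm_le a b
    nlinarith [norm_nonneg b]
  have := ENNReal.ofReal_le_ofReal h
  rwa [ofReal_norm, ENNReal.ofReal_mul (by positivity), ENNReal.ofReal_add (norm_nonneg _)
    (norm_nonneg _), ofReal_norm, ofReal_norm, ofReal_norm] at this

theorem eLpNorm_comp_sub (f : E3 → ℂ) (hf : AEStronglyMeasurable f volume) (y : E3) :
    eLpNorm (fun x ↦ f (x - y)) 3 volume = eLpNorm f 3 volume :=
  eLpNorm_comp_measurePreserving hf (measurePreserving_sub_right volume y)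

theorem aestronglyMeasurable_dlt {f : E3 → ℂ} (hf : AEStronglyMeasurable f volume) (y : E3) :
    AEStronglyMeasurable (dlt y f) volume :=
  hf.sub (hf.comp_measurePreserving (measurePreserving_sub_right volume y))

theorem sub_conv_eq (χ : Cutoff) (j : ℤ) {g : E3 → ℂ} (hg : MemLp g 2 volume) (x : E3) :
    g x - conv (χ.ker j) g x = ∫ y, χ.ker j y * (g x - g (x - y)) := by
  have h1 : Integrable (fun y ↦ χ.ker j y * g x) volume := (χ.ker j).integrable.mul_const _
  simp only [mul_sub]
  rw [integral_sub h1 (integrable_conv (χ.ker j) hg x), integral_mul_const, χ.integral_ker, one_mul,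
    conv]

/-- Since the low-frequency part of `h` vanishes and the multiplier is symmetric, `dual F` may be
replaced by its difference from its own mollification, an average of increments at scale 2^(-j).
Hölder's inequality with three L³ factors then leaves the increments of F. -/
theorem enorm_integral_dual_mul_le (χ : Cutoff) (j : ℤ) {F h : E3 → ℂ} (hF : MemL2Linfty F)
    (hh : MemL2Linfty h) (h0 : conv (χ.ker j) h = 0) :
    ‖∫ x, dual F x * h x‖ₑ ≤ 2 * eLpNorm F 3 volume * eLpNorm h 3 volume *
      ∫⁻ y, ‖χ.ker j y‖ₑ * eLpNorm (dlt y F) 3 volume := by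
  have hG := memLp_dual hF
  have h1 : ∫ x, conv (χ.ker j) (dual F) x * h x = 0 := by
    rw [Cutoff.ker, integral_conv_mul (χ.sym j) (χ.sym j) hG hh.1 fun ξ ↦ (χ.sym_neg j ξ).symm,
      ← Cutoff.ker, h0]
    simp
  have h2 : ∫ x, dual F x * h x = ∫ x, (dual F x - conv (χ.ker j) (dual F) x) * h x := by
    rw [Cutoff.ker] at h1 ⊢
    simp only [sub_mul]
    rw [integral_sub (integrable_mul_of_L2 hG hh.1)
      (integrable_mul_of_L2 (memLp_conv (χ.sym j) hG) hh.1), h1, sub_zero]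
  have hGm : AEMeasurable (fun z : E3 × E3 ↦ ‖χ.ker j z.2‖ₑ * ‖dual F z.1 - dual F (z.1 - z.2)‖ₑ *
      ‖h z.1‖ₑ) (volume.prod volume) := by
    have m1 : AEMeasurable (fun z : E3 × E3 ↦ ‖χ.ker j z.2‖ₑ) (volume.prod volume) :=
      ((χ.ker j).continuous.comp continuous_snd).enorm.measurable.aemeasurable
    exact (m1.mul (hG.1.comp_fst.sub (aestronglyMeasurable_comp_sub hG.1)).enorm).mul
      hh.1.1.comp_fst.enorm
  calc ‖∫ x, dual F x * h x‖ₑ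
      ≤ ∫⁻ x, ‖(dual F x - conv (χ.ker j) (dual F) x) * h x‖ₑ := by
        rw [h2]; exact enorm_integral_le_lintegral_enorm _
    _ ≤ ∫⁻ x, ∫⁻ y, ‖χ.ker j y‖ₑ * ‖dual F x - dual F (x - y)‖ₑ * ‖h x‖ₑ := by
        refine lintegral_mono fun x ↦ ?_
        rw [enorm_mul, sub_conv_eq χ j hG, lintegral_mul_const' _ _ enorm_ne_top]
        gcongr
        refine (enorm_integral_le_lintegral_enorm _).trans_eq ?_
        simp only [enorm_mul]
    _ = ∫⁻ y, ∫⁻ x, ‖χ.ker j y‖ₑ * ‖dual F x - dual F (x - y)‖ₑ * ‖h x‖ₑ :=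
        lintegral_lintegral_swap hGm
    _ ≤ ∫⁻ y, 2 * eLpNorm F 3 volume * eLpNorm h 3 volume *
          (‖χ.ker j y‖ₑ * eLpNorm (dlt y F) 3 volume) := by
        refine lintegral_mono fun y ↦ ?_
        simp only [mul_assoc ‖χ.ker j y‖ₑ]
        rw [lintegral_const_mul' _ _ enorm_ne_top]
        have hFy : AEStronglyMeasurable (fun x ↦ F (x - y)) volume :=
          hF.1.1.comp_measurePreserving (measurePreserving_sub_right volume y)
        have hd := aestronglyMeasurable_dlt hF.1.1 y
        have e1 := lintegral_enorm_mul_mul_le hF.1.1 hd hh.1.1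
        have e2 := lintegral_enorm_mul_mul_le hFy hd hh.1.1
        rw [eLpNorm_comp_sub F hF.1.1 y] at e2
        calc _ ≤ ‖χ.ker j y‖ₑ * ∫⁻ x, (‖F x‖ₑ * ‖dlt y F x‖ₑ * ‖h x‖ₑ +
              ‖F (x - y)‖ₑ * ‖dlt y F x‖ₑ * ‖h x‖ₑ) := by
              gcongr with x
              rw [← add_mul, ← add_mul]
              gcongr
              exact enorm_dual_sub_le _ _
          _ ≤ ‖χ.ker j y‖ₑ * (eLpNorm F 3 volume * eLpNorm (dlt y F) 3 volume * eLpNorm h 3 volume +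
              eLpNorm F 3 volume * eLpNorm (dlt y F) 3 volume * eLpNorm h 3 volume) := by
              have hm' : AEMeasurable (fun x ↦ ‖F x‖ₑ * ‖dlt y F x‖ₑ * ‖h x‖ₑ) volume :=
                (hF.1.1.enorm.mul hd.enorm).mul hh.1.1.enorm
              rw [lintegral_add_left' hm']
              gcongr
          _ = _ := by ring
    _ = _ := lintegral_const_mul' _ _ (ENNReal.mul_ne_top (ENNReal.mul_ne_top (by norm_num)
        hF.memLp_three.2.ne) 
        hh.memLp_three.2.ne)

/-- Bernstein's inequality: as `h` is reproduced by its mollification, the increment may be taken on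
the kernel instead, where it costs 2^j |y|. -/
theorem eLpNorm_dlt_le (χ : Cutoff) (j : ℤ) {h : E3 → ℂ} (hh : MemLp h 2 volume)
    (h1 : conv (χ.ker j) h = h) (y : E3) :
    eLpNorm (dlt y h) 3 volume ≤ ENNReal.ofReal (2 ^ j * ‖y‖) *
      (∫⁻ y, ‖fderiv ℝ (χ.ker 0) y‖ₑ) * eLpNorm h 3 volume := by
  have e : dlt y h = conv (fun z ↦ χ.ker j z - χ.ker j (z - y)) h := by
    ext x
    have i1 := integrable_conv (χ.ker j) hh x
    have i2 : Integrable (fun z ↦ χ.ker j (z - y) * h (x - z)) volume := by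
      have := (integrable_conv (χ.ker j) hh (x - y)).comp_sub_right y
      simpa using this
    have e2 : ∫ z, χ.ker j (z - y) * h (x - z) = conv (χ.ker j) h (x - y) := by
      rw [conv, ← integral_sub_right_eq_self (fun z ↦ χ.ker j z * h (x - y - z)) y]
      simp only [sub_sub_sub_cancel_right]
    rw [conv]
    simp only [sub_mul]
    rw [integral_sub i1 i2, e2, ← conv, h1, dlt]
  rw [e]
  have hi : Integrable (fun z ↦ χ.ker j z - χ.ker j (z - y)) volume :=
    (χ.ker j).integrable.sub ((χ.ker j).integrable.comp_sub_right y)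
  refine (eLpNorm_three_conv_le hi hh.1).trans ?_
  gcongr
  simpa using (χ.isDilation_ker j).lintegral_translate_le (by positivity) y

/-- The sequence c is a geometric average of a, hence no larger in ℓ². Summing the recursion up to
an index m where S is maximal bounds S_m³ by S_m times a sum of squares, and one factor S_m is
divided out. -/
theorem sq_le_of_cube_recursion {a c S : ℕ → ℝ} {B : ℝ} (hB : 0 ≤ B) (ha : ∀ n, 0 ≤ a n)
    (hc0 : c 0 = 0) (hc : ∀ n, c (n + 1) = (c n + a n) / 2) (hS : ∀ n, 0 ≤ S n) (hS0 : S 0 = 0)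
    (haS : ∀ n, a n ≤ S n + S (n + 1))
    (hrec : ∀ n, S (n + 1) ^ 3 ≤ S n ^ 3 + B * (S n * a n * c n) + 3 * (S n * a n ^ 2) + a n ^ 3)
    (N : ℕ) : S N ^ 2 ≤ (B + 5) * ∑ k ∈ Finset.range N, a k ^ 2 := by
  have hcn : ∀ n, 0 ≤ c n := by
    intro n
    induction n with
    | zero => exact hc0.ge
    | succ n ih => rw [hc]; linarith [ha n]
  -- The extra term 2 c_n² makes the ℓ² bound for the average inductive, since (c + a)²/2 ≤ c² + a².
  have hcs : ∀ n, ∑ k ∈ Finset.range n, c k ^ 2 + 2 * c n ^ 2 ≤ ∑ k ∈ Finset.range n, a k ^ 2 := by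
    intro n
    induction n with
    | zero => simp [hc0]
    | succ n ih =>
      rw [Finset.sum_range_succ, Finset.sum_range_succ, hc]
      nlinarith [sq_nonneg (c n - a n)]
  obtain ⟨m, hm, hmax⟩ := Finset.exists_max_image (Finset.range (N + 1)) S ⟨0, by simp⟩
  rw [Finset.mem_range] at hm
  have hmax' : ∀ n ≤ N, S n ≤ S m := fun n hn ↦ hmax n (Finset.mem_range.2 (by omega))
  have hsum : ∀ n ≤ N, S n ^ 3 ≤ S m * ∑ k ∈ Finset.range n,
      (B / 2 * (a k ^ 2 + c k ^ 2) + 5 * a k ^ 2) := by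
    intro n hn
    induction n with
    | zero => simp [hS0]
    | succ n ih =>
      rw [Finset.sum_range_succ, mul_add]
      have h1 := ih (by omega)
      have h2 : S n ≤ S m := hmax' n (by omega)
      -- This absorbs the cubic term into 2 S_m a_n²; with the quadratic term 3 S_n a_n² it makes
      -- the constant 5.
      have h3 : a n ≤ 2 * S m := by linarith [haS n, hmax' (n + 1) hn]
      have h4 : S n * a n * c n ≤ S m * ((a n ^ 2 + c n ^ 2) / 2) := by
        calc S n * a n * c n = S n * (a n * c n) := by ring
          _ ≤ S m * ((a n ^ 2 + c n ^ 2) / 2) := by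
            refine mul_le_mul h2 ?_ (mul_nonneg (ha n) (hcn n)) (hS m)
            nlinarith [sq_nonneg (a n - c n)]
      have h5 : S n * a n ^ 2 ≤ S m * a n ^ 2 := by gcongr
      have h6 : a n ^ 3 ≤ 2 * S m * a n ^ 2 := by
        calc a n ^ 3 = a n * a n ^ 2 := by ring
          _ ≤ _ := by gcongr
      have h7 := mul_le_mul_of_nonneg_left h4 hB
      have h8 := hrec n
      nlinarith
  rcases (hS m).eq_or_lt with h0 | h0
  · have : S N = 0 := le_antisymm (h0 ▸ hmax' N le_rfl) (hS N)
    rw [this]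
    have := Finset.sum_nonneg fun k (_ : k ∈ Finset.range N) ↦ sq_nonneg (a k)
    nlinarith
  · have h1 := hsum m (by omega)
    have h2 : S m ^ 2 ≤ ∑ k ∈ Finset.range m, (B / 2 * (a k ^ 2 + c k ^ 2) + 5 * a k ^ 2) := by
      refine le_of_mul_le_mul_left ?_ h0
      calc S m * S m ^ 2 = S m ^ 3 := by ring
        _ ≤ _ := h1
    have h3 : ∑ k ∈ Finset.range m, (B / 2 * (a k ^ 2 + c k ^ 2) + 5 * a k ^ 2) ≤
        (B + 5) * ∑ k ∈ Finset.range m, a k ^ 2 := by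
      rw [Finset.sum_add_distrib, ← Finset.mul_sum, ← Finset.mul_sum, Finset.sum_add_distrib]
      have := hcs m
      nlinarith [sq_nonneg (c m)]
    have h4 : ∑ k ∈ Finset.range m, a k ^ 2 ≤ ∑ k ∈ Finset.range N, a k ^ 2 :=
      Finset.sum_le_sum_of_subset_of_nonneg (Finset.range_subset_range.2 (by omega))
        fun k _ _ ↦ sq_nonneg _
    calc S N ^ 2 ≤ S m ^ 2 := by
          have := hmax' N le_rfl
          have := hS N
          gcongr
      _ ≤ _ := h2
      _ ≤ _ := h3
      _ ≤ _ := by gcongr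

theorem n3_add_le {f g : E3 → ℂ} (hf : MemLp f 3 volume) (hg : MemLp g 3 volume) :
    n3 (f + g) ≤ n3 f + n3 g := by
  rw [n3, n3, n3, ← ENNReal.toReal_add hf.2.ne hg.2.ne]
  exact ENNReal.toReal_mono (ENNReal.add_ne_top.2 ⟨hf.2.ne, hg.2.ne⟩)
    (eLpNorm_add_le hf.1 hg.1 (by norm_num))

theorem integral_norm_mul_sq_le {F h : E3 → ℂ} (hF : MemL2Linfty F) (hh : MemL2Linfty h) :
    Integrable (fun x ↦ ‖F x‖ * ‖h x‖ ^ 2) volume ∧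
      ∫ x, ‖F x‖ * ‖h x‖ ^ 2 ≤ n3 F * n3 h ^ 2 := by
  have e := lintegral_enorm_mul_mul_le hF.1.1 hh.1.1 hh.1.1
  have e1 : ∀ x, ENNReal.ofReal (‖F x‖ * ‖h x‖ ^ 2) = ‖F x‖ₑ * ‖h x‖ₑ * ‖h x‖ₑ := fun x ↦ by
    rw [ENNReal.ofReal_mul (norm_nonneg _), ENNReal.ofReal_pow (norm_nonneg _), ofReal_norm,
      ofReal_norm, sq, mul_assoc]
  have hm : AEStronglyMeasurable (fun x ↦ ‖F x‖ * ‖h x‖ ^ 2) volume :=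
    hF.1.1.norm.mul (hh.1.1.norm.pow 2)
  have hfin : eLpNorm F 3 volume * eLpNorm h 3 volume * eLpNorm h 3 volume ≠ ⊤ :=
    ENNReal.mul_ne_top (ENNReal.mul_ne_top hF.memLp_three.2.ne hh.memLp_three.2.ne)
      hh.memLp_three.2.ne
  refine ⟨⟨hm, ?_⟩, ?_⟩
  · rw [hasFiniteIntegral_iff_ofReal (Eventually.of_forall fun x ↦ by positivity)]
    simp only [e1]
    exact e.trans_lt hfin.lt_top
  · rw [integral_eq_lintegral_of_nonneg_ae (Eventually.of_forall fun x ↦ by positivity) hm]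
    simp only [e1]
    refine (ENNReal.toReal_mono hfin e).trans_eq ?_
    rw [ENNReal.toReal_mul, ENNReal.toReal_mul, n3, n3]
    ring

theorem n3_add_cube_le {F h : E3 → ℂ} (hF : MemL2Linfty F) (hh : MemL2Linfty h) :
    n3 (F + h) ^ 3 ≤ n3 F ^ 3 + 3 * ‖∫ x, dual F x * h x‖ + 3 * (n3 F * n3 h ^ 2) + n3 h ^ 3 := by
  obtain ⟨i1, i2⟩ := integral_norm_mul_sq_le hF hh
  have hFh := integrable_mul_of_L2 (memLp_dual hF) hh.1
  have iF := integrable_norm_cube hF.memLp_three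
  have ih := integrable_norm_cube hh.memLp_three
  have iFh := integrable_norm_cube (hF.add hh).memLp_three
  have iG : Integrable (fun x ↦ 3 * (dual F x * h x).re) volume := hFh.re.const_mul 3
  have j1 : Integrable (fun x ↦ ‖F x‖ ^ 3 + 3 * (dual F x * h x).re) volume := iF.add iG
  have j2 : Integrable (fun x ↦ ‖F x‖ ^ 3 + 3 * (dual F x * h x).re + 3 * (‖F x‖ * ‖h x‖ ^ 2))
      volume := j1.add (i1.const_mul 3)
  have h1 : ∫ x, ‖(F + h) x‖ ^ 3 ≤ ∫ x, (‖F x‖ ^ 3 + 3 * (dual F x * h x).re +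
      3 * (‖F x‖ * ‖h x‖ ^ 2) + ‖h x‖ ^ 3) :=
    integral_mono iFh (j2.add ih)
      fun x ↦ norm_add_cube_le (F x) (h x)
  have h2 : ∫ x, (dual F x * h x).re ≤ ‖∫ x, dual F x * h x‖ := by
    have : ∫ x, (dual F x * h x).re = (∫ x, dual F x * h x).re := integral_re hFh
    rw [this]
    exact Complex.re_le_norm _
  rw [integral_add j2 ih, integral_add j1 (i1.const_mul 3), integral_add iF iG, integral_const_mul, integral_const_mul,
    integral_norm_cube hF.memLp_three, integral_norm_cube hh.memLp_three,
    integral_norm_cube (hF.add hh).memLp_three] at h1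
  linarith

/-! ### Almost orthogonality of dyadic blocks in L³ -/

section

variable (χ : Cutoff) {h : ℕ → E3 → ℂ} (hh : ∀ k, MemL2Linfty (h k))
  (h1 : ∀ k : ℕ, conv (χ.ker (k + 1)) (h k) = h k)
include hh h1

theorem eLpNorm_dlt_sum_le (n : ℕ) (y : E3) :
    eLpNorm (dlt y (∑ k ∈ Finset.range n, h k)) 3 volume ≤ ∑ k ∈ Finset.range n,
      ENNReal.ofReal (2 ^ ((k : ℤ) + 1) * ‖y‖) * (∫⁻ y, ‖fderiv ℝ (χ.ker 0) y‖ₑ) *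
        eLpNorm (h k) 3 volume := by
  have e : dlt y (∑ k ∈ Finset.range n, h k) = ∑ k ∈ Finset.range n, dlt y (h k) := by
    ext x
    simp only [dlt, Finset.sum_apply, Finset.sum_sub_distrib]
  rw [e]
  refine (eLpNorm_sum_le (fun k _ ↦ aestronglyMeasurable_dlt (hh k).1.1 y) (by norm_num)).trans ?_
  gcongr with k
  exact eLpNorm_dlt_le χ _ (hh k).1 (h1 k) y

/-- The constant in the square function bound. -/
def squareConst (χ : Cutoff) : ℝ :=
  (16 * (kmom (χ.ker 0)).toReal * (∫⁻ y, ‖fderiv ℝ (χ.ker 0) y‖ₑ).toReal)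

/-- The block n + 1 sees only increments of the partial sum at scale 2^(-(n-1)), to which the block
k ≤ n contributes with a gain of order 2^(k-n). This geometric decay is what makes the linear term
summable. -/
theorem norm_integral_dual_sum_le (n : ℕ) (h0 : conv (χ.ker ((n : ℤ) - 1)) (h (n + 1)) = 0) :
    ‖∫ x, dual (∑ k ∈ Finset.range (n + 1), h k) x * h (n + 1) x‖ ≤
      squareConst χ * (n3 (∑ k ∈ Finset.range (n + 1), h k) * n3 (h (n + 1)) *
        ∑ k ∈ Finset.range (n + 1), (2 : ℝ) ^ ((k : ℤ) - (n + 1)) * n3 (h k)) := by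
  set F := ∑ k ∈ Finset.range (n + 1), h k with hF'
  have hF : MemL2Linfty F := MemL2Linfty.sum hh (n + 1)
  set D := ∫⁻ y, ‖fderiv ℝ (χ.ker 0) y‖ₑ with hD
  have hDt : D ≠ ⊤ := (lintegral_fderiv_lt_top _).ne
  set K := kmom (χ.ker 0) with hK
  have hKt : K ≠ ⊤ := (kmom_lt_top _).ne
  -- The 8 comes from k + 1 = 3 + (k - (n + 1)) + (n - 1): 2^(k+1) is the scale reproducing block k,
  -- 2^(n-1) the scale annihilating block n + 1.
  have hP : ∀ k : ℕ, ∫⁻ y, ‖χ.ker ((n : ℤ) - 1) y‖ₑ * ENNReal.ofReal (2 ^ ((k : ℤ) + 1) * ‖y‖) ≤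
      ENNReal.ofReal (8 * 2 ^ ((k : ℤ) - (n + 1))) * K := by
    intro k
    have e1 := (χ.isDilation_ker ((n : ℤ) - 1)).kmom_le (by positivity)
    rw [enorm_one, one_mul] at e1
    rw [hK, ← e1, ← lintegral_const_mul' _ _ ENNReal.ofReal_ne_top]
    refine lintegral_mono fun y ↦ ?_
    rw [mul_left_comm, ← ENNReal.ofReal_mul (by positivity)]
    refine mul_le_mul_right (ENNReal.ofReal_le_ofReal ?_) _
    have e2 : (2 : ℝ) ^ ((k : ℤ) + 1) = 8 * 2 ^ ((k : ℤ) - (n + 1)) * 2 ^ ((n : ℤ) - 1) := by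
      rw [show (8 : ℝ) = 2 ^ (3 : ℤ) by norm_num, ← zpow_add₀ two_ne_zero, ← zpow_add₀ two_ne_zero]
      congr 1; ring
    rw [e2, mul_assoc _ _ ‖y‖]
    refine mul_le_mul_of_nonneg_left ?_ (by positivity)
    have : 0 ≤ (2 : ℝ) ^ ((n : ℤ) - 1) * ‖y‖ := by positivity
    nlinarith
  have key : ‖∫ x, dual F x * h (n + 1) x‖ₑ ≤ 2 * eLpNorm F 3 volume * eLpNorm (h (n + 1)) 3 volume *
      ∑ k ∈ Finset.range (n + 1), ENNReal.ofReal (8 * 2 ^ ((k : ℤ) - (n + 1))) * K * D *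
        eLpNorm (h k) 3 volume := by
    refine (enorm_integral_dual_mul_le χ _ hF (hh (n + 1)) h0).trans ?_
    gcongr
    calc _ ≤ ∫⁻ y, ∑ k ∈ Finset.range (n + 1), ‖χ.ker ((n : ℤ) - 1) y‖ₑ *
          ENNReal.ofReal (2 ^ ((k : ℤ) + 1) * ‖y‖) * (D * eLpNorm (h k) 3 volume) := by
          refine lintegral_mono fun y ↦ ?_
          refine (mul_le_mul_right (eLpNorm_dlt_sum_le χ hh h1 (n + 1) y) _).trans_eq ?_
          rw [Finset.mul_sum]
          exact Finset.sum_congr rfl fun k _ ↦ by ring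
      _ = ∑ k ∈ Finset.range (n + 1), (∫⁻ y, ‖χ.ker ((n : ℤ) - 1) y‖ₑ *
          ENNReal.ofReal (2 ^ ((k : ℤ) + 1) * ‖y‖)) * (D * eLpNorm (h k) 3 volume) := by
          rw [lintegral_finsetSum']
          · refine Finset.sum_congr rfl fun k _ ↦ ?_
            rw [lintegral_mul_const' _ _ (ENNReal.mul_ne_top hDt (hh k).memLp_three.2.ne)]
          · intro k _
            have m1 := (χ.ker ((n : ℤ) - 1)).continuous.enorm.measurable
            exact ((m1.mul (by fun_prop)).mul_const _).aemeasurable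
      _ ≤ _ := by
          refine Finset.sum_le_sum fun k _ ↦ ?_
          rw [mul_assoc (_ * K)]
          gcongr
          exact hP k
  have fin : ∀ k ∈ Finset.range (n + 1), ENNReal.ofReal (8 * 2 ^ ((k : ℤ) - (n + 1))) * K * D *
        eLpNorm (h k) 3 volume ≠ ⊤ := fun k _ ↦ ENNReal.mul_ne_top (ENNReal.mul_ne_top
      (ENNReal.mul_ne_top ENNReal.ofReal_ne_top hKt) hDt) (hh k).memLp_three.2.ne
  have := ENNReal.toReal_mono (ENNReal.mul_ne_top (ENNReal.mul_ne_top (ENNReal.mul_ne_top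
    ENNReal.ofNat_ne_top hF.memLp_three.2.ne) (hh (n + 1)).memLp_three.2.ne)
    (ENNReal.sum_ne_top.2 fin)) key
  rw [toReal_enorm] at this
  refine this.trans_eq ?_
  rw [ENNReal.toReal_mul, ENNReal.toReal_mul, ENNReal.toReal_mul, ENNReal.toReal_sum fin,
    Finset.mul_sum, Finset.mul_sum, Finset.mul_sum]
  refine Finset.sum_congr rfl fun k _ ↦ ?_
  rw [ENNReal.toReal_mul, ENNReal.toReal_mul, ENNReal.toReal_mul,
    ENNReal.toReal_ofReal (by positivity), squareConst, n3, n3, n3, ENNReal.toReal_ofNat]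
  ring

theorem n3_sum_sq_le (h0 : ∀ n : ℕ, conv (χ.ker ((n : ℤ) - 1)) (h (n + 1)) = 0) (N : ℕ) :
    n3 (∑ k ∈ Finset.range N, h k) ^ 2 ≤
      (3 * squareConst χ + 5) * ∑ k ∈ Finset.range N, n3 (h k) ^ 2 := by
  have hC : 0 ≤ squareConst χ := by unfold squareConst; positivity
  -- The average c_n collects the earlier norms with weights 2^(k-n), so that passing to n + 1
  -- halves it after adding the newest term.
  refine sq_le_of_cube_recursion (a := fun k ↦ n3 (h k))
    (c := fun n ↦ ∑ k ∈ Finset.range n, (2 : ℝ) ^ ((k : ℤ) - n) * n3 (h k))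
    (S := fun n ↦ n3 (∑ k ∈ Finset.range n, h k)) (by positivity) (fun n ↦ n3_nonneg _)
    (by simp) (fun n ↦ ?_) (fun n ↦ n3_nonneg _) ?_ (fun n ↦ ?_) (fun n ↦ ?_) N
  · rw [Finset.sum_range_succ, add_div, Finset.sum_div]
    congr 1
    · refine Finset.sum_congr rfl fun k _ ↦ ?_
      rw [show ((k : ℤ) - (n + 1 : ℕ)) = (k - n) - 1 by push_cast; ring, zpow_sub_one₀ two_ne_zero]
      ring
    · rw [show ((n : ℤ) - (n + 1 : ℕ)) = -1 by push_cast; ring, zpow_neg_one]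
      ring
  · simp [n3]
  · have e : h n = (-1 : ℂ) • (∑ k ∈ Finset.range n, h k) + ∑ k ∈ Finset.range (n + 1), h k := by
      rw [Finset.sum_range_succ]; simp
    have hs := fun n ↦ (MemL2Linfty.sum hh n).memLp_three
    have := n3_add_le ((hs n).const_smul (-1 : ℂ)) (hs (n + 1))
    rw [← e] at this
    refine this.trans_eq ?_
    congr 1
    rw [n3, eLpNorm_const_smul, n3]
    simp
  · rw [Finset.sum_range_succ]
    refine (n3_add_cube_le (MemL2Linfty.sum hh n) (hh n)).trans ?_
    rw [mul_assoc 3 (squareConst χ)]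
    gcongr
    cases n with
    | zero => simp [dual]
    | succ n =>
      have := norm_integral_dual_sum_le χ hh h1 n (h0 n)
      exact_mod_cast this

end

/-! ### Littlewood-Paley partial sums and the embedding into L³ -/

theorem Cutoff.norm_sym_le (χ : Cutoff) : ∃ C : ℝ, ∀ (j : ℤ) ξ, ‖χ.sym j ξ‖ ≤ C := by
  obtain ⟨C, hC⟩ := (χ.sym 0).continuous.bounded_above_of_compact_support
    (HasCompactSupport.of_support_subset_isCompact (isCompact_closedBall (0 : E3) 1) fun ξ hξ ↦ by
      by_contra h
      rw [mem_closedBall_zero_iff, not_le] at h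
      refine hξ (χ.sym_eq_zero ?_)
      have := Real.two_le_pi
      rw [zpow_zero]
      nlinarith)
  exact ⟨C, fun j ξ ↦ by rw [χ.sym_scale, one_mul]; exact hC _⟩

theorem Cutoff.tendsto_sym (χ : Cutoff) (ξ : E3) :
    Tendsto (fun N : ℕ ↦ χ.sym N ξ) atTop (𝓝 1) := by
  refine tendsto_const_nhds.congr' ?_
  have h : Tendsto (fun N : ℕ ↦ (2 : ℝ) ^ N) atTop atTop := tendsto_pow_atTop_atTop_of_one_lt (by norm_num)
  filter_upwards [h.eventually_ge_atTop (2 * (2 * Real.pi * ‖ξ‖))] with N hN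
  rw [χ.sym_eq_one]
  rw [zpow_natCast]
  linarith

theorem eLpNorm_two_pow {F : Type*} [NormedAddCommGroup F] (f : E3 → F) :
    eLpNorm f 2 volume ^ 2 = ∫⁻ x, ‖f x‖ₑ ^ 2 := by
  rw [eLpNorm_eq_lintegral_rpow_enorm_toReal (by norm_num) (by norm_num), ← ENNReal.rpow_natCast,
    ← ENNReal.rpow_mul]
  norm_num

theorem tendsto_eLpNorm_conv_ker (χ : Cutoff) {g : E3 → ℂ} (hg : MemLp g 2 volume) :
    Tendsto (fun N : ℕ ↦ eLpNorm (conv (χ.ker N) g - g) 2 volume) atTop (𝓝 0) := by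
  obtain ⟨C, hC⟩ := χ.norm_sym_le
  have e : ∀ N : ℕ, eLpNorm (conv (χ.ker N) g - g) 2 volume ^ 2 =
      ∫⁻ ξ, ‖(χ.sym N ξ - 1) * hat g ξ‖ₑ ^ 2 := by
    intro N
    have hc : MemLp (conv (χ.ker N) g) 2 volume := memLp_conv (χ.sym N) hg
    rw [← eLpNorm_hat (hc.sub hg), eLpNorm_two_pow]
    refine lintegral_congr_ae ?_
    have h2 : hat (conv (χ.ker N) g - g) =ᵐ[volume] hat (conv (χ.ker N) g) + (-1 : ℂ) • hat g := by
      rw [show conv (χ.ker N) g - g = conv (χ.ker N) g + (-1 : ℂ) • g by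
        rw [neg_one_smul, sub_eq_add_neg]]
      refine (hat_add hc (hg.const_smul _)).trans ?_
      filter_upwards [hat_const_smul hg (-1)] with ξ h
      simp only [Pi.add_apply, h]
    filter_upwards [h2, hat_conv (χ.sym N) hg] with ξ h3 h4
    rw [h3, Pi.add_apply, Cutoff.ker, h4]
    simp only [Pi.smul_apply, smul_eq_mul]
    ring_nf
  have h : Tendsto (fun N : ℕ ↦ ∫⁻ ξ, ‖(χ.sym N ξ - 1) * hat g ξ‖ₑ ^ 2) atTop
      (𝓝 (∫⁻ _ : E3, 0)) := by
    refine tendsto_lintegral_of_dominated_convergence'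
      (fun ξ ↦ ENNReal.ofReal (C + 1) ^ 2 * ‖hat g ξ‖ₑ ^ 2) (fun N ↦ ?_) (fun N ↦ ?_) ?_ ?_
    · exact ((((χ.sym N).continuous.sub continuous_const).aestronglyMeasurable.mul
        (memLp_hat g).1).enorm).pow_const 2
    · refine Eventually.of_forall fun ξ ↦ ?_
      simp only
      rw [enorm_mul, mul_pow]
      gcongr
      rw [← ofReal_norm]
      refine ENNReal.ofReal_le_ofReal ((norm_sub_le _ _).trans ?_)
      rw [norm_one]
      gcongr
      exact hC _ _
    · rw [lintegral_const_mul' _ _ (by finiteness), ← eLpNorm_two_pow]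
      exact ENNReal.mul_ne_top (by finiteness) (ENNReal.pow_ne_top (memLp_hat g).2.ne)
    · refine Eventually.of_forall fun ξ ↦ ?_
      have h1 : Tendsto (fun N : ℕ ↦ (χ.sym N ξ - 1) * hat g ξ) atTop (𝓝 0) := by
        have := ((χ.tendsto_sym ξ).sub_const 1).mul_const (hat g ξ)
        simpa using this
      have := (ENNReal.continuous_pow 2).continuousAt.tendsto.comp h1.enorm
      simpa [Function.comp_def] using this
  rw [lintegral_zero] at h
  simp only [← e] at h
  have h3 := ((ENNReal.continuous_rpow_const (y := 1 / 2)).tendsto 0).comp h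
  rw [ENNReal.zero_rpow_of_pos (by norm_num)] at h3
  refine h3.congr fun N ↦ ?_
  simp only [Function.comp]
  rw [← ENNReal.rpow_natCast, ← ENNReal.rpow_mul]
  norm_num

theorem conv_sum_blk (χ : Cutoff) {g : E3 → ℂ} (hg : MemLp g 2 volume) (N : ℕ) :
    ∑ k ∈ Finset.range (N + 1), conv (𝓕⁻ (χ.blk k) : 𝓢(E3, ℂ)) g = conv (χ.ker N) g := by
  have e : χ.ker N = ∑ k ∈ Finset.range (N + 1), (𝓕⁻ (χ.blk k) : 𝓢(E3, ℂ)) := by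
    rw [Cutoff.ker, ← χ.sum_blk]
    exact map_sum (FourierTransform.fourierInvCLM ℂ 𝓢(E3, ℂ)) _ _
  ext x
  rw [e, Finset.sum_apply]
  simp only [conv]
  rw [← integral_finsetSum _ fun k _ ↦ integrable_conv _ hg x]
  refine integral_congr_ae (Eventually.of_forall fun y ↦ ?_)
  simp only [← Finset.sum_mul]
  congr 1
  simp

/-- The embedding `B⁰_{3,2} ⊆ L³`. -/
theorem eLpNorm_three_sq_le (χ : Cutoff) {g : E3 → ℂ} (hg : MemLp g 2 volume) :
    eLpNorm g 3 volume ^ 2 ≤ ENNReal.ofReal (3 * squareConst χ + 5) *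
      ∑' k, eLpNorm (conv (𝓕⁻ (χ.blk k) : 𝓢(E3, ℂ)) g) 3 volume ^ 2 := by
  set h : ℕ → E3 → ℂ := fun k ↦ conv (𝓕⁻ (χ.blk k) : 𝓢(E3, ℂ)) g with hdef
  have hC : 0 ≤ squareConst χ := by unfold squareConst; positivity
  have hh : ∀ k, MemL2Linfty (h k) := fun k ↦ ⟨memLp_conv _ hg, memLp_top_conv _ hg⟩
  have h1 : ∀ k : ℕ, conv (χ.ker (k + 1)) (h k) = h k := fun k ↦ by
    rw [hdef, Cutoff.ker]; simp only
    rw [conv_conv _ _ hg, χ.sym_mul_blk]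
  have h0 : ∀ n : ℕ, conv (χ.ker ((n : ℤ) - 1)) (h (n + 1)) = 0 := fun n ↦ by
    rw [hdef, Cutoff.ker]; simp only
    rw [conv_conv _ _ hg, χ.sym_mul_blk_eq_zero]
    ext x
    rw [conv_eq_fourierInv _ hg, fourierInv_eq_exp]
    simp
  have key : ∀ N : ℕ, eLpNorm (conv (χ.ker N) g) 3 volume ^ 2 ≤
      ENNReal.ofReal (3 * squareConst χ + 5) * ∑' k, eLpNorm (h k) 3 volume ^ 2 := by
    intro N
    have h2 := ENNReal.ofReal_le_ofReal (n3_sum_sq_le χ hh h1 h0 (N + 1))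
    rw [ENNReal.ofReal_pow (n3_nonneg _), ofReal_n3 (MemL2Linfty.sum hh _).memLp_three,
      ENNReal.ofReal_mul (by positivity), ENNReal.ofReal_sum_of_nonneg (fun _ _ ↦ sq_nonneg _),
      conv_sum_blk χ hg N] at h2
    refine h2.trans ?_
    gcongr
    refine le_trans (Finset.sum_le_sum fun k _ ↦ ?_) (ENNReal.sum_le_tsum (Finset.range (N + 1)))
    rw [ENNReal.ofReal_pow (n3_nonneg _), ofReal_n3 (hh k).memLp_three]
  have hm : ∀ N : ℕ, AEStronglyMeasurable (conv (χ.ker N) g) volume :=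
    fun N ↦ (continuous_conv (χ.sym N) hg).aestronglyMeasurable
  -- Membership of g in L³ is not assumed. The partial sums converge in L², so a subsequence
  -- converges almost everywhere and Fatou's lemma transfers the uniform L³ bound.
  obtain ⟨ns, -, hns⟩ := (tendstoInMeasure_of_tendsto_eLpNorm (p := 2) (by norm_num) hm hg.1
    (tendsto_eLpNorm_conv_ker χ hg)).exists_seq_tendsto_ae
  have hfatou := Lp.eLpNorm_lim_le_liminf_eLpNorm (p := 3) (fun n ↦ hm (ns n)) g hns
  set R := ENNReal.ofReal (3 * squareConst χ + 5) * ∑' k, eLpNorm (h k) 3 volume ^ 2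
  have hle : eLpNorm g 3 volume ≤ R ^ (1 / 2 : ℝ) := by
    refine hfatou.trans (liminf_le_of_le (by isBoundedDefault) fun b hb ↦ ?_)
    obtain ⟨n, hn⟩ := hb.exists
    refine hn.trans ?_
    have := ENNReal.rpow_le_rpow (key (ns n)) (z := 1 / 2) (by norm_num)
    rwa [← ENNReal.rpow_natCast, ← ENNReal.rpow_mul, show ((2 : ℕ) : ℝ) * (1 / 2) = 1 by norm_num,
      ENNReal.rpow_one] at this
  calc _ ≤ (R ^ (1 / 2 : ℝ)) ^ 2 := by gcongr
    _ = R := by rw [← ENNReal.rpow_natCast, ← ENNReal.rpow_mul]; norm_num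

/-! ### Increments of a field -/

theorem conv_dlt (σ : 𝓢(E3, ℂ)) {g : E3 → ℂ} (hg : MemLp g 2 volume) (y : E3) :
    conv (𝓕⁻ σ : 𝓢(E3, ℂ)) (dlt y g) = dlt y (conv (𝓕⁻ σ : 𝓢(E3, ℂ)) g) := by
  ext x
  have h2 := integrable_conv (𝓕⁻ σ) hg (x - y)
  simp only [sub_right_comm x y] at h2
  simp only [conv, dlt, mul_sub]
  rw [integral_sub (integrable_conv _ hg x) h2]
  simp only [sub_right_comm x y]

theorem memLp_dlt {g : E3 → ℂ} {p : ℝ≥0∞} (hg : MemLp g p volume) (y : E3) :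
    MemLp (dlt y g) p volume := hg.sub (memLp_comp_sub_right hg y)

/-- The weighted square function at frequency `2^n`. -/
def locX (n : ℤ) (A : ℕ → ℝ≥0∞) : ℝ≥0∞ :=
  ∑' k : ℕ, ENNReal.ofReal (min 1 (2 ^ ((k : ℤ) - n))) ^ 2 * A k ^ 2

/-- The constant in the increment bound for a single block. -/
def dltConst (χ : Cutoff) : ℝ≥0∞ := 2 + 2 * ∫⁻ y, ‖fderiv ℝ (χ.ker 0) y‖ₑ

theorem dltConst_lt_top (χ : Cutoff) : dltConst χ < ⊤ := by
  have := lintegral_fderiv_lt_top (χ.ker 0)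
  unfold dltConst
  finiteness

/-- Below frequency 2^n Bernstein's inequality gains 2^(k-n); above it the triangle inequality is
enough. Both are put in one form, the 2 in `dltConst` serving the second case. -/
theorem eLpNorm_dlt_blk_le (χ : Cutoff) {g : E3 → ℂ} (hg : MemLp g 2 volume) (n : ℤ) (k : ℕ)
    (y : E3) :
    eLpNorm (dlt y (conv (𝓕⁻ (χ.blk k) : 𝓢(E3, ℂ)) g)) 3 volume ≤
      dltConst χ * ENNReal.ofReal (1 + 2 ^ n * ‖y‖) * ENNReal.ofReal (min 1 (2 ^ ((k : ℤ) - n))) *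
        eLpNorm (conv (𝓕⁻ (χ.blk k) : 𝓢(E3, ℂ)) g) 3 volume := by
  set f := conv (𝓕⁻ (χ.blk k) : 𝓢(E3, ℂ)) g with hf
  have hf2 : MemLp f 2 volume := memLp_conv _ hg
  set D := ∫⁻ y, ‖fderiv ℝ (χ.ker 0) y‖ₑ with hD
  have hdc : dltConst χ = 2 + 2 * D := rfl
  rcases le_total (2 ^ ((k : ℤ) - n) : ℝ) 1 with h | h
  · have h1 : conv (χ.ker (k + 1)) f = f := by
      rw [hf, Cutoff.ker, conv_conv _ _ hg, χ.sym_mul_blk]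
    refine (eLpNorm_dlt_le χ _ hf2 h1 y).trans (mul_le_mul_left ?_ _)
    rw [min_eq_right h]
    have e : (2 : ℝ) ^ ((k : ℤ) + 1) * ‖y‖ = 2 * ((2 ^ n * ‖y‖) * 2 ^ ((k : ℤ) - n)) := by
      have : (2 : ℝ) ^ ((k : ℤ) + 1) = 2 * (2 ^ n * 2 ^ ((k : ℤ) - n)) := by
        rw [← zpow_add₀ two_ne_zero, zpow_add_one₀ two_ne_zero, mul_comm]
        congr 2; ring
      rw [this]; ring
    rw [e, ENNReal.ofReal_mul zero_le_two, ENNReal.ofReal_mul (by positivity), hdc]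
    calc _ = 2 * D * ENNReal.ofReal (2 ^ n * ‖y‖) * ENNReal.ofReal (2 ^ ((k : ℤ) - n)) := by
          rw [ENNReal.ofReal_ofNat]; ring
      _ ≤ _ := by
          gcongr
          · exact le_add_self
          · linarith
  · rw [min_eq_left h, ENNReal.ofReal_one, mul_one]
    have h1 : eLpNorm (dlt y f) 3 volume ≤ eLpNorm f 3 volume + eLpNorm f 3 volume := by
      have := eLpNorm_sub_le (p := 3) hf2.1
        (hf2.1.comp_measurePreserving (measurePreserving_sub_right volume y)) (by norm_num)
      refine this.trans_eq ?_
      congr 1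
      exact eLpNorm_comp_sub f hf2.1 y
    refine h1.trans ?_
    rw [← two_mul]
    gcongr
    calc (2 : ℝ≥0∞) ≤ dltConst χ := by rw [hdc]; exact le_self_add
      _ ≤ _ := by
        refine le_mul_of_one_le_right' ?_
        rw [ENNReal.one_le_ofReal]
        have : 0 ≤ 2 ^ n * ‖y‖ := by positivity
        linarith

/-- The constant in the increment bound. -/
def incrConst (χ : Cutoff) : ℝ≥0∞ :=
  ENNReal.ofReal (3 * squareConst χ + 5) ^ (1 / 2 : ℝ) * dltConst χ

theorem incrConst_lt_top (χ : Cutoff) : incrConst χ < ⊤ :=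
  ENNReal.mul_lt_top (ENNReal.rpow_lt_top_of_nonneg (by norm_num) ENNReal.ofReal_ne_top)
    (dltConst_lt_top χ)

/-- The embedding is applied to the increment itself, whose blocks are the increments of the blocks.
The gains thus enter squared and are summed in ℓ². -/
theorem eLpNorm_dlt_le_locX (χ : Cutoff) {g : E3 → ℂ} (hg : MemLp g 2 volume) {A : ℕ → ℝ≥0∞}
    (hA : ∀ k, eLpNorm (conv (𝓕⁻ (χ.blk k) : 𝓢(E3, ℂ)) g) 3 volume ≤ A k) (n : ℤ) (y : E3) :
    eLpNorm (dlt y g) 3 volume ≤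
      incrConst χ * ENNReal.ofReal (1 + 2 ^ n * ‖y‖) * locX n A ^ (1 / 2 : ℝ) := by
  have h := eLpNorm_three_sq_le χ (memLp_dlt hg y)
  have h2 : ∑' k, eLpNorm (conv (𝓕⁻ (χ.blk k) : 𝓢(E3, ℂ)) (dlt y g)) 3 volume ^ 2 ≤
      (dltConst χ * ENNReal.ofReal (1 + 2 ^ n * ‖y‖)) ^ 2 * locX n A := by
    rw [locX, ← ENNReal.tsum_mul_left]
    refine ENNReal.tsum_le_tsum fun k ↦ ?_
    rw [conv_dlt _ hg, ← mul_pow, ← mul_pow, ← mul_assoc]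
    gcongr
    exact (eLpNorm_dlt_blk_le χ hg n k y).trans (by gcongr; exact hA k)
  have h3 := ENNReal.rpow_le_rpow (h.trans (mul_le_mul_right h2 _)) (z := 1 / 2) (by norm_num)
  rw [← ENNReal.rpow_natCast, ← ENNReal.rpow_mul, show ((2 : ℕ) : ℝ) * (1 / 2) = 1 by norm_num,
    ENNReal.rpow_one, ENNReal.mul_rpow_of_nonneg _ _ (by norm_num),
    ENNReal.mul_rpow_of_nonneg _ _ (by norm_num), ← ENNReal.rpow_natCast, ← ENNReal.rpow_mul,
    show ((2 : ℕ) : ℝ) * (1 / 2) = 1 by norm_num, ENNReal.rpow_one] at h3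
  refine h3.trans_eq ?_
  rw [incrConst]; ring

/-! ### The resolved helicity flux vanishes -/

theorem MemL2Linfty.integrable_mul_mul {a b c : E3 → ℂ} (ha : MemL2Linfty a) (hb : MemL2Linfty b)
    (hc : MemL2Linfty c) : Integrable (fun x ↦ a x * b x * c x) volume :=
  integrable_mul_of_L2 (MemLp.mul' (p := ⊤) (q := 2) hb.1 ha.2) hc.1

/-- `a` and its derivative `a'` in direction `e` are bounded and square integrable. -/
structure HasNiceDeriv (a a' : E3 → ℂ) (e : E3) : Prop where
  memL2Linfty : MemL2Linfty a
  memL2Linfty_deriv : MemL2Linfty a'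
  hasLineDerivAt : ∀ x, HasLineDerivAt ℝ a (a' x) x e

/-- The integrand is the derivative of a b c. Each product is integrable, two factors being in L²
and one bounded, so the integral vanishes by integration by parts against the constant 1. -/
theorem integral_hasNiceDeriv_mul_mul {a a' b b' c c' : E3 → ℂ} {e : E3}
    (ha : HasNiceDeriv a a' e) (hb : HasNiceDeriv b b' e) (hc : HasNiceDeriv c c' e) :
    Integrable (fun x ↦ a' x * b x * c x + a x * b' x * c x + a x * b x * c' x) volume ∧
    ∫ x, (a' x * b x * c x + a x * b' x * c x + a x * b x * c' x) = 0 := by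
  have i1 := ha.2.integrable_mul_mul hb.1 hc.1
  have i2 := ha.1.integrable_mul_mul hb.2 hc.1
  have i3 := ha.1.integrable_mul_mul hb.1 hc.2
  have i0 := ha.1.integrable_mul_mul hb.1 hc.1
  have i : Integrable (fun x ↦ a' x * b x * c x + a x * b' x * c x + a x * b x * c' x) volume :=
    (i1.add i2).add i3
  refine ⟨i, ?_⟩
  have h := integral_bilinear_hasLineDerivAt_right_eq_neg_left_of_integrable (μ := volume)
    (f := fun _ : E3 ↦ (1 : ℂ)) (f' := fun _ ↦ 0) (g := fun x ↦ a x * b x * c x)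
    (g' := fun x ↦ a' x * b x * c x + a x * b' x * c x + a x * b x * c' x) (v := e)
    (B := ContinuousLinearMap.mul ℝ ℂ) (by simp) (by simpa using i) (by simpa using i0)
    (fun x _ ↦ hasDerivAt_const _ _) (fun x _ ↦ by
      have h3 := ((ha.3 x).mul (hb.3 x)).mul (hc.3 x)
      simp only [zero_smul, add_zero] at h3
      refine h3.congr_deriv ?_
      simp; ring)
  simpa using h

/-- For a divergence-free field `v` with curl `w`, `∑ v_i v_j ∂_i w_j` is a divergence. -/
theorem integral_vel_vel_deriv_vort {v w : Fin 3 → E3 → ℂ} {Dv Dw : Fin 3 → Fin 3 → E3 → ℂ}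
    (hv : ∀ i k, HasNiceDeriv (v k) (Dv i k) (stdVec i))
    (hw : ∀ i k, HasNiceDeriv (w k) (Dw i k) (stdVec i))
    (divv : ∀ x, ∑ i, Dv i i x = 0) (divw : ∀ x, ∑ i, Dw i i x = 0)
    (w0 : ∀ x, w 0 x = Dv 1 2 x - Dv 2 1 x) (w1 : ∀ x, w 1 x = Dv 2 0 x - Dv 0 2 x)
    (w2 : ∀ x, w 2 x = Dv 0 1 x - Dv 1 0 x) :
    ∫ x, ∑ i, ∑ j, v i x * v j x * Dw i j x = 0 := by
  have h1 := fun i j ↦ integral_hasNiceDeriv_mul_mul (hv i i) (hv i j) (hw i j)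
  have h2 := fun i j ↦ integral_hasNiceDeriv_mul_mul (hw i i) (hv i j) (hv i j)
  -- From (v·∇)v = ∇|v|²/2 - v × w follows w·(v·∇)v = div(|v|² w)/2, using div w = 0. Hence v_i v_j
  -- ∂_i w_j = div((v·w) v) - div(|v|² w)/2, using div v = 0.
  have e : ∀ x, ∑ i, ∑ j, v i x * v j x * Dw i j x =
      ∑ i, ∑ j, ((Dv i i x * v j x * w j x + v i x * Dv i j x * w j x + v i x * v j x * Dw i j x) -
        2⁻¹ * (Dw i i x * v j x * v j x + w i x * Dv i j x * v j x + w i x * v j x * Dv i j x)) := by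
    intro x
    have d1 := divv x
    have d2 := divw x
    simp only [Fin.sum_univ_three] at d1 d2 ⊢
    rw [w0, w1, w2]
    linear_combination (- (v 0 x * (Dv 1 2 x - Dv 2 1 x) + v 1 x * (Dv 2 0 x - Dv 0 2 x) +
      v 2 x * (Dv 0 1 x - Dv 1 0 x))) * d1 + 2⁻¹ * (v 0 x ^ 2 + v 1 x ^ 2 + v 2 x ^ 2) * d2
  simp only [e]
  have h3 : ∀ i j, Integrable (fun x ↦
      (Dv i i x * v j x * w j x + v i x * Dv i j x * w j x + v i x * v j x * Dw i j x) -
      2⁻¹ * (Dw i i x * v j x * v j x + w i x * Dv i j x * v j x + w i x * v j x * Dv i j x))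
      volume := fun i j ↦ (h1 i j).1.sub ((h2 i j).1.const_mul _)
  rw [integral_finsetSum _ fun i _ ↦ integrable_finsetSum _ fun j _ ↦ h3 i j]
  refine Finset.sum_eq_zero fun i _ ↦ ?_
  rw [integral_finsetSum _ fun j _ ↦ h3 i j]
  refine Finset.sum_eq_zero fun j _ ↦ ?_
  rw [integral_sub (h1 i j).1 ((h2 i j).1.const_mul _), integral_const_mul, (h1 i j).2, (h2 i j).2]
  simp

theorem memL2Linfty_conv (σ : 𝓢(E3, ℂ)) {f : E3 → ℂ} (hf : MemLp f 2 volume) :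
    MemL2Linfty (conv (𝓕⁻ σ : 𝓢(E3, ℂ)) f) := ⟨memLp_conv σ hf, memLp_top_conv σ hf⟩

theorem hasNiceDeriv_conv (σ : 𝓢(E3, ℂ)) {f : E3 → ℂ} (hf : MemLp f 2 volume) (e : E3) :
    HasNiceDeriv (conv (𝓕⁻ σ : 𝓢(E3, ℂ)) f) (conv (𝓕⁻ (dS e σ) : 𝓢(E3, ℂ)) f) e where
  memL2Linfty := memL2Linfty_conv σ hf
  memL2Linfty_deriv := memL2Linfty_conv _ hf
  hasLineDerivAt x := by
    rw [← fderiv_conv σ hf]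
    exact (differentiable_conv σ hf x).hasFDerivAt.hasLineDerivAt e

theorem HasNiceDeriv.sub {a a' b b' : E3 → ℂ} {e : E3} (ha : HasNiceDeriv a a' e)
    (hb : HasNiceDeriv b b' e) : HasNiceDeriv (a - b) (a' - b') e where
  memL2Linfty := ⟨ha.1.1.sub hb.1.1, ha.1.2.sub hb.1.2⟩
  memL2Linfty_deriv := ⟨ha.2.1.sub hb.2.1, ha.2.2.sub hb.2.2⟩
  hasLineDerivAt x := HasDerivAt.sub (ha.3 x) (hb.3 x)

section

variable {u : Lp E3 2 (volume : Measure E3)}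

theorem hasNiceDeriv_curlConv (σ : 𝓢(E3, ℂ)) (i j : Fin 3) :
    HasNiceDeriv (curlConv σ u j) (curlConv (dS (stdVec i) σ) u j) (stdVec i) := by
  have key : ∀ a b k l : Fin 3, HasNiceDeriv (conv (𝓕⁻ (dS (stdVec a) σ) : 𝓢(E3, ℂ)) (cmp u k) -
        conv (𝓕⁻ (dS (stdVec b) σ) : 𝓢(E3, ℂ)) (cmp u l))
      (conv (𝓕⁻ (dS (stdVec a) (dS (stdVec i) σ)) : 𝓢(E3, ℂ)) (cmp u k) -
        conv (𝓕⁻ (dS (stdVec b) (dS (stdVec i) σ)) : 𝓢(E3, ℂ)) (cmp u l)) (stdVec i) := by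
    intro a b k l
    rw [dS_comm _ (stdVec i), dS_comm _ (stdVec i)]
    exact (hasNiceDeriv_conv _ (memLp_cmp u k) _).sub (hasNiceDeriv_conv _ (memLp_cmp u l) _)
  fin_cases j
  · exact key 1 2 2 1
  · exact key 2 0 0 2
  · exact key 0 1 1 0

theorem IsDivFree.sum_conv_dS (hd : IsDivFree u) (σ : 𝓢(E3, ℂ)) (x : E3) :
    ∑ i, conv (𝓕⁻ (dS (stdVec i) σ) : 𝓢(E3, ℂ)) (cmp u i) x = 0 := by
  simp only [conv_eq_fourierInv _ (memLp_cmp u _), fourierInv_eq_exp]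
  rw [← integral_finsetSum]
  · refine integral_eq_zero_of_ae ?_
    filter_upwards [hd.sum_dHat] with ξ h
    have e : ∀ i, (Real.fourierChar (inner ℝ ξ x) : ℂ) * (dS (stdVec i) σ ξ * hat (cmp u i) ξ) =
        (Real.fourierChar (inner ℝ ξ x) : ℂ) * σ ξ * dHat i (cmpHat u i) ξ := fun i ↦ by
      rw [dS_apply, dHat, cmpHat]; ring
    simp only [e]
    rw [← Finset.mul_sum, h]
    simp
  · intro i hi
    obtain ⟨κ, h1, -⟩ := exists_modulation (dS (stdVec i) σ) x
    simp only [← mul_assoc, ← h1]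
    exact integrable_schwartz_mul κ (memLp_hat _)

theorem sum_curlConv_dS (σ : 𝓢(E3, ℂ)) (x : E3) :
    ∑ i, curlConv (dS (stdVec i) σ) u i x = 0 := by
  simp only [Fin.sum_univ_three, curlConv, Matrix.cons_val, Pi.sub_apply]
  rw [dS_comm (stdVec 1) (stdVec 0), dS_comm (stdVec 2) (stdVec 0), dS_comm (stdVec 2) (stdVec 1)]
  ring

theorem integral_resolved_flux (hd : IsDivFree u) (σ : 𝓢(E3, ℂ)) :
    ∫ x, ∑ i, ∑ j, conv (𝓕⁻ σ : 𝓢(E3, ℂ)) (cmp u i) x * conv (𝓕⁻ σ : 𝓢(E3, ℂ)) (cmp u j) x *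
      curlConv (dS (stdVec i) σ) u j x = 0 :=
  integral_vel_vel_deriv_vort (v := fun i ↦ conv (𝓕⁻ σ : 𝓢(E3, ℂ)) (cmp u i))
    (w := curlConv σ u) (Dv := fun i k ↦ conv (𝓕⁻ (dS (stdVec i) σ) : 𝓢(E3, ℂ)) (cmp u k))
    (Dw := fun i j ↦ curlConv (dS (stdVec i) σ) u j)
    (fun _ k ↦ hasNiceDeriv_conv σ (memLp_cmp u k) _) (fun i j ↦ hasNiceDeriv_curlConv σ i j)
    (hd.sum_conv_dS σ) (sum_curlConv_dS σ) (fun _ ↦ rfl) (fun _ ↦ rfl) (fun _ ↦ rfl)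

/-! ### The commutator -/

/-- The Constantin-E-Titi identity in symmetric form. Expanding the product of increments gives two
diagonal terms, simplified by the unit mass of the kernel, and two mixed terms equal to the product
of mollifications. -/
theorem two_mul_conv_sub_eq (χ : Cutoff) (n : ℤ) {f g : E3 → ℂ} (hf : MemLp f 2 volume)
    (hg : MemLp g 2 volume) (x : E3) :
    2 * ((∫ y, χ.ker n y * (f (x - y) * g (x - y))) -
        conv (χ.ker n) f x * conv (χ.ker n) g x) =
      ∫ p : E3 × E3, χ.ker n p.1 * χ.ker n p.2 *
        ((f (x - p.1) - f (x - p.2)) * (g (x - p.1) - g (x - p.2))) := by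
  have hP := (χ.ker n).integrable (μ := volume)
  have h1 := integrable_conv (χ.ker n) hf x
  have h2 := integrable_conv (χ.ker n) hg x
  have h3 : Integrable (fun y ↦ χ.ker n y * (f (x - y) * g (x - y))) volume := by
    have h4 := memLp_schwartz_mul (χ.ker n) (memLp_comp_sub_left hf x)
    refine (integrable_mul_of_L2 h4 (memLp_comp_sub_left hg x)).congr
      (Eventually.of_forall fun y ↦ ?_)
    simp only [mul_assoc]
  have e : ∀ p : E3 × E3, χ.ker n p.1 * χ.ker n p.2 *
        ((f (x - p.1) - f (x - p.2)) * (g (x - p.1) - g (x - p.2))) =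
      ((χ.ker n p.1 * (f (x - p.1) * g (x - p.1))) * χ.ker n p.2 +
        χ.ker n p.1 * (χ.ker n p.2 * (f (x - p.2) * g (x - p.2)))) -
      ((χ.ker n p.1 * f (x - p.1)) * (χ.ker n p.2 * g (x - p.2)) +
        (χ.ker n p.1 * g (x - p.1)) * (χ.ker n p.2 * f (x - p.2))) := fun p ↦ by ring
  simp only [e]
  have k1 : Integrable (fun p : E3 × E3 ↦ (χ.ker n p.1 * (f (x - p.1) * g (x - p.1))) *
      χ.ker n p.2) volume := h3.mul_prod hP
  have k2 : Integrable (fun p : E3 × E3 ↦ χ.ker n p.1 * (χ.ker n p.2 *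
      (f (x - p.2) * g (x - p.2)))) volume := hP.mul_prod h3
  have k3 : Integrable (fun p : E3 × E3 ↦ (χ.ker n p.1 * f (x - p.1)) *
      (χ.ker n p.2 * g (x - p.2))) volume := h1.mul_prod h2
  have k4 : Integrable (fun p : E3 × E3 ↦ (χ.ker n p.1 * g (x - p.1)) *
      (χ.ker n p.2 * f (x - p.2))) volume := h2.mul_prod h1
  have l1 := integral_prod_mul (μ := (volume : Measure E3)) (ν := (volume : Measure E3))
    (fun y ↦ χ.ker n y * (f (x - y) * g (x - y))) (χ.ker n)
  have l2 := integral_prod_mul (μ := (volume : Measure E3)) (ν := (volume : Measure E3))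
    (χ.ker n) (fun y ↦ χ.ker n y * (f (x - y) * g (x - y)))
  have l3 := integral_prod_mul (μ := (volume : Measure E3)) (ν := (volume : Measure E3))
    (fun y ↦ χ.ker n y * f (x - y)) (fun y ↦ χ.ker n y * g (x - y))
  have l4 := integral_prod_mul (μ := (volume : Measure E3)) (ν := (volume : Measure E3))
    (fun y ↦ χ.ker n y * g (x - y)) (fun y ↦ χ.ker n y * f (x - y))
  rw [χ.integral_ker] at l1 l2
  have k12 : Integrable (fun p : E3 × E3 ↦
      (χ.ker n p.1 * (f (x - p.1) * g (x - p.1))) * χ.ker n p.2 +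
        χ.ker n p.1 * (χ.ker n p.2 * (f (x - p.2) * g (x - p.2)))) volume := k1.add k2
  have k34 : Integrable (fun p : E3 × E3 ↦ (χ.ker n p.1 * f (x - p.1)) *
      (χ.ker n p.2 * g (x - p.2)) + (χ.ker n p.1 * g (x - p.1)) * (χ.ker n p.2 * f (x - p.2)))
      volume := k3.add k4
  rw [integral_sub k12 k34, integral_add k1 k2, integral_add k3 k4]
  simp only [Measure.volume_eq_prod, l1, l2, l3, l4, conv]
  ring

/-- The bound for the increments at the scale `2^{-n}`. -/
def IncrBound (n : ℤ) (b : ℝ≥0∞) (g : E3 → ℂ) : Prop :=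
  ∀ y, eLpNorm (dlt y g) 3 volume ≤ b * ENNReal.ofReal (1 + 2 ^ n * ‖y‖)

/-- For a fixed pair of shifts, Hölder's inequality bounds the two increments and `h` in L³; the
shifts are then integrated against the kernels. No separate estimate of f g or its mollification is
needed. -/
theorem lintegral_commutator_mul_le (χ : Cutoff) (n : ℤ) {f g h : E3 → ℂ} {b : ℝ≥0∞}
    (hf : MemLp f 2 volume) (hg : MemLp g 2 volume) (hh : AEStronglyMeasurable h volume)
    (hb : b ≠ ⊤) (hh3 : eLpNorm h 3 volume ≠ ⊤) (bf : IncrBound n b f) (bg : IncrBound n b g) :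
    ∫⁻ x, ‖(∫ y, χ.ker n y * (f (x - y) * g (x - y))) -
        conv (χ.ker n) f x * conv (χ.ker n) g x‖ₑ * ‖h x‖ₑ ≤
      b ^ 2 * kmom (χ.ker 0) ^ 2 * eLpNorm h 3 volume := by
  have meas : ∀ {f : E3 → ℂ}, MemLp f 2 volume → AEStronglyMeasurable
      (fun z : E3 × (E3 × E3) ↦ f (z.1 - z.2.1) - f (z.1 - z.2.2)) (volume.prod volume) := by
    intro f hf
    have q1 : Measure.QuasiMeasurePreserving (fun z : E3 × (E3 × E3) ↦ (z.1, z.2.1))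
        (volume.prod volume) (volume.prod volume) :=
      Measure.quasiMeasurePreserving_fst.comp
        (measurePreserving_prodAssoc volume volume volume).symm.quasiMeasurePreserving
    have q2 : Measure.QuasiMeasurePreserving (fun z : E3 × (E3 × E3) ↦ (z.1, z.2.2))
        (volume.prod volume) (volume.prod volume) :=
      q1.comp ((MeasurePreserving.id volume).prod
        Measure.measurePreserving_swap).quasiMeasurePreserving
    exact ((aestronglyMeasurable_comp_sub hf.1).comp_quasiMeasurePreserving q1).sub
      ((aestronglyMeasurable_comp_sub hf.1).comp_quasiMeasurePreserving q2)
  have hP := (χ.ker n).continuous.enorm.measurable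
  calc _ ≤ ∫⁻ x, ∫⁻ p : E3 × E3, (‖χ.ker n p.1‖ₑ * ‖χ.ker n p.2‖ₑ) *
        (‖f (x - p.1) - f (x - p.2)‖ₑ * ‖g (x - p.1) - g (x - p.2)‖ₑ * ‖h x‖ₑ) := by
        refine lintegral_mono fun x ↦ ?_
        have e1 := two_mul_conv_sub_eq χ n hf hg x
        have e2 := enorm_integral_le_lintegral_enorm (μ := volume) (fun p : E3 × E3 ↦
          χ.ker n p.1 * χ.ker n p.2 * ((f (x - p.1) - f (x - p.2)) * (g (x - p.1) - g (x - p.2))))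
        rw [← e1, enorm_mul] at e2
        have e3 := (le_mul_of_one_le_left' (by simp [enorm_eq_nnnorm] : (1 : ℝ≥0∞) ≤ ‖(2 : ℂ)‖ₑ)).trans e2
        refine (mul_le_mul_left e3 _).trans ?_
        rw [← lintegral_mul_const' _ _ enorm_ne_top]
        simp only [enorm_mul, mul_assoc]
        exact le_rfl
    _ = ∫⁻ p : E3 × E3, ∫⁻ x, (‖χ.ker n p.1‖ₑ * ‖χ.ker n p.2‖ₑ) *
        (‖f (x - p.1) - f (x - p.2)‖ₑ * ‖g (x - p.1) - g (x - p.2)‖ₑ * ‖h x‖ₑ) := by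
        refine lintegral_lintegral_swap ?_
        have m1 : AEMeasurable (fun z : E3 × (E3 × E3) ↦ ‖χ.ker n z.2.1‖ₑ * ‖χ.ker n z.2.2‖ₑ)
          (volume.prod volume) := (by fun_prop : Measurable _).aemeasurable
        exact m1.mul (((meas hf).enorm.mul (meas hg).enorm).mul hh.comp_fst.enorm)
    _ ≤ ∫⁻ p : E3 × E3, (‖χ.ker n p.1‖ₑ * ENNReal.ofReal ((1 + 2 ^ n * ‖p.1‖) ^ 2)) *
          (‖χ.ker n p.2‖ₑ * ENNReal.ofReal ((1 + 2 ^ n * ‖p.2‖) ^ 2)) *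
          (b ^ 2 * eLpNorm h 3 volume) := by
        refine lintegral_mono fun p ↦ ?_
        rw [lintegral_const_mul' _ _ (by finiteness)]
        have tr : ∀ {f : E3 → ℂ}, MemLp f 2 volume → IncrBound n b f →
            AEStronglyMeasurable (fun x ↦ f (x - p.1) - f (x - p.2)) volume ∧
            eLpNorm (fun x ↦ f (x - p.1) - f (x - p.2)) 3 volume ≤
              b * (ENNReal.ofReal (1 + 2 ^ n * ‖p.1‖) * ENNReal.ofReal (1 + 2 ^ n * ‖p.2‖)) := by
          intro f hf bf
          -- This is a translate of the increment by p.2 - p.1, and 1 + λ|p.2 - p.1| ≤ (1 +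
          -- λ|p.1|)(1 + λ|p.2|) with λ = 2^n. The factors from f and g produce the squares in
          -- `kmom`.
          have e : (fun x ↦ f (x - p.1) - f (x - p.2)) = fun x ↦ dlt (p.2 - p.1) f (x - p.1) := by
            ext x; simp [dlt]
          have hm := aestronglyMeasurable_dlt hf.1 (p.2 - p.1)
          rw [e, eLpNorm_comp_sub _ hm]
          refine ⟨hm.comp_measurePreserving (measurePreserving_sub_right volume _),
            (bf _).trans ?_⟩
          rw [← ENNReal.ofReal_mul (by positivity)]
          gcongr
          have h1 := norm_sub_le p.2 p.1
          have h2 : (0 : ℝ) < 2 ^ n := by positivity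
          have h3 : 0 ≤ (2 ^ n * ‖p.1‖) * (2 ^ n * ‖p.2‖) := by positivity
          nlinarith
        obtain ⟨mf, nf⟩ := tr hf bf
        obtain ⟨mg, ng⟩ := tr hg bg
        have := lintegral_enorm_mul_mul_le mf mg hh
        calc _ ≤ ‖χ.ker n p.1‖ₑ * ‖χ.ker n p.2‖ₑ *
              ((b * (ENNReal.ofReal (1 + 2 ^ n * ‖p.1‖) * ENNReal.ofReal (1 + 2 ^ n * ‖p.2‖))) *
              (b * (ENNReal.ofReal (1 + 2 ^ n * ‖p.1‖) * ENNReal.ofReal (1 + 2 ^ n * ‖p.2‖))) *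
              eLpNorm h 3 volume) := by
              gcongr
              exact this.trans (by gcongr)
          _ = _ := by
              rw [ENNReal.ofReal_pow (by positivity), ENNReal.ofReal_pow (by positivity)]
              ring
    _ = _ := by
        have hK := (χ.isDilation_ker n).kmom_le (by positivity)
        rw [enorm_one, one_mul] at hK
        have m : Measurable fun y ↦ ‖χ.ker n y‖ₑ * ENNReal.ofReal ((1 + 2 ^ n * ‖y‖) ^ 2) := by
          fun_prop
        rw [lintegral_mul_const' _ _ (by finiteness), Measure.volume_eq_prod,
          lintegral_prod_mul m.aemeasurable m.aemeasurable, hK]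
        ring

theorem dS_scale (χ : Cutoff) (n : ℤ) (v w : E3) (ξ : E3) :
    dS v (dS w (χ.sym n)) ξ =
      ((2 ^ n : ℝ) ^ 2 : ℝ) * dS v (dS w (χ.sym 0)) (((2 : ℝ) ^ n)⁻¹ • ξ) := by
  simp only [dS_apply, χ.sym_scale n ξ, inner_smul_left]
  have : (2 ^ n : ℝ) ≠ 0 := by positivity
  have h : ((2 ^ n : ℝ) : ℂ) ≠ 0 := by exact_mod_cast this
  simp only [map_inv₀, conj_trivial, Complex.ofReal_mul, Complex.ofReal_inv, Complex.ofReal_pow]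
  field_simp

/-- The symbol vanishes at 0, so the kernel has mean zero and the convolution is a superposition of
increments, to which Minkowski's inequality applies. Rescaling the two derivatives produces (2^n)².
-/
theorem eLpNorm_conv_dS_dS_le (χ : Cutoff) (n : ℤ) (v w : E3) {g : E3 → ℂ} {b : ℝ≥0∞}
    (hg : MemLp g 2 volume) (hb : b ≠ ⊤) (hb0 : b ≠ 0) (bg : IncrBound n b g) :
    eLpNorm (conv (𝓕⁻ (dS v (dS w (χ.sym n))) : 𝓢(E3, ℂ)) g) 3 volume ≤
      ENNReal.ofReal ((2 ^ n) ^ 2) * kmom (𝓕⁻ (dS v (dS w (χ.sym 0)))) * b := by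
  set K : 𝓢(E3, ℂ) := 𝓕⁻ (dS v (dS w (χ.sym n))) with hK
  have hdil : IsDilation (2 ^ n) ((2 ^ n : ℝ) ^ 2 : ℝ) K (𝓕⁻ (dS v (dS w (χ.sym 0)))) :=
    isDilation_fourierInv (by positivity) (dS_scale χ n v w)
  have hKi : ∫ y, K y = 0 := by
    rw [hK, integral_fourierInv, dS_apply]; simp
  have h1 : ∀ x, ‖conv K g x‖ₑ ≤ ∫⁻ y, ‖K y‖ₑ * ‖dlt y g x‖ₑ := by
    intro x
    have e : conv K g x = ∫ y, K y * (-dlt y g x) := by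
      have hi : Integrable (fun y ↦ K y * g x) volume := K.integrable.mul_const _
      simp only [dlt, neg_sub, mul_sub]
      rw [integral_sub (integrable_conv K hg x) hi, integral_mul_const, hKi, zero_mul, sub_zero,
        conv]
    rw [e]
    refine (enorm_integral_le_lintegral_enorm _).trans_eq ?_
    simp only [enorm_mul, enorm_neg]
  have h2 := eLpNorm_three_le_of_superposition (k := fun y ↦ ‖K y‖ₑ) (G := fun x y ↦ dlt y g x)
    (F := conv K g) (B := fun y ↦ b.toNNReal * Real.toNNReal (1 + 2 ^ n * ‖y‖))
    (by fun_prop) (fun y ↦ by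
      refine mul_ne_zero (ENNReal.toNNReal_ne_zero.2 ⟨hb0, hb⟩) ?_
      have : 0 < 1 + 2 ^ n * ‖y‖ := by positivity
      simpa using this) K.continuous.enorm.measurable.aemeasurable
    (hg.1.comp_fst.sub (aestronglyMeasurable_comp_sub hg.1))
    (fun x ↦ aestronglyMeasurable_const.sub (memLp_comp_sub_left hg x).1)
    (fun y ↦ aestronglyMeasurable_dlt hg.1 y)
    (fun y ↦ by
      refine (bg y).trans_eq ?_
      rw [ENNReal.coe_mul, ENNReal.coe_toNNReal hb]; rfl) h1
  refine h2.trans ?_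
  have h3 := hdil.kmom_le (by positivity)
  calc _ ≤ ∫⁻ y, b * (‖K y‖ₑ * ENNReal.ofReal ((1 + 2 ^ n * ‖y‖) ^ 2)) := by
        refine lintegral_mono fun y ↦ ?_
        rw [ENNReal.coe_mul, ENNReal.coe_toNNReal hb, mul_left_comm]
        gcongr
        refine ENNReal.ofReal_le_ofReal ?_
        have : 0 ≤ 2 ^ n * ‖y‖ := by positivity
        nlinarith
    _ = _ := by
        rw [lintegral_const_mul' _ _ hb, h3, ← ofReal_norm, Complex.norm_real,
          Real.norm_of_nonneg (by positivity), mul_comm]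

end

/-! ### The flux bound -/

/-- The sum of the weighted norms of the second derivatives of the kernel. -/
def derivConst (χ : Cutoff) : ℝ≥0∞ :=
  ∑ i : Fin 3, ∑ a : Fin 3, kmom (𝓕⁻ (dS (stdVec a) (dS (stdVec i) (χ.sym 0))))

theorem derivConst_lt_top (χ : Cutoff) : derivConst χ < ⊤ :=
  ENNReal.sum_lt_top.2 fun _ _ ↦ ENNReal.sum_lt_top.2 fun _ _ ↦ kmom_lt_top _

theorem le_derivConst (χ : Cutoff) (i a : Fin 3) :
    kmom (𝓕⁻ (dS (stdVec a) (dS (stdVec i) (χ.sym 0)))) ≤ derivConst χ :=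
  (Finset.single_le_sum (f := fun a ↦ kmom (𝓕⁻ (dS (stdVec a) (dS (stdVec i) (χ.sym 0)))))
    (fun _ _ ↦ zero_le) (Finset.mem_univ a)).trans
  (Finset.single_le_sum (f := fun i ↦ ∑ a, kmom (𝓕⁻ (dS (stdVec a) (dS (stdVec i) (χ.sym 0)))))
    (fun _ _ ↦ zero_le) (Finset.mem_univ i))

section

variable {u : Lp E3 2 (volume : Measure E3)}

theorem eLpNorm_curlConv_dS_le (χ : Cutoff) (n : ℤ) {b : ℝ≥0∞} (hb : b ≠ ⊤) (hb0 : b ≠ 0)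
    (bu : ∀ k, IncrBound n b (cmp u k)) (i j : Fin 3) :
    eLpNorm (curlConv (dS (stdVec i) (χ.sym n)) u j) 3 volume ≤
      2 * (ENNReal.ofReal ((2 ^ n) ^ 2) * derivConst χ * b) := by
  have key : ∀ a b' k l : Fin 3, eLpNorm
      (conv (𝓕⁻ (dS (stdVec a) (dS (stdVec i) (χ.sym n))) : 𝓢(E3, ℂ)) (cmp u k) -
        conv (𝓕⁻ (dS (stdVec b') (dS (stdVec i) (χ.sym n))) : 𝓢(E3, ℂ)) (cmp u l)) 3 volume ≤
      2 * (ENNReal.ofReal ((2 ^ n) ^ 2) * derivConst χ * b) := by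
    intro a b' k l
    refine (eLpNorm_sub_le (memLp_conv _ (memLp_cmp u k)).1 (memLp_conv _ (memLp_cmp u l)).1
      (by norm_num)).trans ?_
    rw [two_mul]
    gcongr
    · refine (eLpNorm_conv_dS_dS_le χ n _ _ (memLp_cmp u k) hb hb0 (bu k)).trans ?_
      gcongr
      exact le_derivConst χ i a
    · refine (eLpNorm_conv_dS_dS_le χ n _ _ (memLp_cmp u l) hb hb0 (bu l)).trans ?_
      gcongr
      exact le_derivConst χ i b'
  fin_cases j
  · exact key 1 2 2 1
  · exact key 2 0 0 2
  · exact key 0 1 1 0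

theorem low_tensorVel_eq (χ : Cutoff) (Q : ℕ) (i j : Fin 3) (x : E3) :
    χ.low Q (tensorVel u i j) x =
      ∫ y, χ.ker (Q + 1) y * (cmp u i (x - y) * cmp u j (x - y)) := by
  rw [Cutoff.low, tensorVel, ← integral_sub_left_eq_self _ volume x]
  refine integral_congr_ae (Eventually.of_forall fun y ↦ ?_)
  simp only [χ.lowKernel_apply, sub_sub_cancel, cmp, Complex.ofReal_mul]
  rfl

/-- Subtracting the vanishing resolved flux replaces S(u_i u_j) by a commutator, quadratic in
increments. The gradient of the mollified vorticity supplies the third increment. The 18 is 9 index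
pairs times the two terms of a curl component. -/
theorem enorm_integral_velFlux_le_of_incr (hu : HHalf u) (hd : IsDivFree u) (χ : Cutoff) (Q : ℕ)
    {b : ℝ≥0∞} (hb : b ≠ ⊤) (bu : ∀ k, IncrBound ((Q : ℤ) + 1) b (cmp u k)) :
    ‖∫ x, velFlux χ Q u x‖ₑ ≤ 18 * kmom (χ.ker 0) ^ 2 * derivConst χ *
      ENNReal.ofReal ((2 ^ ((Q : ℤ) + 1)) ^ 2) * b ^ 3 := by
  set n : ℤ := (Q : ℤ) + 1 with hn
  have hσ : χ.lowSchwartz Q = χ.sym n := rfl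
  have i1 := fun i j ↦ integrable_velFlux_term hu χ Q i j
  have i2 : ∀ i j, Integrable (fun x ↦ conv (𝓕⁻ (χ.sym n) : 𝓢(E3, ℂ)) (cmp u i) x *
      conv (𝓕⁻ (χ.sym n) : 𝓢(E3, ℂ)) (cmp u j) x * curlConv (dS (stdVec i) (χ.sym n)) u j x)
      volume := fun i j ↦ (memL2Linfty_conv _ (memLp_cmp u i)).integrable_mul_mul
    (memL2Linfty_conv _ (memLp_cmp u j)) (hasNiceDeriv_curlConv (χ.sym n) i j).2
  have i3 : ∀ i j, Integrable (fun x ↦ (χ.low Q (tensorVel u i j) x -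
      conv (χ.ker n) (cmp u i) x * conv (χ.ker n) (cmp u j) x) *
      curlConv (dS (stdVec i) (χ.sym n)) u j x) volume := fun i j ↦ by
    refine ((i1 i j).sub (i2 i j)).congr (Eventually.of_forall fun x ↦ ?_)
    simp only [Pi.sub_apply, sub_mul]
    rfl
  have e : ∫ x, velFlux χ Q u x = ∑ i, ∑ j, ∫ x, (χ.low Q (tensorVel u i j) x -
      conv (χ.ker n) (cmp u i) x * conv (χ.ker n) (cmp u j) x) *
      curlConv (dS (stdVec i) (χ.sym n)) u j x := by
    rw [← sub_zero (∫ x, velFlux χ Q u x), ← integral_resolved_flux hd (χ.sym n),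
      ← integral_sub (integrable_velFlux hu χ Q)
        (integrable_finsetSum _ fun i _ ↦ integrable_finsetSum _ fun j _ ↦ i2 i j)]
    have e1 : ∀ i, ∑ j, ∫ x, (χ.low Q (tensorVel u i j) x -
        conv (χ.ker n) (cmp u i) x * conv (χ.ker n) (cmp u j) x) *
        curlConv (dS (stdVec i) (χ.sym n)) u j x = ∫ x, ∑ j, (χ.low Q (tensorVel u i j) x -
        conv (χ.ker n) (cmp u i) x * conv (χ.ker n) (cmp u j) x) *
        curlConv (dS (stdVec i) (χ.sym n)) u j x :=
      fun i ↦ (integral_finsetSum _ fun j _ ↦ i3 i j).symm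
    simp only [e1]
    rw [← integral_finsetSum _ fun i _ ↦ integrable_finsetSum _ fun j _ ↦ i3 i j]
    refine integral_congr_ae (Eventually.of_forall fun x ↦ ?_)
    simp only [velFlux, hσ, ← Finset.sum_sub_distrib, sub_mul]
    rfl
  have key : ∀ i j, ‖∫ x, (χ.low Q (tensorVel u i j) x -
      conv (χ.ker n) (cmp u i) x * conv (χ.ker n) (cmp u j) x) *
      curlConv (dS (stdVec i) (χ.sym n)) u j x‖ₑ ≤ 2 * kmom (χ.ker 0) ^ 2 * derivConst χ *
      ENNReal.ofReal ((2 ^ n) ^ 2) * b ^ 3 := by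
    intro i j
    have h3 := (hasNiceDeriv_curlConv (u := u) (χ.sym n) i j).2
    have hle := lintegral_commutator_mul_le χ n (memLp_cmp u i) (memLp_cmp u j) h3.1.1 hb
      h3.memLp_three.2.ne (bu i) (bu j)
    refine (enorm_integral_le_lintegral_enorm _).trans ?_
    simp only [enorm_mul, low_tensorVel_eq]
    refine hle.trans ?_
    -- The superposition bound divides by its weight, so b = 0 is separate; there the commutator
    -- estimate already vanishes.
    rcases eq_or_ne b 0 with rfl | hb0
    · simp
    · calc _ ≤ b ^ 2 * kmom (χ.ker 0) ^ 2 *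
          (2 * (ENNReal.ofReal ((2 ^ n) ^ 2) * derivConst χ * b)) := by
            gcongr
            exact eLpNorm_curlConv_dS_le χ n hb hb0 bu i j
        _ = _ := by ring
  rw [e]
  refine (enorm_sum_le _ _).trans ?_
  calc _ ≤ ∑ i : Fin 3, ∑ j : Fin 3, 2 * kmom (χ.ker 0) ^ 2 * derivConst χ *
      ENNReal.ofReal ((2 ^ n) ^ 2) * b ^ 3 :=
        Finset.sum_le_sum fun i _ ↦ (enorm_sum_le _ _).trans (Finset.sum_le_sum fun j _ ↦ key i j)
    _ = _ := by
      simp only [Finset.sum_const, Finset.card_univ, Fintype.card_fin, nsmul_eq_mul]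
      push_cast
      ring

/-- The constant in the flux bound. -/
def fluxConst (χ : Cutoff) : ℝ≥0∞ :=
  1 + 18 * kmom (χ.ker 0) ^ 2 * derivConst χ * incrConst χ ^ 3

theorem fluxConst_lt_top (χ : Cutoff) : fluxConst χ < ⊤ := by
  have := kmom_lt_top (χ.ker 0)
  have := derivConst_lt_top χ
  have := incrConst_lt_top χ
  unfold fluxConst
  finiteness

theorem enorm_integral_velFlux_le (hu : HHalf u) (hd : IsDivFree u) (χ : Cutoff) (Q : ℕ)
    {A : ℕ → ℝ≥0∞}
    (hA : ∀ k i, eLpNorm (conv (𝓕⁻ (χ.blk k) : 𝓢(E3, ℂ)) (cmp u i)) 3 volume ≤ A k) :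
    ‖∫ x, velFlux χ Q u x‖ₑ ≤ fluxConst χ *
      (ENNReal.ofReal ((2 ^ ((Q : ℤ) + 1)) ^ 2) * locX (Q + 1) A ^ (3 / 2 : ℝ)) := by
  have h2 : ENNReal.ofReal ((2 ^ ((Q : ℤ) + 1)) ^ 2) ≠ 0 := by
    have : (0 : ℝ) < (2 ^ ((Q : ℤ) + 1)) ^ 2 := by positivity
    exact (ENNReal.ofReal_pos.2 this).ne'
  -- For an infinite sum the bound is trivial provided the constant is not 0, which is the purpose
  -- of the summand 1 in `fluxConst`.
  by_cases hX : locX (Q + 1) A = ⊤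
  · rw [hX, ENNReal.top_rpow_of_pos (by norm_num), ENNReal.mul_top h2, ENNReal.mul_top]
    · exact le_top
    · simp [fluxConst]
  · refine (enorm_integral_velFlux_le_of_incr hu hd χ Q
      (b := incrConst χ * locX (Q + 1) A ^ (1 / 2 : ℝ)) ?_ fun k y ↦ ?_).trans ?_
    · exact ENNReal.mul_ne_top (incrConst_lt_top χ).ne
        (ENNReal.rpow_lt_top_of_nonneg (by norm_num) hX).ne
    · refine (eLpNorm_dlt_le_locX χ (memLp_cmp u k) (fun m ↦ hA m k) (Q + 1) y).trans_eq ?_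
      ring
    · have e : (locX (Q + 1) A ^ (1 / 2 : ℝ)) ^ 3 = locX (Q + 1) A ^ (3 / 2 : ℝ) := by
        rw [← ENNReal.rpow_natCast, ← ENNReal.rpow_mul]; norm_num
      rw [mul_pow, e]
      calc _ = (18 * kmom (χ.ker 0) ^ 2 * derivConst χ * incrConst χ ^ 3) *
          (ENNReal.ofReal ((2 ^ ((Q : ℤ) + 1)) ^ 2) * locX (Q + 1) A ^ (3 / 2 : ℝ)) := by ring
        _ ≤ _ := by
          gcongr
          exact le_add_self

/-! ### Blocks of distributions -/

theorem Cutoff.blockSymbol_eq (χ : Cutoff) (k : ℕ) :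
    (fun ξ : E3 ↦ (χ.blockSymbol ((k : ℤ) - 1) ((2 * Real.pi) • ξ) : ℂ)) = χ.blk k := by
  ext ξ
  cases k with
  | zero =>
    simp [blockSymbol, blk_zero, sym_apply, dilate]
  | succ n =>
    rw [blk_succ, sub_apply, sym_apply, sym_apply, ← Complex.ofReal_sub]
    congr 1
    simp only [blockSymbol, phi, dilate, Nat.cast_add, Nat.cast_one, add_sub_cancel_right,
      Int.natCast_nonneg, if_true, smul_smul]
    rw [zpow_one, zpow_add_one₀ two_ne_zero, mul_inv]
    congr 3
    ring

theorem block_apply (χ : Cutoff) (k : ℕ) (i : Fin 3) (ψ : 𝓢(E3, ℂ)) :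
    (χ.block ((k : ℤ) - 1) (toDist u) ψ) i =
      ∫ x, ψ x * conv (𝓕⁻ (χ.blk k) : 𝓢(E3, ℂ)) (cmp u i) x := by
  rw [Cutoff.block, χ.blockSymbol_eq, fourierMultiplierCLM_apply_apply, toDist_apply, comp_apply,
    ← integral_schwartz_mul_hat (memLp_cmp u i)]
  have h : ψ = 𝓕 (𝓕⁻ ψ) := (FourierTransform.fourier_fourierInv_eq ψ).symm
  conv_rhs => rw [h]
  rw [← integral_schwartz_mul_hat (memLp_conv _ (memLp_cmp u i))]
  refine integral_congr_ae ?_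
  filter_upwards [hat_conv (χ.blk k) (memLp_cmp u i)] with ξ hξ
  rw [hξ, SchwartzMap.smulLeftCLM_apply_apply (χ.blk k).hasTemperateGrowth, smul_eq_mul]
  ring

theorem locallyIntegrable_of_memLp_three {f : E3 → ℂ} (hf : MemLp f 3 volume) :
    LocallyIntegrable f volume := hf.locallyIntegrable (by norm_num)

/-- Any L³ representative of the block agrees almost everywhere with the convolution, by testing, so
the infimum defining `distLpNorm` cannot be smaller. -/
theorem eLpNorm_conv_blk_le (χ : Cutoff) (k : ℕ) (i : Fin 3) :
    eLpNorm (conv (𝓕⁻ (χ.blk k) : 𝓢(E3, ℂ)) (cmp u i)) 3 volume ≤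
      distLpNorm 3 (χ.block ((k : ℤ) - 1) (toDist u)) := by
  refine le_iInf fun g ↦ le_iInf fun hg ↦ ?_
  have hgi : MemLp (fun x ↦ g x i) 3 volume :=
    (EuclideanSpace.proj (𝕜 := ℂ) i : C3 →L[ℂ] ℂ).comp_memLp' (Lp.memLp g)
  have h : conv (𝓕⁻ (χ.blk k) : 𝓢(E3, ℂ)) (cmp u i) =ᵐ[volume] fun x ↦ g x i := by
    refine ae_eq_of_forall_schwartz (memLp_conv _ (memLp_cmp u i)).locInt
      (locallyIntegrable_of_memLp_three hgi) fun ψ ↦ ?_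
    rw [← block_apply, hg, toTemperedDistribution_apply_coord]
  rw [eLpNorm_congr_ae h, Lp.enorm_def]
  exact eLpNorm_mono fun x ↦ PiLp.norm_apply_le (g x) i

theorem distLpNorm_block_lt_top (χ : Cutoff) (k : ℕ) :
    distLpNorm 3 (χ.block ((k : ℤ) - 1) (toDist u)) < ⊤ := by
  have hG : MemLp (fun x ↦ WithLp.toLp 2 (fun i ↦ conv (𝓕⁻ (χ.blk k) : 𝓢(E3, ℂ)) (cmp u i) x) :
      E3 → C3) 3 volume := by
    rw [memLp_piLp_iff]
    exact fun i ↦ memLp_three_conv _ (memLp_cmp u i)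
  have h : χ.block ((k : ℤ) - 1) (toDist u) = (hG.toLp _ : Lp C3 3 (volume : Measure E3)) := by
    ext ψ i
    rw [block_apply, toTemperedDistribution_apply_coord]
    refine integral_congr_ae ?_
    filter_upwards [hG.coeFn_toLp] with x hx
    rw [hx]
  exact (iInf₂_le (hG.toLp _) h).trans_lt enorm_lt_top

/-! ### The localized Besov sum -/

/-- With q = k - 1 the terms agree exactly: λ_(Q+1)^(4/3) min(1, 2^(q-Q))² equals 2^(4/3) T(Q - q)
λ_q^(4/3) in both regimes. The inequality only comes from allowing all integers q. -/
theorem locX_le_locSum (χ : Cutoff) (f : 𝓢'(E3, C3)) (Q : ℕ) :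
    ENNReal.ofReal ((2 ^ ((Q : ℤ) + 1) : ℝ) ^ (4 / 3 : ℝ)) *
      locX (Q + 1) (fun k ↦ distLpNorm 3 (χ.block ((k : ℤ) - 1) f)) ≤
      ENNReal.ofReal (2 ^ (4 / 3 : ℝ)) * locSum χ f Q := by
  have hinj : Function.Injective fun k : ℕ ↦ (k : ℤ) - 1 := fun a b h ↦ by simpa using h
  refine le_trans ?_ (mul_le_mul_right (ENNReal.tsum_comp_le_tsum_of_injective hinj _) _)
  rw [locX, ← ENNReal.tsum_mul_left, ← ENNReal.tsum_mul_left]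
  refine ENNReal.tsum_le_tsum fun k ↦ le_of_eq ?_
  rw [weightedBlock, mul_pow, ← mul_assoc, ← mul_assoc, ← mul_assoc]
  congr 1
  rw [← ENNReal.ofReal_pow (by positivity), ← ENNReal.ofReal_pow (by positivity),
    ← ENNReal.ofReal_mul (by positivity)]
  have hz : ∀ (m : ℤ) (r : ℝ), ((2 : ℝ) ^ m) ^ r = 2 ^ ((m : ℝ) * r) := fun m r ↦ by
    rw [← Real.rpow_intCast, ← Real.rpow_mul zero_le_two]
  have h0 : ∀ r : ℝ, (0 : ℝ) < 2 ^ r := fun r ↦ by positivity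
  rw [locKernel]
  split_ifs with h
  · rw [min_eq_left (one_le_zpow₀ one_le_two (by omega)), ← ENNReal.ofReal_mul (by positivity),
      ← ENNReal.ofReal_mul (by positivity), hz, hz, hz, one_pow, mul_one,
      ← Real.rpow_natCast, ← Real.rpow_mul zero_le_two, ← Real.rpow_add two_pos,
      ← Real.rpow_add two_pos]
    congr 2
    push_cast
    ring
  · rw [min_eq_right (zpow_le_one_of_nonpos₀ one_le_two (by omega)),
      ← ENNReal.ofReal_mul (by positivity), ← ENNReal.ofReal_mul (by positivity), hz, hz, hz,
      ← Real.rpow_intCast, ← Real.rpow_natCast, ← Real.rpow_natCast, ← Real.rpow_mul zero_le_two,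
      ← Real.rpow_mul zero_le_two, ← Real.rpow_add two_pos, ← Real.rpow_add two_pos,
      ← Real.rpow_add two_pos]
    congr 2
    push_cast
    ring

/-- Raising the comparison of sums to the power 3/2 turns 4/3 into 2, which matches the cost λ² of
the two derivatives; 8 is the product of the two halves of the flux with (2^(4/3))^(3/2) = 4. -/
theorem enorm_helicityFlux_le (hu : HHalf u) (hd : IsDivFree u) (χ : Cutoff) (Q : ℕ) :
    ‖helicityFlux χ Q u‖ₑ ≤ 8 * fluxConst χ * locSum χ (toDist u) Q ^ (3 / 2 : ℝ) := by
  have h := enorm_integral_velFlux_le hu hd χ Q (eLpNorm_conv_blk_le (u := u) χ)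
  have h1 := ENNReal.rpow_le_rpow (locX_le_locSum χ (toDist u) Q) (z := 3 / 2) (by norm_num)
  rw [ENNReal.mul_rpow_of_nonneg _ _ (by norm_num), ENNReal.mul_rpow_of_nonneg _ _ (by norm_num),
    ENNReal.ofReal_rpow_of_nonneg (by positivity) (by norm_num),
    ENNReal.ofReal_rpow_of_nonneg (by positivity) (by norm_num), ← Real.rpow_mul (by positivity),
    ← Real.rpow_mul (by positivity), show (4 / 3 * (3 / 2) : ℝ) = (2 : ℕ) by norm_num,
    Real.rpow_natCast, Real.rpow_natCast] at h1
  rw [helicityFlux_eq hu hd, enorm_mul]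
  calc _ ≤ 2 * (fluxConst χ * (ENNReal.ofReal (2 ^ 2) * locSum χ (toDist u) Q ^ (3 / 2 : ℝ))) := by
        gcongr
        · rw [← ofReal_norm, Complex.norm_ofNat, ENNReal.ofReal_ofNat]
        · exact h.trans (mul_le_mul_right h1 _)
    _ = _ := by
        rw [show ENNReal.ofReal (2 ^ 2) = 4 by norm_num]
        ring

/-! ### Summability of the localization kernel and decay of the localized sum -/

theorem tsum_ofReal_geometric_lt_top {r : ℝ} (h1 : r < 1) :
    ∑' m : ℕ, ENNReal.ofReal r ^ m < ⊤ := by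
  rw [ENNReal.tsum_geometric, ENNReal.inv_lt_top, tsub_pos_iff_lt]
  exact ENNReal.ofReal_lt_one.2 h1

theorem tsum_locKernel_lt_top : ∑' m : ℤ, locKernel m < ⊤ := by
  have hz : ∀ (m : ℤ) (r : ℝ), ((2 : ℝ) ^ m) ^ r = 2 ^ ((m : ℝ) * r) := fun m r ↦ by
    rw [← Real.rpow_intCast, ← Real.rpow_mul zero_le_two]
  have h1 : ∀ m : ℕ, locKernel m = ENNReal.ofReal (2 ^ (-(2 / 3) : ℝ)) ^ m := by
    intro m
    rw [← ENNReal.ofReal_pow (by positivity), ← Real.rpow_natCast, ← Real.rpow_mul zero_le_two,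
      locKernel, hz, hz]
    split_ifs with h
    · have : m = 0 := by omega
      simp [this]
    · congr 2
      push_cast; ring
  have h2 : ∀ m : ℕ, locKernel (-(m + 1)) ≤ ENNReal.ofReal (2 ^ (-(4 / 3) : ℝ)) ^ m := by
    intro m
    rw [← ENNReal.ofReal_pow (by positivity), ← Real.rpow_natCast, ← Real.rpow_mul zero_le_two,
      locKernel, if_pos (by omega), hz]
    refine ENNReal.ofReal_le_ofReal (Real.rpow_le_rpow_of_exponent_le one_le_two ?_)
    push_cast
    linarith
  rw [tsum_of_nat_of_neg_add_one ENNReal.summable ENNReal.summable]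
  simp only [h1]
  exact ENNReal.add_lt_top.2 ⟨tsum_ofReal_geometric_lt_top
      (Real.rpow_lt_one_of_one_lt_of_neg one_lt_two (by norm_num)),
    (ENNReal.tsum_le_tsum h2).trans_lt (tsum_ofReal_geometric_lt_top
      (Real.rpow_lt_one_of_one_lt_of_neg one_lt_two (by norm_num)))⟩

theorem locSum_eq (χ : Cutoff) (f : 𝓢'(E3, C3)) (Q : ℕ) :
    locSum χ f Q = ∑' m : ℤ, locKernel m * weightedBlock χ (2 / 3) 3 f (Q - m) ^ 2 := by
  rw [locSum, ← (Equiv.subLeft (Q : ℤ)).tsum_eq]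
  simp

theorem distLpNorm_zero : distLpNorm 3 (0 : 𝓢'(E3, C3)) = 0 := by
  refine le_antisymm ((iInf₂_le (0 : Lp C3 3 (volume : Measure E3)) ?_).trans (by simp)) zero_le
  ext ψ i
  rw [toTemperedDistribution_apply_coord]
  symm
  refine integral_eq_zero_of_ae ?_
  filter_upwards [Lp.coeFn_zero C3 3 (volume : Measure E3)] with x hx
  rw [hx]; simp

theorem weightedBlock_of_lt (χ : Cutoff) (f : 𝓢'(E3, C3)) {q : ℤ} (hq : q < -1) :
    weightedBlock χ (2 / 3) 3 f q = 0 := by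
  have h : χ.block q f = 0 := by
    have e : (fun ξ : E3 ↦ (χ.blockSymbol q ((2 * Real.pi) • ξ) : ℂ)) = fun _ ↦ 0 := by
      ext ξ
      rw [Cutoff.blockSymbol, if_neg (by omega), if_neg (by omega), Complex.ofReal_zero]
    rw [Cutoff.block, e]
    ext ψ
    rw [fourierMultiplierCLM_apply_apply]
    have : SchwartzMap.smulLeftCLM ℂ (fun _ : E3 ↦ (0 : ℂ)) (𝓕⁻ ψ) = 0 := by
      ext ξ
      rw [SchwartzMap.smulLeftCLM_apply_apply (by fun_prop)]
      simp
    rw [this]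
    simp
  rw [weightedBlock, h, distLpNorm_zero, mul_zero]

theorem weightedBlock_le_besovNorm (χ : Cutoff) (f : 𝓢'(E3, C3)) (q : ℤ) :
    weightedBlock χ (2 / 3) 3 f q ≤ besovNorm χ (2 / 3) 3 f := by
  rcases lt_or_ge q (-1) with h | h
  · rw [weightedBlock_of_lt χ f h]; exact zero_le
  rcases eq_or_lt_of_le h with rfl | h
  · refine le_trans ?_ le_self_add
    refine mul_le_of_le_one_left' ?_
    rw [ENNReal.ofReal_le_one]
    exact Real.rpow_le_one (by positivity) (by norm_num) (by norm_num)
  · obtain ⟨m, rfl⟩ := Int.eq_ofNat_of_zero_le (a := q) (by omega)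
    exact (le_iSup (fun q : ℕ ↦ weightedBlock χ (2 / 3) 3 f q) m).trans le_add_self

theorem locSum_le_besovNorm (χ : Cutoff) (f : 𝓢'(E3, C3)) (Q : ℕ) :
    locSum χ f Q ≤ (∑' m : ℤ, locKernel m) * besovNorm χ (2 / 3) 3 f ^ 2 := by
  rw [locSum_eq, ← ENNReal.tsum_mul_right]
  refine ENNReal.tsum_le_tsum fun m ↦ ?_
  gcongr
  exact weightedBlock_le_besovNorm χ f _

theorem weightedBlock_lt_top (χ : Cutoff) (q : ℤ) :
    weightedBlock χ (2 / 3) 3 (toDist u) q < ⊤ := by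
  rcases lt_or_ge q (-1) with h | h
  · rw [weightedBlock_of_lt χ _ h]; exact ENNReal.zero_lt_top
  · obtain ⟨k, hk⟩ := Int.eq_ofNat_of_zero_le (a := q + 1) (by omega)
    have : q = (k : ℤ) - 1 := by omega
    rw [this, weightedBlock]
    exact ENNReal.mul_lt_top ENNReal.ofReal_lt_top (distLpNorm_block_lt_top χ k)

/-- After the change of index m = Q - q, dominated convergence for the counting measure applies: T
is summable, the weighted blocks are bounded, and each shifted block tends to 0. -/
theorem tendsto_locSum (χ : Cutoff) (h : MemBesovC χ (2 / 3) 3 (toDist u)) :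
    Tendsto (fun Q : ℕ ↦ locSum χ (toDist u) Q) atTop (𝓝 0) := by
  set c : ℤ → ℝ≥0∞ := fun q ↦ weightedBlock χ (2 / 3) 3 (toDist u) q with hc
  have hev : ∀ᶠ q : ℕ in atTop, c q ≤ 1 := h.eventually_le_const (by norm_num)
  obtain ⟨N, hN⟩ := eventually_atTop.1 hev
  -- Beyond N the blocks are at most 1; the finitely many others are finite because blocks of an L²
  -- field lie in L³.
  set M : ℝ≥0∞ := 1 + ∑ q ∈ Finset.Icc (-1 : ℤ) N, c q with hM
  have hMt : M < ⊤ := ENNReal.add_lt_top.2 ⟨ENNReal.one_lt_top,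
    ENNReal.sum_lt_top.2 fun q _ ↦ weightedBlock_lt_top χ q⟩
  have hcM : ∀ q, c q ≤ M := by
    intro q
    rcases lt_or_ge q (-1) with h1 | h1
    · rw [hc]; simp only
      rw [weightedBlock_of_lt χ _ h1]; exact zero_le
    · rcases le_or_gt q N with h2 | h2
      · exact (Finset.single_le_sum (f := c) (fun _ _ ↦ zero_le)
          (Finset.mem_Icc.2 ⟨h1, h2⟩)).trans le_add_self
      · obtain ⟨m, rfl⟩ := Int.eq_ofNat_of_zero_le (a := q) (by omega)
        exact (hN m (by omega)).trans le_self_add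
  simp only [locSum_eq]
  simp only [← lintegral_count]
  rw [← lintegral_zero (μ := (Measure.count : Measure ℤ))]
  refine tendsto_lintegral_of_dominated_convergence (fun m ↦ locKernel m * M ^ 2)
    (fun Q ↦ measurable_from_top) (fun Q ↦ Eventually.of_forall fun m ↦ ?_) ?_
    (Eventually.of_forall fun m ↦ ?_)
  · simp only
    gcongr
    exact hcM _
  · rw [lintegral_count, ENNReal.tsum_mul_right]
    exact ENNReal.mul_ne_top tsum_locKernel_lt_top.ne (ENNReal.pow_ne_top hMt.ne)
  · have h1 : Tendsto (fun Q : ℕ ↦ c ((Q : ℤ) - m)) atTop (𝓝 0) := by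
      have ht : Tendsto (fun Q : ℕ ↦ ((Q : ℤ) - m).toNat) atTop atTop := by
        refine tendsto_atTop.2 fun B ↦ ?_
        filter_upwards [eventually_ge_atTop (B + m.natAbs)] with Q hQ
        omega
      refine (h.comp ht).congr' ?_
      filter_upwards [eventually_ge_atTop m.natAbs] with Q hQ
      simp only [Function.comp, hc]
      rw [Int.toNat_of_nonneg (by omega)]
    have hK : locKernel m ≠ ⊤ := by
      rw [locKernel]; split_ifs <;> exact ENNReal.ofReal_ne_top
    have h2 := ENNReal.Tendsto.const_mul (((ENNReal.continuous_pow 2).tendsto 0).comp h1)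
      (Or.inr hK)
    simpa [Function.comp_def] using h2

end

/-! ### Weakly continuous curves in a Hilbert space -/

section

variable {H : Type*} [NormedAddCommGroup H] [InnerProductSpace ℝ H]

theorem Orthonormal.countable' [SecondCountableTopology H] {ι : Type*} {b : ι → H}
    (hb : Orthonormal ℝ b) : Countable ι := by
  have hdisj : Pairwise (Function.onFun Disjoint fun i ↦ Metric.ball (b i) (1 / 2)) := by
    intro i j hij
    refine Metric.ball_disjoint_ball ?_
    have h : ‖b i - b j‖ ^ 2 = 2 := by
      rw [norm_sub_sq_real, hb.1 i, hb.1 j, hb.2 hij]; norm_num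
    rw [dist_eq_norm]
    nlinarith [norm_nonneg (b i - b j)]
  have := Set.PairwiseDisjoint.countable_of_isOpen (s := fun i ↦ Metric.ball (b i) (1 / 2))
    (a := (univ : Set ι)) (fun i _ j _ hij ↦ hdisj hij) (fun i _ ↦ Metric.isOpen_ball)
    (fun i _ ↦ Metric.nonempty_ball.2 (by norm_num))
  exact countable_univ_iff.1 this

/-- Pettis's theorem in a separable Hilbert space: the partial sums in a countable Hilbert basis
have continuous coefficients and converge pointwise. -/
theorem aestronglyMeasurable_of_weakly_continuous [CompleteSpace H] [SecondCountableTopology H]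
    {s : Set ℝ} (hs : MeasurableSet s) {u : ℝ → H}
    (hu : ∀ v, ContinuousOn (fun t ↦ inner ℝ (u t) v) s) :
    AEStronglyMeasurable u (volume.restrict s) := by
  obtain ⟨w, b, -⟩ := exists_hilbertBasis ℝ H
  have : Countable w := Orthonormal.countable' b.orthonormal
  refine aestronglyMeasurable_of_tendsto_ae (u := (atTop : Filter (Finset w)))
    (f := fun F t ↦ ∑ i ∈ F, inner ℝ (u t) (b i) • b i) (fun F ↦ ?_) ?_
  · refine Finset.aestronglyMeasurable_fun_sum _ fun i _ ↦ ?_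
    exact ((hu (b i)).aestronglyMeasurable hs).smul_const _
  · refine Eventually.of_forall fun t ↦ ?_
    have := b.hasSum_repr (u t)
    simp only [b.repr_apply_apply] at this
    simp only [real_inner_comm (b _)]
    exact this

theorem exists_norm_le_of_weakly_continuous [CompleteSpace H] {s : Set ℝ} (hs : IsCompact s)
    {u : ℝ → H} (hu : ∀ v, ContinuousOn (fun t ↦ inner ℝ (u t) v) s) :
    ∃ M, 0 ≤ M ∧ ∀ t ∈ s, ‖u t‖ ≤ M := by
  obtain ⟨C, hC⟩ := banach_steinhaus (g := fun t : s ↦ innerSL ℝ (u t)) fun v ↦ by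
    obtain ⟨C, hC⟩ := (hs.image_of_continuousOn (hu v)).isBounded.exists_norm_le
    exact ⟨C, fun t ↦ hC _ ⟨t, t.2, rfl⟩⟩
  refine ⟨max C 0, le_max_right _ _, fun t ht ↦ ?_⟩
  have := hC ⟨t, ht⟩
  rw [innerSL_apply_norm] at this
  exact this.trans (le_max_left _ _)

theorem tendsto_clm_of_weakly_continuous [CompleteSpace H] {s : Set ℝ} {u : ℝ → H}
    (hu : ∀ v, ContinuousOn (fun t ↦ inner ℝ (u t) v) s) (L : H →L[ℝ] ℝ) :
    ContinuousOn (fun t ↦ L (u t)) s := by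
  have h : ∀ v, L v = inner ℝ v ((InnerProductSpace.toDual ℝ H).symm L) := fun v ↦ by
    rw [real_inner_comm, InnerProductSpace.toDual_symm_apply]
  simp only [h]
  exact hu _

/-! ### Partitions of the time interval and the quadratic identity -/

/-- The left end of the cell of `r` in the uniform partition of `[0,t]` into `n` cells. -/
def cellLeft (t : ℝ) (n : ℕ) (r : ℝ) : ℝ := t * (⌊r * n / t⌋₊ : ℝ) / n

/-- The right end of the cell of `r`. -/
def cellRight (t : ℝ) (n : ℕ) (r : ℝ) : ℝ := t * ((⌊r * n / t⌋₊ : ℝ) + 1) / n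

theorem cell_floor {t : ℝ} (ht : 0 < t) {n : ℕ} (hn : 0 < n) {k : ℕ} {r : ℝ}
    (h : r ∈ Ioo (t * k / n) (t * (k + 1) / n)) : ⌊r * n / t⌋₊ = k := by
  have hn' : (0 : ℝ) < n := by exact_mod_cast hn
  obtain ⟨h1, h2⟩ := h
  rw [div_lt_iff₀ hn'] at h1
  rw [lt_div_iff₀ hn'] at h2
  have hk : (k : ℝ) ≤ r * n / t := by rw [le_div_iff₀ ht]; linarith
  rw [Nat.floor_eq_iff ((Nat.cast_nonneg k).trans hk)]
  refine ⟨hk, ?_⟩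
  rw [div_lt_iff₀ ht]
  linarith

theorem cell_mem {t : ℝ} (ht : 0 < t) {n : ℕ} (hn : 0 < n) {r : ℝ} (hr : r ∈ Ico 0 t) :
    cellLeft t n r ∈ Icc 0 t ∧ cellRight t n r ∈ Icc 0 t ∧ |cellLeft t n r - r| ≤ t / n ∧
      |cellRight t n r - r| ≤ t / n := by
  have hn' : (0 : ℝ) < n := by exact_mod_cast hn
  obtain ⟨h1, h2⟩ := hr
  have h3 : 0 ≤ r * n / t := by positivity
  have f1 := Nat.floor_le h3
  have f2 := Nat.lt_floor_add_one (r * n / t)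
  have f3 : ⌊r * n / t⌋₊ < n := by
    rw [Nat.floor_lt h3, div_lt_iff₀ ht]
    nlinarith
  have f4 : (⌊r * n / t⌋₊ : ℝ) + 1 ≤ n := by exact_mod_cast f3
  rw [le_div_iff₀ ht] at f1
  rw [div_lt_iff₀ ht] at f2
  have e1 : cellLeft t n r ≤ r := by rw [cellLeft, div_le_iff₀ hn']; linarith
  have e2 : r ≤ cellRight t n r := by rw [cellRight, le_div_iff₀ hn']; linarith
  have e3 : cellRight t n r = cellLeft t n r + t / n := by
    rw [cellRight, cellLeft]; ring
  have e4 : 0 ≤ cellLeft t n r := by unfold cellLeft; positivity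
  have e5 : cellRight t n r ≤ t := by
    rw [cellRight, div_le_iff₀ hn']
    nlinarith
  refine ⟨⟨e4, by linarith⟩, ⟨by linarith, e5⟩, ?_, ?_⟩ <;> rw [abs_le] <;> constructor <;> linarith

variable [CompleteSpace H] [SecondCountableTopology H] {τ : ℝ} {u : ℝ → H}
  (hu : ∀ v, ContinuousOn (fun t ↦ inner ℝ (u t) v) (Icc 0 τ))
  (α : H →L[ℝ] H →L[ℝ] ℝ) {G : H → H →L[ℝ] ℝ} (hG : Continuous G) {C : ℝ}
  (hGC : ∀ v, ‖G v‖ ≤ C * ‖v‖ ^ 2)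

include hu hG hGC in
theorem integrableOn_quadratic : IntegrableOn (fun r ↦ G (u r)) (Icc 0 τ) volume ∧
    IntegrableOn (fun r ↦ G (u r) (u r)) (Icc 0 τ) volume := by
  have hm := aestronglyMeasurable_of_weakly_continuous measurableSet_Icc hu
  obtain ⟨M, hM0, hM⟩ := exists_norm_le_of_weakly_continuous isCompact_Icc hu
  have hm2 : AEStronglyMeasurable (fun r ↦ G (u r)) (volume.restrict (Icc 0 τ)) :=
    hG.comp_aestronglyMeasurable hm
  have hm3 : AEStronglyMeasurable (fun r ↦ G (u r) (u r)) (volume.restrict (Icc 0 τ)) := by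
    have hc : Continuous fun v : H ↦ G v v := hG.clm_apply continuous_id
    exact hc.comp_aestronglyMeasurable hm
  have hb2 : ∀ r ∈ Icc 0 τ, ‖G (u r)‖ ≤ |C| * M ^ 2 := fun r hr ↦ by
    refine (hGC _).trans ?_
    have := hM r hr
    gcongr
    exact le_abs_self C
  have hb3 : ∀ r ∈ Icc 0 τ, ‖G (u r) (u r)‖ ≤ |C| * M ^ 2 * M := fun r hr ↦ by
    refine (ContinuousLinearMap.le_opNorm _ _).trans ?_
    exact mul_le_mul (hb2 r hr) (hM r hr) (norm_nonneg _) (by positivity)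
  constructor
  · exact Integrable.of_bound hm2 _ (ae_restrict_of_forall_mem measurableSet_Icc hb2)
  · exact Integrable.of_bound hm3 _ (ae_restrict_of_forall_mem measurableSet_Icc hb3)

include hu hG hGC in
-- Both sides are continuous in the test vector once the time integral is taken in the dual space,
-- so density suffices; subtracting two times gives arbitrary endpoints.
theorem identity_of_dense {D : Set H} (hD : Dense D)
    (hid : ∀ a ∈ D, ∀ t ∈ Icc 0 τ, α (u t) a - α (u 0) a = ∫ r in (0 : ℝ)..t, G (u r) a)
    {s t : ℝ} (hs : s ∈ Icc 0 τ) (ht : t ∈ Icc 0 τ) (a : H) :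
    α (u t) a - α (u s) a = ∫ r in s..t, G (u r) a := by
  have hi := (integrableOn_quadratic hu hG hGC).1
  have h0 : (0 : ℝ) ∈ Icc 0 τ := ⟨le_rfl, hs.1.trans hs.2⟩
  have hint : ∀ {s t : ℝ}, s ∈ Icc 0 τ → t ∈ Icc 0 τ →
      IntervalIntegrable (fun r ↦ G (u r)) volume s t := fun hs ht ↦
    (hi.mono_set (uIcc_subset_Icc hs ht)).intervalIntegrable
  have e : ∀ {s t : ℝ}, s ∈ Icc 0 τ → t ∈ Icc 0 τ → ∀ a,
      ∫ r in s..t, G (u r) a = (∫ r in s..t, G (u r)) a := fun hs ht a ↦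
    (ContinuousLinearMap.intervalIntegral_apply (hint hs ht) a).symm
  have key : ∀ t ∈ Icc 0 τ, ∀ a, α (u t) a - α (u 0) a = (∫ r in (0 : ℝ)..t, G (u r)) a := by
    intro t ht a
    refine congrFun (Continuous.ext_on hD (f := fun a ↦ α (u t) a - α (u 0) a) (by fun_prop)
      (ContinuousLinearMap.continuous _) fun a ha ↦ ?_) a
    simp only
    rw [hid a ha t ht, e h0 ht]
  rw [e hs ht, ← intervalIntegral.integral_interval_sub_left (hint h0 ht) (hint h0 hs),
    sub_apply, ← key t ht, ← key s hs]
  ring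

include hu hG hGC in
-- A weakly continuous curve cannot be inserted as its own time-dependent test vector. By symmetry,
-- α(u',u') - α(u,u) = α(u',u'+u) - α(u,u'+u), and on each cell this tests the linear identity with
-- the fixed vector u' + u. The sum telescopes, and the mesh is then sent to 0.
theorem energy_identity {D : Set H} (hD : Dense D) (hα : ∀ v w, α v w = α w v)
    (hid : ∀ a ∈ D, ∀ t ∈ Icc 0 τ, α (u t) a - α (u 0) a = ∫ r in (0 : ℝ)..t, G (u r) a)
    {t : ℝ} (ht : t ∈ Icc 0 τ) :
    α (u t) (u t) - α (u 0) (u 0) = 2 * ∫ r in (0 : ℝ)..t, G (u r) (u r) := by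
  rcases ht.1.eq_or_lt with rfl | ht0
  · simp
  have hi := (integrableOn_quadratic hu hG hGC).1
  obtain ⟨M, hM0, hM⟩ := exists_norm_le_of_weakly_continuous isCompact_Icc hu
  have hsub : Icc 0 t ⊆ Icc 0 τ := Icc_subset_Icc_right ht.2
  set g : ℕ → ℝ → ℝ := fun n r ↦ G (u r) (u (cellRight t n r) + u (cellLeft t n r)) with hg
  have hp : ∀ {n : ℕ}, 0 < n → ∀ k ≤ n, t * k / n ∈ Icc 0 τ := by
    intro n hn k hk
    have hn' : (0 : ℝ) < n := by exact_mod_cast hn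
    have hk' : (k : ℝ) ≤ n := by exact_mod_cast hk
    refine hsub ⟨by positivity, ?_⟩
    rw [div_le_iff₀ hn']
    gcongr
  have hcell : ∀ {n : ℕ}, 0 < n → ∀ k < n,
      IntervalIntegrable (g n) volume (t * k / n) (t * (k + 1 : ℕ) / n) ∧
      ∫ r in (t * k / n)..(t * (k + 1 : ℕ) / n), g n r =
        α (u (t * (k + 1 : ℕ) / n)) (u (t * (k + 1 : ℕ) / n)) -
          α (u (t * k / n)) (u (t * k / n)) := by
    intro n hn k hk
    have m1 := hp hn k hk.le
    have m2 := hp hn (k + 1) hk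
    have hle : t * k / n ≤ t * (k + 1 : ℕ) / n := by
      gcongr; exact Nat.le_succ k
    -- On an open cell both endpoint functions are constant, so the integrand is a fixed test vector
    -- there; the division points are negligible.
    have hE : EqOn (g n) (fun r ↦ G (u r) (u (t * (k + 1 : ℕ) / n) + u (t * k / n)))
        (Ioo (t * k / n) (t * (k + 1 : ℕ) / n)) := by
      intro r hr
      have := cell_floor ht0 hn (by exact_mod_cast hr)
      simp only [hg, cellRight, cellLeft, this]
      push_cast
      rfl
    have hae : g n =ᵐ[volume.restrict (uIoc (t * k / n) (t * (k + 1 : ℕ) / n))]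
        fun r ↦ G (u r) (u (t * (k + 1 : ℕ) / n) + u (t * k / n)) := by
      rw [uIoc_of_le hle, ← restrict_Ioo_eq_restrict_Ioc]
      exact (ae_restrict_iff' measurableSet_Ioo).2 (Eventually.of_forall hE)
    have hii : IntervalIntegrable
        (fun r ↦ G (u r) (u (t * (k + 1 : ℕ) / n) + u (t * k / n))) volume
        (t * k / n) (t * (k + 1 : ℕ) / n) := by
      refine IntegrableOn.intervalIntegrable ?_
      exact (hi.mono_set (uIcc_subset_Icc m1 m2)).apply_continuousLinearMap _
    refine ⟨hii.congr_ae hae.symm, ?_⟩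
    rw [intervalIntegral.integral_congr_ae_restrict hae, ← identity_of_dense hu α hG hGC hD hid m1 m2,
      map_add, map_add, hα (u (t * k / n)) (u (t * (k + 1 : ℕ) / n))]
    ring
  have hsum : ∀ {n : ℕ}, 0 < n → IntervalIntegrable (g n) volume 0 t ∧
      ∫ r in (0 : ℝ)..t, g n r = α (u t) (u t) - α (u 0) (u 0) := by
    intro n hn
    have hn' : (n : ℝ) ≠ 0 := by exact_mod_cast hn.ne'
    have h1 := intervalIntegral.sum_integral_adjacent_intervals
      (a := fun k : ℕ ↦ t * k / n) (fun k hk ↦ (hcell hn k hk).1)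
    have h2 := IntervalIntegrable.trans_iterate
      (a := fun k : ℕ ↦ t * k / n) (fun k hk ↦ (hcell hn k hk).1)
    simp only [Nat.cast_zero, mul_zero, zero_div, mul_div_cancel_right₀ _ hn'] at h1 h2
    refine ⟨h2, ?_⟩
    rw [← h1, Finset.sum_congr rfl fun k hk ↦ (hcell hn k (Finset.mem_range.1 hk)).2,
      Finset.sum_range_sub (fun k : ℕ ↦ α (u (t * k / n)) (u (t * k / n)))]
    simp [mul_div_cancel_right₀ _ hn']
  have hlim : Tendsto (fun n ↦ ∫ r in (0 : ℝ)..t, g n r) atTop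
      (𝓝 (∫ r in (0 : ℝ)..t, 2 * G (u r) (u r))) := by
    -- At r = t the right cell end would leave [0,t], so this null point is discarded.
    have hIco : ∀ᵐ r ∂volume, r ∈ uIoc 0 t → r ∈ Ico 0 t := by
      filter_upwards [(measure_singleton (μ := (volume : Measure ℝ)) t : _) |> measure_eq_zero_iff_ae_notMem.1] with r hr h
      rw [uIoc_of_le ht0.le] at h
      exact ⟨h.1.le, lt_of_le_of_ne h.2 fun h' ↦ hr (by simp [h'])⟩
    refine intervalIntegral.tendsto_integral_filter_of_dominated_convergence
      (fun _ ↦ |C| * M ^ 2 * (M + M)) ?_ ?_ intervalIntegrable_const ?_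
    · filter_upwards [eventually_gt_atTop 0] with n hn
      exact (intervalIntegrable_iff.1 (hsum hn).1).aestronglyMeasurable
    · filter_upwards [eventually_gt_atTop 0] with n hn
      filter_upwards [hIco] with r hr h
      obtain ⟨c1, c2, -, -⟩ := cell_mem ht0 hn (hr h)
      refine (ContinuousLinearMap.le_opNorm _ _).trans ?_
      refine mul_le_mul ((hGC _).trans ?_) ((norm_add_le _ _).trans ?_) (norm_nonneg _)
        (by positivity)
      · have := hM r (hsub (Ico_subset_Icc_self (hr h)))
        gcongr
        exact le_abs_self C
      · exact add_le_add (hM _ (hsub c2)) (hM _ (hsub c1))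
    -- For fixed r the functional G(u(r)) is fixed while both cell ends tend to r, so weak
    -- continuity suffices for the limit.
    · filter_upwards [hIco] with r hr h
      have hr' := hr h
      have hc := tendsto_clm_of_weakly_continuous hu (G (u r)) r
        (hsub (Ico_subset_Icc_self hr'))
      have h0 : Tendsto (fun n : ℕ ↦ t / n) atTop (𝓝 0) := tendsto_const_div_atTop_nhds_zero_nat t
      have hL : Tendsto (fun n ↦ cellLeft t n r) atTop (𝓝[Icc 0 τ] r) := by
        refine tendsto_nhdsWithin_iff.2 ⟨?_, ?_⟩
        · rw [tendsto_iff_dist_tendsto_zero]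
          refine squeeze_zero' (Eventually.of_forall fun _ ↦ dist_nonneg) ?_ h0
          filter_upwards [eventually_gt_atTop 0] with n hn
          exact (cell_mem ht0 hn hr').2.2.1
        · filter_upwards [eventually_gt_atTop 0] with n hn
          exact hsub (cell_mem ht0 hn hr').1
      have hR : Tendsto (fun n ↦ cellRight t n r) atTop (𝓝[Icc 0 τ] r) := by
        refine tendsto_nhdsWithin_iff.2 ⟨?_, ?_⟩
        · rw [tendsto_iff_dist_tendsto_zero]
          refine squeeze_zero' (Eventually.of_forall fun _ ↦ dist_nonneg) ?_ h0
          filter_upwards [eventually_gt_atTop 0] with n hn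
          exact (cell_mem ht0 hn hr').2.2.2
        · filter_upwards [eventually_gt_atTop 0] with n hn
          exact hsub (cell_mem ht0 hn hr').2.1
      have := (hc.tendsto.comp hR).add (hc.tendsto.comp hL)
      rw [two_mul]
      refine this.congr fun n ↦ ?_
      simp [hg]
  have hconst : Tendsto (fun n ↦ ∫ r in (0 : ℝ)..t, g n r) atTop
      (𝓝 (α (u t) (u t) - α (u 0) (u 0))) := by
    refine tendsto_const_nhds.congr' ?_
    filter_upwards [eventually_gt_atTop 0] with n hn
    exact (hsum hn).2.symm
  rw [tendsto_nhds_unique hconst hlim, intervalIntegral.integral_const_mul]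

end

/-! ### The mollified helicity form and its rate of change -/

theorem integrable_norm_mul_norm {f g : E3 → ℂ} (hf : MemLp f 2 volume) (hg : MemLp g 2 volume) :
    Integrable (fun x ↦ ‖f x‖ * ‖g x‖) volume := by
  have := (integrable_mul_of_L2 hf hg).norm
  simpa only [norm_mul] using this

theorem integral_norm_mul_norm_le {f g : E3 → ℂ} (hf : MemLp f 2 volume) (hg : MemLp g 2 volume) :
    ∫ x, ‖f x‖ * ‖g x‖ ≤ (eLpNorm f 2 volume).toReal * (eLpNorm g 2 volume).toReal := by
  have h := eLpNorm_smul_le_mul_eLpNorm (p := 2) (q := 2) (r := 1) hg.1 hf.1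
  have e : ∫ x, ‖f x‖ * ‖g x‖ = (eLpNorm (f • g) 1 volume).toReal := by
    rw [eLpNorm_one_eq_lintegral_enorm, ← integral_norm_eq_lintegral_enorm (hf.1.smul hg.1)]
    simp
  rw [e, ← ENNReal.toReal_mul]
  exact ENNReal.toReal_mono (ENNReal.mul_lt_top hf.2 hg.2).ne h

section

variable {f g : E3 → ℂ}

theorem conv_add_right (σ : 𝓢(E3, ℂ)) (hf : MemLp f 2 volume) (hg : MemLp g 2 volume) :
    conv σ (f + g) = conv σ f + conv σ g := by
  ext x
  rw [Pi.add_apply, conv, conv, conv, ← integral_add (integrable_conv σ hf x)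
    (integrable_conv σ hg x)]
  exact integral_congr_ae (Eventually.of_forall fun y ↦ mul_add _ _ _)

theorem conv_smul_right (σ : 𝓢(E3, ℂ)) (c : ℂ) : conv σ (c • f) = c • conv σ f := by
  ext x
  rw [Pi.smul_apply, conv, conv, smul_eq_mul, ← integral_const_mul]
  exact integral_congr_ae (Eventually.of_forall fun y ↦ by simp; ring)

theorem norm_conv_apply_le (σ : 𝓢(E3, ℂ)) (hf : MemLp f 2 volume) (x : E3) :
    ‖conv σ f x‖ ≤ (eLpNorm σ 2 volume).toReal * (eLpNorm f 2 volume).toReal := by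
  have h := memLp_comp_sub_left hf x
  have e : eLpNorm (fun y ↦ f (x - y)) 2 volume = eLpNorm f 2 volume :=
    eLpNorm_comp_measurePreserving hf.1 (Measure.measurePreserving_sub_left volume x)
  rw [← e]
  refine (norm_integral_le_integral_norm _).trans ?_
  simp only [norm_mul]
  exact integral_norm_mul_norm_le (memLp_schwartz σ 2) h

theorem toReal_eLpNorm_conv_le (σ : 𝓢(E3, ℂ)) (hf : MemLp f 2 volume) :
    (eLpNorm (conv σ f) 2 volume).toReal ≤
      (∫⁻ y, ‖σ y‖ₑ).toReal * (eLpNorm f 2 volume).toReal := by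
  have h := eLpNorm_conv_le (p := 2) (by norm_num) σ.integrable hf.1
  simp only [ENNReal.ofReal_ofNat] at h
  rw [← ENNReal.toReal_mul]
  exact ENNReal.toReal_mono (ENNReal.mul_lt_top (hasFiniteIntegral_iff_enorm.1 σ.integrable.2) hf.2).ne h

end

section

variable (u v : Lp E3 2 (volume : Measure E3))

theorem cmp_add (i : Fin 3) : cmp (u + v) i =ᵐ[volume] cmp u i + cmp v i := by
  filter_upwards [Lp.coeFn_add u v] with x hx
  simp only [cmp, Pi.add_apply, hx]
  simp

theorem cmp_smul (c : ℝ) (i : Fin 3) : cmp (c • u) i =ᵐ[volume] (c : ℂ) • cmp u i := by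
  filter_upwards [Lp.coeFn_smul c u] with x hx
  simp [cmp, hx]

theorem toReal_eLpNorm_cmp_le (i : Fin 3) : (eLpNorm (cmp u i) 2 volume).toReal ≤ ‖u‖ := by
  rw [Lp.norm_def]
  refine ENNReal.toReal_mono (Lp.memLp u).2.ne (eLpNorm_mono_enorm fun x ↦ ?_)
  rw [cmp, enorm_le_iff_norm_le, Complex.norm_real]
  exact PiLp.norm_apply_le _ _

theorem curlConv_add (σ : 𝓢(E3, ℂ)) (j : Fin 3) :
    curlConv σ (u + v) j = curlConv σ u j + curlConv σ v j := by
  have h : ∀ (τ : 𝓢(E3, ℂ)) i, conv τ (cmp (u + v) i) = conv τ (cmp u i) + conv τ (cmp v i) :=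
    fun τ i ↦ by
      rw [conv_congr_right _ (cmp_add u v i), conv_add_right _ (memLp_cmp u i) (memLp_cmp v i)]
  fin_cases j <;> simp only [curlConv, Fin.zero_eta, Fin.mk_one, Fin.reduceFinMk, Matrix.cons_val,
    Matrix.cons_val_zero, Matrix.cons_val_one, h] <;> ring

theorem curlConv_smul (σ : 𝓢(E3, ℂ)) (c : ℝ) (j : Fin 3) :
    curlConv σ (c • u) j = (c : ℂ) • curlConv σ u j := by
  have h : ∀ (τ : 𝓢(E3, ℂ)) i, conv τ (cmp (c • u) i) = (c : ℂ) • conv τ (cmp u i) :=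
    fun τ i ↦ by rw [conv_congr_right _ (cmp_smul u c i), conv_smul_right]
  fin_cases j <;> simp only [curlConv, Fin.zero_eta, Fin.mk_one, Fin.reduceFinMk, Matrix.cons_val,
    Matrix.cons_val_zero, Matrix.cons_val_one, h] <;> rw [smul_sub]

variable {u v}

/-- A bound of `curlConv σ` as a map from `L²` to `L²` and to `L^∞`. -/
theorem exists_curlConv_bound (σ : 𝓢(E3, ℂ)) : ∃ C : ℝ, 0 ≤ C ∧
    ∀ (a : Lp E3 2 (volume : Measure E3)) j,
      (∀ x, ‖curlConv σ a j x‖ ≤ C * ‖a‖) ∧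
        (eLpNorm (curlConv σ a j) 2 volume).toReal ≤ C * ‖a‖ := by
  set k : Fin 3 → 𝓢(E3, ℂ) := fun i ↦ 𝓕⁻ (dS (stdVec i) σ) with hk
  set c : Fin 3 → ℝ := fun i ↦ (eLpNorm (k i) 2 volume).toReal + (∫⁻ y, ‖k i y‖ₑ).toReal with hc
  have c0 : ∀ i, 0 ≤ c i := fun i ↦ by positivity
  have h1 : ∀ i l (a : Lp E3 2 (volume : Measure E3)) x, ‖conv (k i) (cmp a l) x‖ ≤ c i * ‖a‖ := by
    intro i l a x
    refine (norm_conv_apply_le _ (memLp_cmp a l) x).trans ?_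
    have := toReal_eLpNorm_cmp_le a l
    gcongr
    exact le_add_of_nonneg_right (by positivity)
  have h2 : ∀ i l (a : Lp E3 2 (volume : Measure E3)),
      (eLpNorm (conv (k i) (cmp a l)) 2 volume).toReal ≤ c i * ‖a‖ := by
    intro i l a
    refine (toReal_eLpNorm_conv_le _ (memLp_cmp a l)).trans ?_
    have := toReal_eLpNorm_cmp_le a l
    gcongr
    exact le_add_of_nonneg_left (by positivity)
  have m : ∀ i l (a : Lp E3 2 (volume : Measure E3)), MemLp (conv (k i) (cmp a l)) 2 volume :=
    fun i l a ↦ memLp_conv _ (memLp_cmp a l)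
  have key : ∀ i l i' l' (a : Lp E3 2 (volume : Measure E3)),
      (∀ x, ‖(conv (k i) (cmp a l) - conv (k i') (cmp a l')) x‖ ≤ (∑ i, 2 * c i) * ‖a‖) ∧
      (eLpNorm (conv (k i) (cmp a l) - conv (k i') (cmp a l')) 2 volume).toReal ≤
        (∑ i, 2 * c i) * ‖a‖ := by
    intro i l i' l' a
    have hs : ∀ i, 2 * c i ≤ ∑ i, 2 * c i := fun i ↦
      Finset.single_le_sum (f := fun i ↦ 2 * c i) (fun i _ ↦ mul_nonneg zero_le_two (c0 i))
        (Finset.mem_univ i)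
    have hle : c i * ‖a‖ + c i' * ‖a‖ ≤ (∑ i, 2 * c i) * ‖a‖ := by
      rw [← add_mul]
      have := hs i
      have := hs i'
      gcongr
      linarith
    refine ⟨fun x ↦ ?_, ?_⟩
    · exact (norm_sub_le _ _).trans ((add_le_add (h1 i l a x) (h1 i' l' a x)).trans hle)
    · refine (ENNReal.toReal_mono (ENNReal.add_lt_top.2 ⟨(m i l a).2, (m i' l' a).2⟩).ne
        (eLpNorm_sub_le (m i l a).1 (m i' l' a).1 (by norm_num))).trans ?_
      rw [ENNReal.toReal_add (m i l a).2.ne (m i' l' a).2.ne]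
      exact (add_le_add (h2 i l a) (h2 i' l' a)).trans hle
  refine ⟨∑ i, 2 * c i, Finset.sum_nonneg fun i _ ↦ mul_nonneg zero_le_two (c0 i), fun a j ↦ ?_⟩
  fin_cases j
  exacts [key 1 2 2 1 a, key 2 0 0 2 a, key 0 1 1 0 a]

end

/-- The rate is quadratic in the solution and linear in the test vector. Its norm continuity, from
bilinear boundedness, supplies the measurability of its values along a weakly continuous curve. -/
theorem exists_quadratic_clm {H : Type*} [NormedAddCommGroup H] [NormedSpace ℝ H] {C : ℝ}
    (hC0 : 0 ≤ C) (t : H → H → H → ℝ) (hb : ∀ u v a, ‖t u v a‖ ≤ C * ‖u‖ * ‖v‖ * ‖a‖)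
    (add₁ : ∀ u v b a, t (u + v) b a = t u b a + t v b a)
    (smul₁ : ∀ (c : ℝ) u v a, t (c • u) v a = c * t u v a)
    (add₂ : ∀ b u v a, t b (u + v) a = t b u a + t b v a)
    (smul₂ : ∀ (c : ℝ) u v a, t u (c • v) a = c * t u v a)
    (add₃ : ∀ u v a b, t u v (a + b) = t u v a + t u v b)
    (smul₃ : ∀ (c : ℝ) u v a, t u v (c • a) = c * t u v a) :
    ∃ G : H → H →L[ℝ] ℝ, Continuous G ∧ (∃ C, ∀ v, ‖G v‖ ≤ C * ‖v‖ ^ 2) ∧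
      ∀ u a, G u a = t u u a := by
  set T : H → H → H →L[ℝ] ℝ := fun u v ↦ LinearMap.mkContinuous
    { toFun := t u v, map_add' := add₃ u v, map_smul' := fun c a ↦ smul₃ c u v a }
    (C * ‖u‖ * ‖v‖) (hb u v) with hT
  have hTa : ∀ u v a, T u v a = t u v a := fun u v a ↦ rfl
  have hTn : ∀ u v, ‖T u v‖ ≤ C * ‖u‖ * ‖v‖ := fun u v ↦
    LinearMap.mkContinuous_norm_le _ (by positivity) _
  have hB : IsBoundedBilinearMap ℝ fun p : H × H ↦ T p.1 p.2 :=
    { add_left := fun u v b ↦ by ext a; simp only [hTa, add_apply, add₁]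
      smul_left := fun c u v ↦ by ext a; simp only [hTa, smul_apply, smul₁, smul_eq_mul]
      add_right := fun b u v ↦ by ext a; simp only [hTa, add_apply, add₂]
      smul_right := fun c u v ↦ by ext a; simp only [hTa, smul_apply, smul₂, smul_eq_mul]
      bound := ⟨C + 1, by positivity, fun u v ↦ (hTn u v).trans (by gcongr; linarith)⟩ }
  refine ⟨fun u ↦ T u u, ?_, ⟨C, fun v ↦ ?_⟩, fun u a ↦ rfl⟩
  · exact hB.continuous.comp (continuous_id.prodMk continuous_id)
  · refine (hTn v v).trans (le_of_eq ?_)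
    ring

section

variable (σ : 𝓢(E3, ℂ)) (u v a b : Lp E3 2 (volume : Measure E3))

/-- The mollified helicity form. -/
def helForm : ℂ := ∑ j, ∫ x, cmp u j x * curlConv σ a j x

/-- The rate of change of the mollified helicity form along the Euler flow. -/
def rateForm : ℂ :=
  ∑ i, ∑ j, ∫ x, cmp u i x * cmp v j x * curlConv (dS (stdVec i) σ) a j x

variable {σ u v a b}

theorem integrable_cmp_mul_curlConv (j : Fin 3) :
    Integrable (fun x ↦ cmp u j x * curlConv σ a j x) volume :=
  integrable_mul_of_L2 (memLp_cmp u j) (memLp_curlConv σ j)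

theorem integrable_cmp_mul_cmp_mul_curlConv (i j k : Fin 3) :
    Integrable (fun x ↦ cmp u i x * cmp v j x * curlConv σ a k x) volume := by
  have h1 : Integrable (fun x ↦ cmp u i x * cmp v j x) volume :=
    integrable_mul_of_L2 (memLp_cmp u i) (memLp_cmp v j)
  obtain ⟨C, -, hC⟩ := exists_curlConv_bound σ
  exact h1.mul_bdd (memLp_curlConv σ k).1 (Eventually.of_forall (hC a k).1)

theorem helForm_add_left : helForm σ (u + v) a = helForm σ u a + helForm σ v a := by
  simp only [helForm, ← Finset.sum_add_distrib]
  refine Finset.sum_congr rfl fun j _ ↦ ?_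
  rw [← integral_add (integrable_cmp_mul_curlConv j) (integrable_cmp_mul_curlConv j)]
  refine integral_congr_ae ?_
  filter_upwards [cmp_add u v j] with x hx
  rw [hx, Pi.add_apply, add_mul]

theorem helForm_smul_left (c : ℝ) : helForm σ (c • u) a = c * helForm σ u a := by
  simp only [helForm, Finset.mul_sum, ← integral_const_mul]
  refine Finset.sum_congr rfl fun j _ ↦ integral_congr_ae ?_
  filter_upwards [cmp_smul u c j] with x hx
  rw [hx, Pi.smul_apply, smul_eq_mul, mul_assoc]

theorem helForm_add_right : helForm σ u (a + b) = helForm σ u a + helForm σ u b := by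
  simp only [helForm, ← Finset.sum_add_distrib]
  refine Finset.sum_congr rfl fun j _ ↦ ?_
  rw [← integral_add (integrable_cmp_mul_curlConv j) (integrable_cmp_mul_curlConv j)]
  simp only [curlConv_add, Pi.add_apply, mul_add]

theorem helForm_smul_right (c : ℝ) : helForm σ u (c • a) = c * helForm σ u a := by
  simp only [helForm, Finset.mul_sum, ← integral_const_mul]
  refine Finset.sum_congr rfl fun j _ ↦ integral_congr_ae (Eventually.of_forall fun x ↦ ?_)
  simp only [curlConv_smul, Pi.smul_apply, smul_eq_mul]
  ring

theorem rateForm_add_left : rateForm σ (u + v) b a = rateForm σ u b a + rateForm σ v b a := by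
  simp only [rateForm, ← Finset.sum_add_distrib]
  refine Finset.sum_congr rfl fun i _ ↦ Finset.sum_congr rfl fun j _ ↦ ?_
  rw [← integral_add (integrable_cmp_mul_cmp_mul_curlConv i j j)
    (integrable_cmp_mul_cmp_mul_curlConv i j j)]
  refine integral_congr_ae ?_
  filter_upwards [cmp_add u v i] with x hx
  rw [hx, Pi.add_apply, add_mul, add_mul]

theorem rateForm_smul_left (c : ℝ) : rateForm σ (c • u) v a = c * rateForm σ u v a := by
  simp only [rateForm, Finset.mul_sum, ← integral_const_mul]
  refine Finset.sum_congr rfl fun i _ ↦ Finset.sum_congr rfl fun j _ ↦ integral_congr_ae ?_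
  filter_upwards [cmp_smul u c i] with x hx
  rw [hx, Pi.smul_apply, smul_eq_mul]
  ring

theorem rateForm_add_middle : rateForm σ b (u + v) a = rateForm σ b u a + rateForm σ b v a := by
  simp only [rateForm, ← Finset.sum_add_distrib]
  refine Finset.sum_congr rfl fun i _ ↦ Finset.sum_congr rfl fun j _ ↦ ?_
  rw [← integral_add (integrable_cmp_mul_cmp_mul_curlConv i j j)
    (integrable_cmp_mul_cmp_mul_curlConv i j j)]
  refine integral_congr_ae ?_
  filter_upwards [cmp_add u v j] with x hx
  rw [hx, Pi.add_apply, mul_add, add_mul]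

theorem rateForm_smul_middle (c : ℝ) : rateForm σ u (c • v) a = c * rateForm σ u v a := by
  simp only [rateForm, Finset.mul_sum, ← integral_const_mul]
  refine Finset.sum_congr rfl fun i _ ↦ Finset.sum_congr rfl fun j _ ↦ integral_congr_ae ?_
  filter_upwards [cmp_smul v c j] with x hx
  rw [hx, Pi.smul_apply, smul_eq_mul]
  ring

theorem rateForm_add_right : rateForm σ u v (a + b) = rateForm σ u v a + rateForm σ u v b := by
  simp only [rateForm, ← Finset.sum_add_distrib]
  refine Finset.sum_congr rfl fun i _ ↦ Finset.sum_congr rfl fun j _ ↦ ?_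
  rw [← integral_add (integrable_cmp_mul_cmp_mul_curlConv i j j)
    (integrable_cmp_mul_cmp_mul_curlConv i j j)]
  simp only [curlConv_add, Pi.add_apply, mul_add]

theorem rateForm_smul_right (c : ℝ) : rateForm σ u v (c • a) = c * rateForm σ u v a := by
  simp only [rateForm, Finset.mul_sum, ← integral_const_mul]
  refine Finset.sum_congr rfl fun i _ ↦ Finset.sum_congr rfl fun j _ ↦
    integral_congr_ae (Eventually.of_forall fun x ↦ ?_)
  simp only [curlConv_smul, Pi.smul_apply, smul_eq_mul]
  ring

theorem exists_norm_helForm_le (σ : 𝓢(E3, ℂ)) : ∃ C : ℝ, 0 ≤ C ∧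
    ∀ u a, ‖helForm σ u a‖ ≤ C * ‖u‖ * ‖a‖ := by
  obtain ⟨C, hC0, hC⟩ := exists_curlConv_bound σ
  refine ⟨3 * C, by positivity, fun u a ↦ ?_⟩
  have : ∀ j ∈ (Finset.univ : Finset (Fin 3)),
      ‖∫ x, cmp u j x * curlConv σ a j x‖ ≤ ‖u‖ * (C * ‖a‖) := fun j _ ↦ by
    refine (norm_integral_le_integral_norm _).trans ?_
    simp only [norm_mul]
    refine (integral_norm_mul_norm_le (memLp_cmp u j) (memLp_curlConv σ j)).trans ?_
    exact mul_le_mul (toReal_eLpNorm_cmp_le u j) (hC a j).2 (by positivity) (norm_nonneg _)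
  refine (norm_sum_le_of_le _ this).trans (le_of_eq ?_)
  simp
  ring

theorem exists_norm_rateForm_le (σ : 𝓢(E3, ℂ)) : ∃ C : ℝ, 0 ≤ C ∧
    ∀ u v a, ‖rateForm σ u v a‖ ≤ C * ‖u‖ * ‖v‖ * ‖a‖ := by
  choose C hC0 hC using fun i : Fin 3 ↦ exists_curlConv_bound (dS (stdVec i) σ)
  refine ⟨∑ i, ∑ _j : Fin 3, C i, Finset.sum_nonneg fun i _ ↦ Finset.sum_nonneg fun j _ ↦ hC0 i,
    fun u v a ↦ ?_⟩
  have : ∀ i j, ‖∫ x, cmp u i x * cmp v j x * curlConv (dS (stdVec i) σ) a j x‖ ≤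
      C i * ‖u‖ * ‖v‖ * ‖a‖ := fun i j ↦ by
    refine (norm_integral_le_integral_norm _).trans ?_
    have hle : ∀ x, ‖cmp u i x * cmp v j x * curlConv (dS (stdVec i) σ) a j x‖ ≤
        ‖cmp u i x‖ * ‖cmp v j x‖ * (C i * ‖a‖) := fun x ↦ by
      rw [norm_mul, norm_mul]
      exact mul_le_mul_of_nonneg_left ((hC i a j).1 x) (by positivity)
    refine (integral_mono (integrable_cmp_mul_cmp_mul_curlConv i j j).norm
      ((integrable_norm_mul_norm (memLp_cmp u i) (memLp_cmp v j)).mul_const _) hle).trans ?_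
    rw [integral_mul_const]
    have h1 := integral_norm_mul_norm_le (memLp_cmp u i) (memLp_cmp v j)
    have h2 := mul_le_mul (toReal_eLpNorm_cmp_le u i) (toReal_eLpNorm_cmp_le v j) (by positivity)
      (norm_nonneg _)
    have h3 := mul_le_mul_of_nonneg_right (h1.trans h2)
      (mul_nonneg (hC0 i) (norm_nonneg a))
    linarith
  rw [rateForm]
  refine (norm_sum_le_of_le _ fun i _ ↦ norm_sum_le_of_le _ fun j _ ↦ this i j).trans
    (le_of_eq ?_)
  simp only [Finset.sum_mul]

/-- A real-linear functional of the mollified helicity form, as a continuous bilinear form. -/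
theorem exists_helForm_clm (σ : 𝓢(E3, ℂ)) (θ : ℂ →L[ℝ] ℝ) :
    ∃ α : Lp E3 2 (volume : Measure E3) →L[ℝ] Lp E3 2 (volume : Measure E3) →L[ℝ] ℝ,
      ∀ u a, α u a = θ (helForm σ u a) := by
  obtain ⟨C, hC0, hC⟩ := exists_norm_helForm_le σ
  have hs : ∀ (c : ℝ) z, θ (c * z) = c • θ z := fun c z ↦ by
    rw [← map_smul, Complex.real_smul]
  refine ⟨LinearMap.mkContinuous₂ (LinearMap.mk₂ ℝ (fun u a ↦ θ (helForm σ u a))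
    (fun u v a ↦ by rw [helForm_add_left, map_add])
    (fun c u a ↦ by rw [helForm_smul_left, hs])
    (fun u a b ↦ by rw [helForm_add_right, map_add])
    (fun c u a ↦ by rw [helForm_smul_right, hs])) (‖θ‖ * C) fun u a ↦ ?_, fun u a ↦ rfl⟩
  refine (θ.le_opNorm _).trans ?_
  rw [mul_assoc, mul_assoc, ← mul_assoc C]
  exact mul_le_mul_of_nonneg_left (hC u a) (norm_nonneg _)

/-- A real-linear functional of the rate of change, as a continuous map into the dual. -/
theorem exists_rateForm_clm (σ : 𝓢(E3, ℂ)) (θ : ℂ →L[ℝ] ℝ) :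
    ∃ G : Lp E3 2 (volume : Measure E3) → Lp E3 2 (volume : Measure E3) →L[ℝ] ℝ,
      Continuous G ∧ (∃ C, ∀ v, ‖G v‖ ≤ C * ‖v‖ ^ 2) ∧ ∀ u a, G u a = θ (rateForm σ u u a) := by
  obtain ⟨C, hC0, hC⟩ := exists_norm_rateForm_le σ
  have hs : ∀ (c : ℝ) z, θ (c * z) = c * θ z := fun c z ↦ by
    rw [← smul_eq_mul c, ← map_smul, Complex.real_smul]
  refine exists_quadratic_clm (C := ‖θ‖ * C) (by positivity) (fun u v a ↦ θ (rateForm σ u v a))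
    (fun u v a ↦ ?_) (fun u v b a ↦ by rw [rateForm_add_left, map_add])
    (fun c u v a ↦ by rw [rateForm_smul_left, hs])
    (fun u v b a ↦ by rw [rateForm_add_middle, map_add])
    (fun c u v a ↦ by rw [rateForm_smul_middle, hs])
    (fun u v b a ↦ by rw [rateForm_add_right, map_add])
    (fun c u v a ↦ by rw [rateForm_smul_right, hs])
  refine (θ.le_opNorm _).trans ?_
  have := mul_le_mul_of_nonneg_left (hC u v a) (norm_nonneg θ)
  linarith

theorem integral_mul_conv_dS (hσ : ∀ ξ, σ (-ξ) = σ ξ) (e : E3) {f g : E3 → ℂ}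
    (hf : MemLp f 2 volume) (hg : MemLp g 2 volume) :
    ∫ x, f x * conv (𝓕⁻ (dS e σ) : 𝓢(E3, ℂ)) g x =
      -∫ x, g x * conv (𝓕⁻ (dS e σ) : 𝓢(E3, ℂ)) f x := by
  have e1 : (𝓕⁻ (-dS e σ) : 𝓢(E3, ℂ)) = -𝓕⁻ (dS e σ) :=
    FourierTransform.fourierInv_neg _
  have e2 : conv (𝓕⁻ (-dS e σ) : 𝓢(E3, ℂ)) g = -conv (𝓕⁻ (dS e σ) : 𝓢(E3, ℂ)) g := by
    ext x
    rw [e1, Pi.neg_apply, conv, conv, ← integral_neg]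
    exact integral_congr_ae (Eventually.of_forall fun y ↦ by simp)
  have := integral_conv_mul (dS e σ) (-dS e σ) hf hg fun ξ ↦ by
    rw [neg_apply, dS_apply, dS_apply, hσ, inner_neg_left]; push_cast; ring
  simp only [e2, Pi.neg_apply, mul_neg, integral_neg] at this
  rw [← neg_eq_iff_eq_neg, ← this]
  exact integral_congr_ae (Eventually.of_forall fun y ↦ mul_comm _ _)

/-- Curl is symmetric: for an even symbol each mollified derivative is antisymmetric, and so is the
index permutation in the curl. -/
theorem helForm_comm (hσ : ∀ ξ, σ (-ξ) = σ ξ) : helForm σ u a = helForm σ a u := by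
  have I : ∀ (v w : Lp E3 2 (volume : Measure E3)) j k l, Integrable (fun x ↦ cmp v j x *
      conv (𝓕⁻ (dS (stdVec k) σ) : 𝓢(E3, ℂ)) (cmp w l) x) volume := fun v w j k l ↦
    integrable_mul_of_L2 (memLp_cmp v j) (memLp_conv _ (memLp_cmp w l))
  have h : ∀ v w : Lp E3 2 (volume : Measure E3), ∀ j k l k' l',
      ∫ x, cmp v j x * (conv (𝓕⁻ (dS (stdVec k) σ) : 𝓢(E3, ℂ)) (cmp w l) -
        conv (𝓕⁻ (dS (stdVec k') σ) : 𝓢(E3, ℂ)) (cmp w l')) x =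
      (∫ x, cmp v j x * conv (𝓕⁻ (dS (stdVec k) σ) : 𝓢(E3, ℂ)) (cmp w l) x) -
      ∫ x, cmp v j x * conv (𝓕⁻ (dS (stdVec k') σ) : 𝓢(E3, ℂ)) (cmp w l') x := by
    intro v w j k l k' l'
    rw [← integral_sub (I v w j k l) (I v w j k' l')]
    simp only [Pi.sub_apply, mul_sub]
  have s := fun j k l ↦ integral_mul_conv_dS hσ (stdVec k) (memLp_cmp u j) (memLp_cmp a l)
  simp only [helForm, Fin.sum_univ_three, curlConv, Matrix.cons_val_zero, Matrix.cons_val_one,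
    Matrix.cons_val, h, s]
  ring

end

/-! ### Testing the Euler equations with mollified curls -/

section

variable {σ : 𝓢(E3, ℂ)}

theorem exists_schwartz_eq_conv (τ κ : 𝓢(E3, ℂ)) :
    ∃ Φ : 𝓢(E3, ℂ), ∀ x, Φ x = conv (𝓕⁻ τ : 𝓢(E3, ℂ)) κ x := by
  refine ⟨𝓕⁻ (mulS τ (𝓕 κ)), fun x ↦ ?_⟩
  rw [conv_eq_fourierInv' τ (memLp_schwartz κ 2), SchwartzMap.fourierInv_coe,
    fourierInv_eq_exp, fourierInv_eq_exp]
  refine integral_congr_ae ?_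
  filter_upwards [hat_schwartz κ] with ξ hξ
  rw [hξ, mulS_apply]

/-- A Schwartz vector field as an element of `L²`. -/
def schwartzField (f : 𝓢(E3, E3)) : Lp E3 2 (volume : Measure E3) :=
  SchwartzMap.toLpCLM ℝ E3 2 (volume : Measure E3) f

theorem exists_schwartz_eq_curlConv (σ : 𝓢(E3, ℂ)) (f : 𝓢(E3, E3)) (j : Fin 3) :
    ∃ Φ : 𝓢(E3, ℂ), ∀ x, Φ x = curlConv σ (schwartzField f) j x := by
  have h : ∀ i, ∃ κ : 𝓢(E3, ℂ), cmp (schwartzField f) i =ᵐ[volume] κ := fun i ↦ by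
    refine ⟨SchwartzMap.postcompCLM (𝕜 := ℝ)
      (Complex.ofRealCLM.comp (EuclideanSpace.proj (𝕜 := ℝ) i)) f, ?_⟩
    filter_upwards [SchwartzMap.coeFn_toLp f 2 (volume : Measure E3)] with x hx
    rw [SchwartzMap.postcompCLM_apply, cmp]
    simp only [schwartzField, SchwartzMap.toLpCLM_apply, hx]
    rfl
  choose κ hκ using h
  choose Ψ hΨ using fun (a l : Fin 3) ↦ exists_schwartz_eq_conv (dS (stdVec a) σ) (κ l)
  have hs : ∀ a l x, Ψ a l x = conv (𝓕⁻ (dS (stdVec a) σ) : 𝓢(E3, ℂ)) (cmp (schwartzField f) l) x :=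
    fun a l x ↦ by rw [hΨ, conv_congr_right _ (hκ l)]
  fin_cases j
  · exact ⟨Ψ 1 2 - Ψ 2 1, fun x ↦ by rw [sub_apply, hs, hs]; rfl⟩
  · exact ⟨Ψ 2 0 - Ψ 0 2, fun x ↦ by rw [sub_apply, hs, hs]; rfl⟩
  · exact ⟨Ψ 0 1 - Ψ 1 0, fun x ↦ by rw [sub_apply, hs, hs]; rfl⟩

/-- The divergence-free test field built from a mollified curl. -/
theorem exists_testField (σ : 𝓢(E3, ℂ)) (f : 𝓢(E3, E3)) (θ : ℂ →L[ℝ] ℝ) :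
    ∃ ψ : 𝓢(E3, E3), (∀ x j, ψ x j = θ (curlConv σ (schwartzField f) j x)) ∧
      ∀ x i j, (fderiv ℝ ψ x (stdVec i)) j =
        θ (curlConv (dS (stdVec i) σ) (schwartzField f) j x) := by
  choose Φ hΦ using exists_schwartz_eq_curlConv σ f
  set L : Fin 3 → ℂ →L[ℝ] E3 := fun j ↦ θ.smulRight (stdVec j) with hL
  set ψ : 𝓢(E3, E3) := ∑ j, SchwartzMap.postcompCLM (𝕜 := ℝ) (L j) (Φ j) with hψ
  have h1 : ∀ x, ψ x = ∑ j, L j (Φ j x) := fun x ↦ by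
    rw [hψ, sum_apply]
    rfl
  have hc : ∀ (c : Fin 3 → ℂ) j, (∑ k, L k (c k)) j = θ (c j) := fun c j ↦ by
    simp [hL, stdVec, Pi.single_apply]
  refine ⟨ψ, fun x j ↦ by rw [h1, hc, hΦ], fun x i j ↦ ?_⟩
  have h2 : HasFDerivAt ψ (∑ j, (L j).comp (fderiv ℝ (Φ j) x)) x := by
    have : (ψ : E3 → E3) = fun x ↦ ∑ j, L j (Φ j x) := funext h1
    rw [this]
    exact HasFDerivAt.fun_sum fun j _ ↦
      (L j).hasFDerivAt.comp x ((Φ j).differentiable x).hasFDerivAt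
  rw [h2.fderiv, sum_apply]
  simp only [ContinuousLinearMap.comp_apply]
  rw [hc, (funext (hΦ j) : (Φ j : E3 → ℂ) = _), fderiv_curlConv]

theorem re_linear_mul (θ : ℂ →L[ℝ] ℝ) (c : ℝ) (z : ℂ) : θ (c * z) = c * θ z := by
  rw [← smul_eq_mul c, ← map_smul, Complex.real_smul]

/-- The test field is independent of time and is a curl, hence divergence free, so the pressure is
absent. The real functional θ makes it real valued while still recovering complex forms from their
real and imaginary parts. -/
theorem helForm_identity_schwartz {τ : ℝ} {u : ℝ → Lp E3 2 (volume : Measure E3)}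
    (hu : IsWeakEulerSolution τ u) (θ : ℂ →L[ℝ] ℝ) (f : 𝓢(E3, E3)) {t : ℝ} (ht : t ∈ Icc 0 τ) :
    θ (helForm σ (u t) (schwartzField f)) - θ (helForm σ (u 0) (schwartzField f)) =
      ∫ r in (0 : ℝ)..t, θ (rateForm σ (u r) (u r) (schwartzField f)) := by
  obtain ⟨ψ, h1, h2⟩ := exists_testField σ f θ
  have hdiv : ∀ x, ∑ i : Fin 3, (fderiv ℝ ψ x (stdVec i)) i = 0 := fun x ↦ by
    simp only [h2]
    rw [← map_sum, sum_curlConv_dS, map_zero]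
  have hd0 : ∀ t, HasDerivWithinAt (fun _ : ℝ ↦ ψ) 0 (Icc 0 τ) t := fun t ↦ by
    have := hasFDerivWithinAt_const (𝕜 := ℝ) ψ t (Icc 0 τ)
    rwa [← ContinuousLinearMap.toSpanSingleton_zero ℝ] at this
  have hw := hu.weak (fun _ ↦ ψ) (fun _ ↦ 0) continuousOn_const
    (fun t _ ↦ hd0 t) (fun t _ ↦ hdiv) t ht
  have e1 : ∀ v : Lp E3 2 (volume : Measure E3),
      ∫ x, inner ℝ (v x) (ψ x) = θ (helForm σ v (schwartzField f)) := fun v ↦ by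
    have : helForm σ v (schwartzField f) =
        ∫ x, ∑ j, cmp v j x * curlConv σ (schwartzField f) j x := by
      rw [helForm, integral_finsetSum _ fun j _ ↦ integrable_cmp_mul_curlConv j]
    rw [this, ← θ.integral_comp_comm (integrable_finsetSum _ fun j _ ↦
      integrable_cmp_mul_curlConv j)]
    refine integral_congr_ae (Eventually.of_forall fun x ↦ ?_)
    simp only [map_sum, cmp, re_linear_mul, PiLp.inner_apply, h1]
    refine Finset.sum_congr rfl fun j _ ↦ ?_
    simp [mul_comm]
  have e2 : ∀ v : Lp E3 2 (volume : Measure E3),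
      ∫ x, inner ℝ (fderiv ℝ ψ x (v x)) (v x) = θ (rateForm σ v v (schwartzField f)) := fun v ↦ by
    have I : ∀ i j : Fin 3, Integrable (fun x ↦ cmp v i x * cmp v j x *
        curlConv (dS (stdVec i) σ) (schwartzField f) j x) volume := fun i j ↦
      integrable_cmp_mul_cmp_mul_curlConv i j j
    have : rateForm σ v v (schwartzField f) = ∫ x, ∑ i, ∑ j, cmp v i x * cmp v j x *
        curlConv (dS (stdVec i) σ) (schwartzField f) j x := by
      rw [rateForm, integral_finsetSum _ fun i _ ↦ integrable_finsetSum _ fun j _ ↦ I i j]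
      exact Finset.sum_congr rfl fun i _ ↦ (integral_finsetSum _ fun j _ ↦ I i j).symm
    rw [this, ← θ.integral_comp_comm (integrable_finsetSum _ fun i _ ↦
      integrable_finsetSum _ fun j _ ↦ I i j)]
    refine integral_congr_ae (Eventually.of_forall fun x ↦ ?_)
    have hv : v x = ∑ i, v x i • stdVec i := by
      ext k
      simp [stdVec, Pi.single_apply]
    have hd : ∀ j, (fderiv ℝ ψ x (v x)) j =
        ∑ i, v x i * θ (curlConv (dS (stdVec i) σ) (schwartzField f) j x) := fun j ↦ by
      conv_lhs => rw [hv]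
      simp only [map_sum, map_smul, ← h2]
      simp
    simp only [map_sum, cmp, mul_assoc, re_linear_mul, PiLp.inner_apply, hd]
    rw [Finset.sum_comm]
    refine Finset.sum_congr rfl fun j _ ↦ ?_
    simp only [RCLike.inner_apply, conj_trivial, Finset.mul_sum]
    refine Finset.sum_congr rfl fun i _ ↦ ?_
    ring
  simp only [e1, e2] at hw
  rw [← hw]
  simp

/-- The evolution of the mollified helicity of a weak solution. -/
theorem helForm_evolution {τ : ℝ} {u : ℝ → Lp E3 2 (volume : Measure E3)}
    (hu : IsWeakEulerSolution τ u) (hσ : ∀ ξ, σ (-ξ) = σ ξ) (θ : ℂ →L[ℝ] ℝ) {t : ℝ}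
    (ht : t ∈ Icc 0 τ) :
    θ (helForm σ (u t) (u t)) - θ (helForm σ (u 0) (u 0)) =
      2 * ∫ r in (0 : ℝ)..t, θ (rateForm σ (u r) (u r) (u r)) := by
  obtain ⟨α, hα⟩ := exists_helForm_clm σ θ
  obtain ⟨G, hG, ⟨C, hC⟩, hGe⟩ := exists_rateForm_clm σ θ
  have : Fact ((2 : ℝ≥0∞) ≠ ⊤) := ⟨by norm_num⟩
  have hD := SchwartzMap.denseRange_toLpCLM (E := E3) (F := E3) (p := 2)
    (μ := (volume : Measure E3)) (by norm_num)
  have := energy_identity hu.weaklyContinuous α hG hC (D := range schwartzField) hD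
    (fun v w ↦ by rw [hα, hα, helForm_comm hσ]) (by
      rintro _ ⟨f, rfl⟩ t ht
      simp only [hα, hGe]
      exact helForm_identity_schwartz hu θ f ht) ht
  simpa only [hα, hGe] using this

theorem aestronglyMeasurable_rateForm {τ : ℝ} {u : ℝ → Lp E3 2 (volume : Measure E3)}
    (hu : IsWeakEulerSolution τ u) (σ : 𝓢(E3, ℂ)) (θ : ℂ →L[ℝ] ℝ) :
    AEStronglyMeasurable (fun r ↦ θ (rateForm σ (u r) (u r) (u r)))
      (volume.restrict (Icc 0 τ)) := by
  obtain ⟨G, hG, ⟨C, hC⟩, hGe⟩ := exists_rateForm_clm σ θ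
  have : Fact ((2 : ℝ≥0∞) ≠ ⊤) := ⟨by norm_num⟩
  have := (integrableOn_quadratic hu.weaklyContinuous hG hC).2.aestronglyMeasurable
  simpa only [hGe] using this

end

/-- The product u_i u_j is only in L¹, so Parseval's identity is unavailable; boundedness of `g`
makes Fubini's theorem applicable instead. -/
theorem integral_mul_conv_of_even {k : 𝓢(E3, ℂ)} (hk : ∀ y, k (-y) = k y) {f g : E3 → ℂ} {B : ℝ}
    (hf : Integrable f volume) (hg : AEStronglyMeasurable g volume) (hB : ∀ x, ‖g x‖ ≤ B) :
    ∫ x, f x * conv k g x = ∫ x, (∫ y, k y * f (x - y)) * g x := by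
  have I1 : Integrable (fun p : E3 × E3 ↦ f p.1 * k p.2 * g (p.1 - p.2)) (volume.prod volume) :=
    (hf.mul_prod k.integrable).mul_bdd (aestronglyMeasurable_comp_sub hg)
      (Eventually.of_forall fun p ↦ hB _)
  have I2 : Integrable (fun p : E3 × E3 ↦ k p.2 * f (p.1 - p.2) * g p.1)
      (volume.prod volume) :=
    ((k.integrable (μ := volume)).convolution_integrand (ContinuousLinearMap.mul ℂ ℂ) hf).mul_bdd
      hg.comp_fst (Eventually.of_forall fun p ↦ hB _)
  have e1 : ∀ y, ∫ x, f x * k y * g (x - y) = ∫ x, k (-y) * f (x + y) * g x := fun y ↦ by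
    rw [← integral_add_right_eq_self _ y]
    refine integral_congr_ae (Eventually.of_forall fun x ↦ ?_)
    simp only [add_sub_cancel_right, hk]
    ring
  calc ∫ x, f x * conv k g x = ∫ x, ∫ y, f x * k y * g (x - y) := by
        simp only [conv, ← integral_const_mul, mul_assoc]
    _ = ∫ y, ∫ x, f x * k y * g (x - y) := integral_integral_swap I1
    _ = ∫ y, ∫ x, k y * f (x - y) * g x := by
        simp only [e1]
        rw [← integral_comp_neg]
        simp only [neg_neg, ← sub_eq_add_neg]
    _ = ∫ x, ∫ y, k y * f (x - y) * g x := (integral_integral_swap I2).symm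
    _ = _ := by simp only [integral_mul_const]

theorem fourierInv_neg_of_even {σ : 𝓢(E3, ℂ)} (hσ : ∀ ξ, σ (-ξ) = σ ξ) (y : E3) :
    (𝓕⁻ σ : 𝓢(E3, ℂ)) (-y) = (𝓕⁻ σ : 𝓢(E3, ℂ)) y := by
  rw [SchwartzMap.fourierInv_coe, fourierInv_eq_exp, fourierInv_eq_exp, ← integral_comp_neg]
  simp only [hσ, inner_neg_neg]

section

variable {u : Lp E3 2 (volume : Measure E3)}

theorem curlConv_dS_mulS (σ : 𝓢(E3, ℂ)) (e : E3) (j : Fin 3) :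
    curlConv (dS e (mulS σ σ)) u j = conv (𝓕⁻ σ : 𝓢(E3, ℂ)) (curlConv (dS e σ) u j) := by
  rw [conv_eq_fourierInv' σ (memLp_curlConv _ j), ← fourierInv_schwartz_mul_vortHat]
  ext x
  rw [fourierInv_eq_exp, fourierInv_eq_exp]
  refine integral_congr_ae ?_
  filter_upwards [hat_curlConv (u := u) (dS e σ) j] with ξ hξ
  rw [hξ, dS_apply, dS_apply, mulS_apply]
  ring

/-- The mollified helicity carries the square of the symbol of S_Q. One factor is moved onto u_i u_j
and the other stays on the vorticity, which gives exactly one half of the flux. -/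
theorem rateForm_lowSchwartz (hu : HHalf u) (χ : Cutoff) (Q : ℕ) :
    rateForm (mulS (χ.lowSchwartz Q) (χ.lowSchwartz Q)) u u u = ∫ x, velFlux χ Q u x := by
  have hI := integrable_velFlux_term hu χ Q
  simp only [velFlux]
  rw [integral_finsetSum _ fun i _ ↦ integrable_finsetSum _ fun j _ ↦ hI i j]
  refine Finset.sum_congr rfl fun i _ ↦ ?_
  rw [integral_finsetSum _ fun j _ ↦ hI i j]
  refine Finset.sum_congr rfl fun j _ ↦ ?_
  obtain ⟨C, -, hC⟩ := exists_curlConv_bound (dS (stdVec i) (χ.lowSchwartz Q))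
  rw [curlConv_dS_mulS, integral_mul_conv_of_even
    (fourierInv_neg_of_even (lowSchwartz_neg χ Q))
    (integrable_mul_of_L2 (memLp_cmp u i) (memLp_cmp u j)) (memLp_curlConv _ j).1 (hC u j).1]
  simp only [low_tensorVel_eq]
  rfl

end

/-! ### Convergence of the mollified helicity -/

section

variable {u : Lp E3 2 (volume : Measure E3)}

theorem helForm_eq_hat (σ : 𝓢(E3, ℂ)) :
    helForm σ u u = ∑ j, ∫ ξ, σ ξ * (vortHat u j ξ * cmpHat u j (-ξ)) := by
  refine Finset.sum_congr rfl fun j _ ↦ ?_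
  simp only [mul_comm (cmp u j _)]
  rw [integral_mul_eq_hat (memLp_curlConv σ j) (memLp_cmp u j)]
  refine integral_congr_ae ?_
  filter_upwards [hat_curlConv (u := u) σ j] with ξ hξ
  rw [hξ, mul_assoc]
  rfl

theorem helicity_eq_hat (hu : HHalf u) :
    helicity u = ∑ j, ∫ ξ, vortHat u j ξ * cmpHat u j (-ξ) := by
  refine Finset.sum_congr rfl fun j _ ↦ ?_
  have h := memLp_wt_vortHat hu j
  refine sobolevPairing_eq (hasFourier_vorticity u j) (hasFourier_comp u j)
    (locallyIntegrable_of_wt h) (memLp_cmpHat u j).locInt ?_ ?_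
  · convert h using 3
    norm_num
  · convert hu j using 3
    norm_num

theorem integrable_vortHat_mul_cmpHat (hu : HHalf u) (j : Fin 3) :
    Integrable (fun ξ ↦ vortHat u j ξ * cmpHat u j (-ξ)) volume := by
  have := integrable_mul_of_L2 (memLp_wt_vortHat hu j) (memLp_comp_neg (hu j))
  refine this.congr (Eventually.of_forall fun ξ ↦ ?_)
  have h1 : (wt (1 / 4) ξ : ℂ) * wt (-(1 / 4)) ξ = 1 := by exact_mod_cast wt_mul_wt_neg _ _
  simp only [wt_neg]
  linear_combination (vortHat u j ξ * cmpHat u j (-ξ)) * h1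

/-- On the Fourier side the integrand is dominated by a multiple of |ω̂ û|, integrable because the
weights of H^{-1/2} and H^{1/2} cancel, while the squared symbols tend to 1. -/
theorem tendsto_helForm (hu : HHalf u) (χ : Cutoff) :
    Tendsto (fun Q : ℕ ↦ helForm (mulS (χ.lowSchwartz Q) (χ.lowSchwartz Q)) u u) atTop
      (𝓝 (helicity u)) := by
  obtain ⟨C, hC⟩ := χ.norm_sym_le
  simp only [helForm_eq_hat, helicity_eq_hat hu]
  refine tendsto_finsetSum _ fun j _ ↦ ?_
  have hi := integrable_vortHat_mul_cmpHat hu j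
  refine tendsto_integral_of_dominated_convergence
    (fun ξ ↦ C * C * ‖vortHat u j ξ * cmpHat u j (-ξ)‖) (fun Q ↦ ?_) (hi.norm.const_mul _)
    (fun Q ↦ Eventually.of_forall fun ξ ↦ ?_) (Eventually.of_forall fun ξ ↦ ?_)
  · exact (SchwartzMap.continuous _).aestronglyMeasurable.mul hi.aestronglyMeasurable
  · rw [norm_mul, mulS_apply, norm_mul, χ.lowSchwartz_eq]
    have := hC (Q + 1) ξ
    gcongr
    exact (norm_nonneg _).trans this
  · have h := (tendsto_add_atTop_iff_nat 1).2 (χ.tendsto_sym ξ)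
    have := (h.mul h).mul_const (vortHat u j ξ * cmpHat u j (-ξ))
    simp only [mul_one, one_mul] at this
    refine this.congr fun Q ↦ ?_
    rw [mulS_apply, χ.lowSchwartz_eq]
    push_cast
    rfl

/-! ### Regularity at every time -/

theorem eLpNorm_wt_cmpHat_le (i : Fin 3) :
    eLpNorm (fun ξ ↦ wt (1 / 4) ξ * cmpHat u i ξ) 2 volume ≤ sobolevNorm (1 / 2) (toDist u) := by
  refine le_iInf fun g ↦ le_iInf fun hg ↦ ?_
  have hgi : MemLp (fun x ↦ g x i) 2 volume :=
    (EuclideanSpace.proj (𝕜 := ℂ) i : C3 →L[ℂ] ℂ).comp_memLp' (Lp.memLp g)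
  have hF : besselPotential E3 ℂ (1 / 2) (comp u i) =
      (hgi.toLp _ : Lp ℂ 2 (volume : Measure E3)) := by
    ext ψ
    rw [← bessel_toDist_apply, hg, toTemperedDistribution_apply_coord,
      Lp.toTemperedDistribution_apply]
    refine integral_congr_ae ?_
    filter_upwards [hgi.coeFn_toLp] with x h
    rw [h, smul_eq_mul]
  have h := (hasFourier_comp u i).bessel_ae_eq (memLp_cmpHat u i).locInt hF
  norm_num at h ⊢
  rw [← eLpNorm_congr_ae h, eLpNorm_hat (Lp.memLp _), Lp.enorm_def,
    eLpNorm_congr_ae hgi.coeFn_toLp]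
  exact eLpNorm_mono fun x ↦ PiLp.norm_apply_le (g x) i

theorem exists_conv_clm (κ : 𝓢(E3, ℂ)) (i : Fin 3) (x : E3) (θ : ℂ →L[ℝ] ℝ) :
    ∃ L : Lp E3 2 (volume : Measure E3) →L[ℝ] ℝ, ∀ v, L v = θ (conv κ (cmp v i) x) := by
  refine ⟨LinearMap.mkContinuous
    { toFun := fun v ↦ θ (conv κ (cmp v i) x)
      map_add' := fun v w ↦ by
        rw [conv_congr_right _ (cmp_add v w i), conv_add_right _ (memLp_cmp v i) (memLp_cmp w i),
          Pi.add_apply, map_add]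
      map_smul' := fun c v ↦ by
        rw [conv_congr_right _ (cmp_smul v c i), conv_smul_right, Pi.smul_apply, smul_eq_mul,
          re_linear_mul]
        rfl }
    (‖θ‖ * (eLpNorm κ 2 volume).toReal) fun v ↦ ?_, fun v ↦ rfl⟩
  refine (θ.le_opNorm _).trans ?_
  rw [mul_assoc]
  refine mul_le_mul_of_nonneg_left ((norm_conv_apply_le κ (memLp_cmp v i) x).trans ?_)
    (norm_nonneg _)
  exact mul_le_mul_of_nonneg_left (toReal_eLpNorm_cmp_le v i) (by positivity)

/-- Pointwise evaluation after convolution with a Schwartz kernel is continuous on L², so weak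
continuity in time becomes pointwise convergence in space. -/
theorem continuousOn_conv_cmp {s : Set ℝ} {u : ℝ → Lp E3 2 (volume : Measure E3)}
    (hu : ∀ v, ContinuousOn (fun t ↦ inner ℝ (u t) v) s) (κ : 𝓢(E3, ℂ)) (i : Fin 3) (x : E3) :
    ContinuousOn (fun t ↦ conv κ (cmp (u t) i) x) s := by
  have h : ∀ θ : ℂ →L[ℝ] ℝ, ContinuousOn (fun t ↦ θ (conv κ (cmp (u t) i) x)) s := fun θ ↦ by
    obtain ⟨L, hL⟩ := exists_conv_clm κ i x θ
    simp only [← hL]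
    exact tendsto_clm_of_weakly_continuous hu L
  have h1 := Complex.continuous_ofReal.comp_continuousOn (h Complex.reCLM)
  have h2 := Complex.continuous_ofReal.comp_continuousOn (h Complex.imCLM)
  refine (h1.add (h2.mul_const Complex.I)).congr fun t _ ↦ ?_
  exact (Complex.re_add_im _).symm

theorem eLpNorm_conv_wtS (χ : Cutoff) (N : ℕ) (i : Fin 3) :
    eLpNorm (conv (𝓕⁻ (wtS (1 / 4) (χ.sym N)) : 𝓢(E3, ℂ)) (cmp u i)) 2 volume =
      eLpNorm (fun ξ ↦ χ.sym N ξ * (wt (1 / 4) ξ * cmpHat u i ξ)) 2 volume := by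
  rw [← eLpNorm_hat (memLp_conv _ (memLp_cmp u i)),
    eLpNorm_congr_ae (hat_conv _ (memLp_cmp u i))]
  refine congrArg (fun f ↦ eLpNorm f 2 volume) (funext fun ξ ↦ ?_)
  rw [wtS_apply, cmpHat]
  ring

/-- The exceptional times are removed by lower semicontinuity: t is approached by times obeying the
essential bound, first for frequency-truncated fields and then without truncation. -/
theorem hHalf_of_memLinftyHHalf {τ : ℝ} (hτ : 0 < τ) {u : ℝ → Lp E3 2 (volume : Measure E3)}
    (hu : ∀ v, ContinuousOn (fun t ↦ inner ℝ (u t) v) (Icc 0 τ)) (h : MemLinftyHHalf τ u)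
    (χ : Cutoff) {t : ℝ} (ht : t ∈ Icc 0 τ) : HHalf (u t) := by
  intro i
  obtain ⟨M, hM⟩ := h
  obtain ⟨C, hC⟩ := χ.norm_sym_le
  have hm : ∀ v : Lp E3 2 (volume : Measure E3),
      AEStronglyMeasurable (fun ξ ↦ wt (1 / 4) ξ * cmpHat v i ξ) volume := fun v ↦
    (Complex.continuous_ofReal.comp (continuous_wt _)).aestronglyMeasurable.mul
      (memLp_cmpHat v i).1
  have hs : ∃ s : ℕ → ℝ, (∀ n, s n ∈ Icc 0 τ ∧ sobolevNorm (1 / 2) (toDist (u (s n))) ≤ M) ∧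
      Tendsto s atTop (𝓝 t) := by
    -- A set of full measure is dense; intersecting with the open interval keeps the approximating
    -- times admissible and, as τ > 0, still reaches both endpoints.
    have hd := Measure.dense_of_ae ((ae_restrict_iff' measurableSet_Icc).1 hM)
    have hcl : t ∈ closure (Ioo 0 τ) := by rwa [closure_Ioo hτ.ne]
    have := closure_mono (hd.open_subset_closure_inter isOpen_Ioo) hcl
    rw [closure_closure] at this
    obtain ⟨s, hs, hst⟩ := mem_closure_iff_seq_limit.1 this
    exact ⟨s, fun n ↦ ⟨Ioo_subset_Icc_self (hs n).1, (hs n).2 (Ioo_subset_Icc_self (hs n).1)⟩, hst⟩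
  obtain ⟨s, hs, hst⟩ := hs
  -- For fixed N the truncated fields converge pointwise along the chosen times, and Fatou's lemma
  -- gives a bound independent of N. A second use of Fatou's lemma removes N.
  have hb : ∀ N : ℕ, eLpNorm (fun ξ ↦ χ.sym N ξ * (wt (1 / 4) ξ * cmpHat (u t) i ξ)) 2 volume ≤
      ENNReal.ofReal C * M := by
    intro N
    rw [← eLpNorm_conv_wtS]
    refine (Lp.eLpNorm_lim_le_liminf_eLpNorm
      (f := fun n ↦ conv (𝓕⁻ (wtS (1 / 4) (χ.sym N)) : 𝓢(E3, ℂ)) (cmp (u (s n)) i))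
      (fun n ↦ (memLp_conv _ (memLp_cmp _ i)).1) _ (Eventually.of_forall fun x ↦ ?_)).trans ?_
    · exact (continuousOn_conv_cmp hu _ i x t ht).tendsto.comp
        (tendsto_nhdsWithin_iff.2 ⟨hst, Eventually.of_forall fun n ↦ (hs n).1⟩)
    · refine liminf_le_of_le (by isBoundedDefault) fun b hb ↦ ?_
      obtain ⟨n, hn⟩ := hb.exists
      refine hn.trans ?_
      rw [eLpNorm_conv_wtS]
      refine (eLpNorm_le_mul_eLpNorm_of_ae_le_mul (g := fun ξ ↦ wt (1 / 4) ξ * cmpHat (u (s n)) i ξ)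
        (c := C) (Eventually.of_forall fun ξ ↦ ?_) 2).trans ?_
      · rw [norm_mul]
        exact mul_le_mul_of_nonneg_right (hC _ _) (norm_nonneg _)
      · gcongr
        exact (eLpNorm_wt_cmpHat_le i).trans (hs n).2
  refine ⟨hm _, ?_⟩
  refine (Lp.eLpNorm_lim_le_liminf_eLpNorm
    (f := fun N : ℕ ↦ fun ξ ↦ χ.sym N ξ * (wt (1 / 4) ξ * cmpHat (u t) i ξ))
    (fun N ↦ (χ.sym N).continuous.aestronglyMeasurable.mul (hm _)) _
    (Eventually.of_forall fun ξ ↦ ?_)).trans_lt ?_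
  · have := (χ.tendsto_sym ξ).mul_const ((wt (1 / 4) ξ : ℂ) * cmpHat (u t) i ξ)
    simpa only [one_mul] using this
  · refine lt_of_le_of_lt (liminf_le_of_le (by isBoundedDefault) fun b hb' ↦ ?_)
      (ENNReal.mul_lt_top (ENNReal.ofReal_lt_top (r := C)) (ENNReal.coe_lt_top (r := M)))
    obtain ⟨n, hn⟩ := hb'.exists
    exact hn.trans (hb n)

end

/-! ### Conservation of helicity -/

section

theorem tendsto_const_mul_locSum_rpow (χ : Cutoff) {u : Lp E3 2 (volume : Measure E3)}
    (h : MemBesovC χ (2 / 3) 3 (toDist u)) {K : ℝ≥0∞} (hK : K ≠ ⊤) :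
    Tendsto (fun Q : ℕ ↦ K * locSum χ (toDist u) Q ^ (3 / 2 : ℝ)) atTop (𝓝 0) := by
  have h1 := ((ENNReal.continuous_rpow_const (y := 3 / 2)).tendsto 0).comp (tendsto_locSum χ h)
  rw [ENNReal.zero_rpow_of_pos (by norm_num)] at h1
  simpa using! ENNReal.Tendsto.const_mul h1 (Or.inr hK)

theorem eight_mul_fluxConst_ne_top (χ : Cutoff) : 8 * fluxConst χ ≠ ⊤ :=
  ENNReal.mul_ne_top (by norm_num) (fluxConst_lt_top χ).ne

theorem enorm_rateForm_le {u : Lp E3 2 (volume : Measure E3)} (hu : HHalf u) (hd : IsDivFree u)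
    (χ : Cutoff) (Q : ℕ) (θ : ℂ →L[ℝ] ℝ) :
    ‖θ (rateForm (mulS (χ.lowSchwartz Q) (χ.lowSchwartz Q)) u u u)‖ₑ ≤
      ‖θ‖ₑ * (8 * fluxConst χ) * locSum χ (toDist u) Q ^ (3 / 2 : ℝ) := by
  rw [rateForm_lowSchwartz hu]
  refine (θ.le_opENorm _).trans ?_
  rw [mul_assoc]
  gcongr
  refine le_trans ?_ (enorm_helicityFlux_le hu hd χ Q)
  rw [helicityFlux_eq hu hd, enorm_mul]
  refine le_mul_of_one_le_left (zero_le) ?_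
  rw [← ofReal_norm]
  norm_num

theorem locSum_rpow_le (χ : Cutoff) (f : 𝓢'(E3, C3)) (Q : ℕ) :
    locSum χ f Q ^ (3 / 2 : ℝ) ≤
      (∑' m : ℤ, locKernel m) ^ (3 / 2 : ℝ) * besovNorm χ (2 / 3) 3 f ^ 3 := by
  have h : (besovNorm χ (2 / 3) 3 f ^ 2) ^ (3 / 2 : ℝ) = besovNorm χ (2 / 3) 3 f ^ 3 := by
    rw [← ENNReal.rpow_natCast, ← ENNReal.rpow_mul, ← ENNReal.rpow_natCast]
    norm_num
  rw [← h, ← ENNReal.mul_rpow_of_nonneg _ _ (by norm_num)]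
  exact ENNReal.rpow_le_rpow (locSum_le_besovNorm χ f Q) (by norm_num)

variable {τ : ℝ} {u : ℝ → Lp E3 2 (volume : Measure E3)}

/-- The supremum over Q is at most a multiple of the cube of the Besov norm, integrable by
hypothesis, and for almost every time the localized sum tends to 0. -/
theorem tendsto_lintegral_rateForm (χ : Cutoff) (hu : IsWeakEulerSolution τ u)
    (hh : ∀ t ∈ Icc 0 τ, HHalf (u t)) (hB : MemL3Besov χ τ u) (θ : ℂ →L[ℝ] ℝ) :
    Tendsto (fun Q : ℕ ↦ ∫⁻ r in Icc 0 τ,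
      ‖θ (rateForm (mulS (χ.lowSchwartz Q) (χ.lowSchwartz Q)) (u r) (u r) (u r))‖ₑ) atTop
      (𝓝 0) := by
  set F : ℕ → ℝ → ℝ≥0∞ := fun Q r ↦
    ‖θ (rateForm (mulS (χ.lowSchwartz Q) (χ.lowSchwartz Q)) (u r) (u r) (u r))‖ₑ with hF
  set K : ℝ≥0∞ := ‖θ‖ₑ * (8 * fluxConst χ) with hK
  have hKt : K ≠ ⊤ := ENNReal.mul_ne_top enorm_ne_top (eight_mul_fluxConst_ne_top χ)
  have hFb : ∀ r ∈ Icc 0 τ, ∀ Q, F Q r ≤ K * locSum χ (toDist (u r)) Q ^ (3 / 2 : ℝ) :=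
    fun r hr Q ↦ enorm_rateForm_le (hh r hr) (hu.divFree r hr) χ Q θ
  have hFm : ∀ Q, AEMeasurable (F Q) (volume.restrict (Icc 0 τ)) := fun Q ↦
    (aestronglyMeasurable_rateForm hu _ θ).enorm
  have h := tendsto_lintegral_of_dominated_convergence' (μ := volume.restrict (Icc 0 τ))
    (F := F) (f := fun _ ↦ 0) (fun r ↦ ⨆ Q, F Q r) hFm
    (fun Q ↦ Eventually.of_forall fun r ↦ le_iSup (fun Q ↦ F Q r) Q) ?_ ?_
  · simpa using h
  · set S : ℝ≥0∞ := (∑' m : ℤ, locKernel m) ^ (3 / 2 : ℝ) with hS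
    have hSt : S ≠ ⊤ := (ENNReal.rpow_lt_top_of_nonneg (by norm_num) tsum_locKernel_lt_top.ne).ne
    refine ((setLIntegral_mono' measurableSet_Icc fun r hr ↦ iSup_le fun Q ↦
      (hFb r hr Q).trans (mul_le_mul_right (locSum_rpow_le χ _ Q) K)).trans_lt ?_).ne
    simp only [← mul_assoc]
    rw [lintegral_const_mul' _ _ (ENNReal.mul_ne_top hKt hSt)]
    exact ENNReal.mul_lt_top (ENNReal.mul_ne_top hKt hSt).lt_top hB.2
  · filter_upwards [hB.1, ae_restrict_mem measurableSet_Icc] with r hr hr'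
    exact tendsto_of_tendsto_of_tendsto_of_le_of_le tendsto_const_nhds
      (tendsto_const_mul_locSum_rpow χ hr hKt) (fun _ ↦ zero_le) (hFb r hr')

/-- The difference of mollified helicities equals the time integral of a rate that tends to 0, while
it converges to the difference of helicities; real and imaginary parts are treated separately. -/
theorem helicity_conserved (χ : Cutoff) (hτ : 0 < τ) (hu : IsWeakEulerSolution τ u)
    (hh : ∀ t ∈ Icc 0 τ, HHalf (u t)) (hB : MemL3Besov χ τ u) {t : ℝ} (ht : t ∈ Icc 0 τ) :
    helicity (u t) = helicity (u 0) := by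
  have key : ∀ θ : ℂ →L[ℝ] ℝ, θ (helicity (u t)) = θ (helicity (u 0)) := by
    intro θ
    have h1 := ((θ.continuous.tendsto _).comp (tendsto_helForm (hh t ht) χ)).sub
      ((θ.continuous.tendsto _).comp (tendsto_helForm (hh 0 ⟨le_rfl, hτ.le⟩) χ))
    have h2 : Tendsto (fun Q : ℕ ↦ 2 * ∫ r in (0 : ℝ)..t,
        θ (rateForm (mulS (χ.lowSchwartz Q) (χ.lowSchwartz Q)) (u r) (u r) (u r))) atTop
        (𝓝 (2 * 0)) := by
      refine Tendsto.const_mul 2 (tendsto_zero_iff_enorm_tendsto_zero.2 ?_)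
      refine tendsto_of_tendsto_of_tendsto_of_le_of_le tendsto_const_nhds
        (tendsto_lintegral_rateForm χ hu hh hB θ) (fun _ ↦ zero_le) fun Q ↦ ?_
      rw [intervalIntegral.integral_of_le ht.1]
      exact (enorm_integral_le_lintegral_enorm _).trans
        (lintegral_mono_set (Ioc_subset_Icc_self.trans (Icc_subset_Icc_right ht.2)))
    have h3 : (fun Q : ℕ ↦ 2 * ∫ r in (0 : ℝ)..t,
        θ (rateForm (mulS (χ.lowSchwartz Q) (χ.lowSchwartz Q)) (u r) (u r) (u r))) =
        fun Q : ℕ ↦ θ (helForm (mulS (χ.lowSchwartz Q) (χ.lowSchwartz Q)) (u t) (u t)) -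
          θ (helForm (mulS (χ.lowSchwartz Q) (χ.lowSchwartz Q)) (u 0) (u 0)) := by
      ext Q
      refine (helForm_evolution hu (fun ξ ↦ ?_) θ ht).symm
      rw [mulS_apply, mulS_apply, lowSchwartz_neg]
    rw [h3, mul_zero] at h2
    exact sub_eq_zero.1 (tendsto_nhds_unique h1 h2)
  exact Complex.ext (key Complex.reCLM) (key Complex.imCLM)

end

end

end HelicityFlux

theorem mainTheorem3 (χ : Cutoff) :
    (∃ C : ℝ≥0, ∀ u : Lp E3 2 (volume : Measure E3),
      IsDivFree u → MemSobolev (1 / 2) 2 (toDist u) → ∀ Q : ℕ,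
        Integrable (fluxDensity χ Q u) ∧
          ‖helicityFlux χ Q u‖ₑ ≤ C * locSum χ (toDist u) Q ^ (3 / 2 : ℝ)) ∧
    (∀ u : Lp E3 2 (volume : Measure E3),
      IsDivFree u → MemSobolev (1 / 2) 2 (toDist u) →
      MemBesovC χ (2 / 3) 3 (toDist u) →
        Tendsto (fun Q : ℕ ↦ helicityFlux χ Q u) atTop (𝓝 0)) ∧
    (∀ τ : ℝ, 0 < τ → ∀ u : ℝ → Lp E3 2 (volume : Measure E3),
      IsWeakEulerSolution τ u → MemL3Besov χ τ u → MemLinftyHHalf τ u →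
        ∀ t ∈ Icc 0 τ, MemSobolev (1 / 2) 2 (toDist (u t)) ∧
          helicity (u t) = helicity (u 0)) := by
  refine ⟨⟨(8 * fluxConst χ).toNNReal, fun u hd hu Q ↦ ?_⟩, fun u hd hu hB ↦ ?_,
    fun τ hτ u hu hB hH t ht ↦ ?_⟩
  · rw [memSobolev_toDist_iff] at hu
    refine ⟨integrable_fluxDensity hu χ Q, ?_⟩
    rw [ENNReal.coe_toNNReal (eight_mul_fluxConst_ne_top χ)]
    exact enorm_helicityFlux_le hu hd χ Q
  · rw [memSobolev_toDist_iff] at hu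
    rw [tendsto_zero_iff_enorm_tendsto_zero]
    exact tendsto_of_tendsto_of_tendsto_of_le_of_le tendsto_const_nhds
      (tendsto_const_mul_locSum_rpow χ hB (eight_mul_fluxConst_ne_top χ)) (fun _ ↦ zero_le)
      (enorm_helicityFlux_le hu hd χ)
  · have hh : ∀ t ∈ Icc 0 τ, HHalf (u t) := fun t ht ↦
      hHalf_of_memLinftyHHalf hτ hu.weaklyContinuous hH χ ht
    exact ⟨memSobolev_toDist_iff.2 (hh t ht), helicity_conserved χ hτ hu hh hB ht⟩
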